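/- Let $X$ be a finite set of points in the plane. Its convex layers are obtained by repeatedly deleting the vertices of the convex hull; let $k$ be the number of layers, and let $R_1,\dots,R_k$ be the layers numbered from the inside ($R_1$ is the innermost layer and $R_k$ is the set of vertices of the convex hull of $X$). Put $X_0=\emptyset$ and $X_j=R_1\cup\dots\cup R_j$. The set $X$ is called a nested almost convex set if for every $1\le j\le k$: 1. no three points of $X_j$ are collinear; 2. the vertices of the convex hull of $X_j$ are exactly the points of $R_j$; 3. every triangle determined by three points of $R_j$ contains exactly one point of $X_{j-1}$ in its interior. Theorem. There is an algorithm that decides in $O(n\log n)$ time whether a given set $X$ of $n$ points in the plane is a nested almost convex set. Precisely: there are a single program $P$ for the real RAM (unit-cost operations on natural numbers: addition, truncated subtraction, comparison, with the natural numbers serving as addresses; unit-cost operations on real numbers: addition, subtraction, multiplication, comparison; integer constants only; no rounding and no conversion between real and natural numbers) and a function $T:\mathbb N\to\mathbb N$ with $T(n)=O(n\log n)$ such that, for every $n\ge 0$ and every set $X$ of $n$ distinct points of $\mathbb R^2$, given by $n$ and the coordinates of its points in any order, $P$ halts after at most $T(n)$ steps, with answer $1$ if $X$ is a nested almost convex set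 and with answer $0$ otherwise. -/

import Mathlib

open Filter Asymptotics

/-! ## Convex layers and nested almost convex sets -/

/-- The vertices of the convex hull of a planar point set. -/
def hullVertices (S : Set (ℝ × ℝ)) : Set (ℝ × ℝ) :=
  (convexHull ℝ S).extremePoints ℝ

/-- Delete the outermost convex layer. -/
def peel (S : Set (ℝ × ℝ)) : Set (ℝ × ℝ) :=
  S \ hullVertices S

/-- The number of convex layers: how often the outermost layer has to be deleted until
nothing is left. -/
noncomputable def layerCount (X : Set (ℝ × ℝ)) : ℕ :=
  sInf {i : ℕ | peel^[i] X = ∅}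

/-- The `j`-th convex layer of `X`, for `1 ≤ j ≤ layerCount X`. Layers are numbered from the
inside: layer `1` is the innermost one and layer `layerCount X` is the set of vertices of the
convex hull of `X`. -/
noncomputable def layer (X : Set (ℝ × ℝ)) (j : ℕ) : Set (ℝ × ℝ) :=
  hullVertices (peel^[layerCount X - j] X)

/-- The union of the layers `1, …, j`; it is empty for `j = 0`. -/
noncomputable def innerLayers (X : Set (ℝ × ℝ)) (j : ℕ) : Set (ℝ × ℝ) :=
  ⋃ i ∈ Set.Icc 1 j, layer X i

/-- No three distinct points of the set are collinear. -/
def InGeneralPosition (S : Set (ℝ × ℝ)) : Prop :=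
  ∀ p ∈ S, ∀ q ∈ S, ∀ r ∈ S, p ≠ q → p ≠ r → q ≠ r → ¬ Collinear ℝ {p, q, r}

/-- Nested almost convex (finite) point sets. -/
structure IsNestedAlmostConvex (X : Set (ℝ × ℝ)) : Prop where
  finite : X.Finite
  generalPosition : ∀ j, 1 ≤ j → j ≤ layerCount X → InGeneralPosition (innerLayers X j)
  hull : ∀ j, 1 ≤ j → j ≤ layerCount X → hullVertices (innerLayers X j) = layer X j
  triangle : ∀ j, 1 ≤ j → j ≤ layerCount X →
    ∀ p ∈ layer X j, ∀ q ∈ layer X j, ∀ r ∈ layer X j, p ≠ q → p ≠ r → q ≠ r →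
      ∃! x, x ∈ innerLayers X (j - 1) ∧ x ∈ interior (convexHull ℝ {p, q, r})

/-! ## The real random access machine

Programs for a real RAM. The memory consists of arrays of natural numbers and arrays of real
numbers, all indexed by natural numbers (a scalar variable is cell `0` of an array of its own). A
program is a fixed finite text, so it names finitely many arrays; cells are addressed indirectly,
by natural numbers that are computed at run time. Every arithmetic operation, memory access and
comparison costs one step. On natural numbers there are only addition, truncated subtraction and
comparison; on real numbers there are only addition, subtraction, multiplication and comparison.
There is no conversion between the two kinds of numbers, no rounding, and the only constants are
integers. -/

namespace RealRAM

/-- The contents of the memory: `nats a i` and `reals a i` are the `i`-th cells of the `a`-th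
array of natural numbers and of the `a`-th array of real numbers. -/
structure State where
  nats : ℕ → ℕ → ℕ
  reals : ℕ → ℕ → ℝ

/-- Expressions for natural numbers. -/
inductive NatExp where
  | const (c : ℕ)
  | read (a : ℕ) (i : NatExp)
  | add (e f : NatExp)
  | sub (e f : NatExp)

/-- Value of an expression (`sub` is truncated subtraction). -/
def NatExp.eval (s : State) : NatExp → ℕ
  | .const c => c
  | .read a i => s.nats a (i.eval s)
  | .add e f => e.eval s + f.eval s
  | .sub e f => e.eval s - f.eval s

/-- Number of steps for the evaluation: one for each node of the expression. -/
def NatExp.cost : NatExp → ℕ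
  | .const _ => 1
  | .read _ i => 1 + i.cost
  | .add e f => 1 + e.cost + f.cost
  | .sub e f => 1 + e.cost + f.cost

/-- Expressions for real numbers. -/
inductive RealExp where
  | const (c : ℤ)
  | read (a : ℕ) (i : NatExp)
  | add (e f : RealExp)
  | sub (e f : RealExp)
  | mul (e f : RealExp)

/-- Value of an expression. -/
noncomputable def RealExp.eval (s : State) : RealExp → ℝ
  | .const c => (c : ℝ)
  | .read a i => s.reals a (i.eval s)
  | .add e f => e.eval s + f.eval s
  | .sub e f => e.eval s - f.eval s
  | .mul e f => e.eval s * f.eval s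

/-- Number of steps for the evaluation: one for each node of the expression. -/
def RealExp.cost : RealExp → ℕ
  | .const _ => 1
  | .read _ i => 1 + i.cost
  | .add e f => 1 + e.cost + f.cost
  | .sub e f => 1 + e.cost + f.cost
  | .mul e f => 1 + e.cost + f.cost

/-- Conditions for branches and loops. -/
inductive Test where
  | natLt (e f : NatExp)
  | realLt (e f : RealExp)
  | not (b : Test)
  | and (b c : Test)

/-- Truth of a condition. -/
def Test.Holds (s : State) : Test → Prop
  | .natLt e f => e.eval s < f.eval s
  | .realLt e f => e.eval s < f.eval s
  | .not b => ¬ b.Holds s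
  | .and b c => b.Holds s ∧ c.Holds s

/-- Number of steps for the evaluation of a condition. -/
def Test.cost : Test → ℕ
  | .natLt e f => 1 + e.cost + f.cost
  | .realLt e f => 1 + e.cost + f.cost
  | .not b => 1 + b.cost
  | .and b c => 1 + b.cost + c.cost

/-- Programs: assignments to cells, sequential composition, branches, and while loops. -/
inductive Program where
  | skip
  | setNat (a : ℕ) (i e : NatExp)
  | setReal (a : ℕ) (i : NatExp) (e : RealExp)
  | seq (P Q : Program)
  | branch (b : Test) (P Q : Program)
  | loop (b : Test) (P : Program)

/-- Write `v` into cell `i` of the `a`-th array of natural numbers. -/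
def State.writeNat (s : State) (a i v : ℕ) : State :=
  { s with nats := Function.update s.nats a (Function.update (s.nats a) i v) }

/-- Write `v` into cell `i` of the `a`-th array of real numbers. -/
noncomputable def State.writeReal (s : State) (a i : ℕ) (v : ℝ) : State :=
  { s with reals := Function.update s.reals a (Function.update (s.reals a) i v) }

/-- `Runs P s t s'`: started in `s`, the program `P` halts after exactly `t` steps, in `s'`. -/
inductive Runs : Program → State → ℕ → State → Prop where
  | skip (s : State) : Runs .skip s 1 s
  | setNat (s : State) (a : ℕ) (i e : NatExp) :
      Runs (.setNat a i e) s (1 + i.cost + e.cost) (s.writeNat a (i.eval s) (e.eval s))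
  | setReal (s : State) (a : ℕ) (i : NatExp) (e : RealExp) :
      Runs (.setReal a i e) s (1 + i.cost + e.cost) (s.writeReal a (i.eval s) (e.eval s))
  | seq {P Q : Program} {s s' s'' : State} {t t' : ℕ} :
      Runs P s t s' → Runs Q s' t' s'' → Runs (.seq P Q) s (t + t') s''
  | branch_true {b : Test} {P Q : Program} {s s' : State} {t : ℕ} :
      b.Holds s → Runs P s t s' → Runs (.branch b P Q) s (1 + b.cost + t) s'
  | branch_false {b : Test} {P Q : Program} {s s' : State} {t : ℕ} :
      ¬ b.Holds s → Runs Q s t s' → Runs (.branch b P Q) s (1 + b.cost + t) s'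
  | loop_true {b : Test} {P : Program} {s s' s'' : State} {t t' : ℕ} :
      b.Holds s → Runs P s t s' → Runs (.loop b P) s' t' s'' →
        Runs (.loop b P) s (1 + b.cost + t + t') s''
  | loop_false {b : Test} {P : Program} {s : State} :
      ¬ b.Holds s → Runs (.loop b P) s (1 + b.cost) s

/-- The machine is deterministic: running time and final state are determined by the program and
the initial state. -/
theorem Runs.unique {P : Program} {s s₁ s₂ : State} {t₁ t₂ : ℕ}
    (h₁ : Runs P s t₁ s₁) (h₂ : Runs P s t₂ s₂) : t₁ = t₂ ∧ s₁ = s₂ := by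
  induction h₁ generalizing t₂ s₂ with
  | skip => cases h₂; exact ⟨rfl, rfl⟩
  | setNat => cases h₂; exact ⟨rfl, rfl⟩
  | setReal => cases h₂; exact ⟨rfl, rfl⟩
  | seq _ _ ih ih' =>
    cases h₂ with
    | seq k k' =>
      obtain ⟨rfl, rfl⟩ := ih k
      obtain ⟨rfl, rfl⟩ := ih' k'
      exact ⟨rfl, rfl⟩
  | branch_true hb _ ih =>
    cases h₂ with
    | branch_true _ k => obtain ⟨rfl, rfl⟩ := ih k; exact ⟨rfl, rfl⟩
    | branch_false nb _ => exact absurd hb nb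
  | branch_false nb _ ih =>
    cases h₂ with
    | branch_true hb _ => exact absurd hb nb
    | branch_false _ k => obtain ⟨rfl, rfl⟩ := ih k; exact ⟨rfl, rfl⟩
  | loop_true hb _ _ ih ih' =>
    cases h₂ with
    | loop_true _ k k' =>
      obtain ⟨rfl, rfl⟩ := ih k
      obtain ⟨rfl, rfl⟩ := ih' k'
      exact ⟨rfl, rfl⟩
    | loop_false nb => exact absurd hb nb
  | loop_false nb =>
    cases h₂ with
    | loop_true hb _ _ => exact absurd hb nb
    | loop_false _ => exact ⟨rfl, rfl⟩

/-- The initial memory for a list of `n` points: `n` is in cell `0` of the `0`-th array of natural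
numbers, the abscissas and the ordinates of the points are in the cells `0, …, n - 1` of the `0`-th
and of the `1`-st array of real numbers, and everything else is `0`. -/
noncomputable def input {n : ℕ} (x : Fin n → ℝ × ℝ) : State where
  nats a i := if a = 0 ∧ i = 0 then n else 0
  reals a i :=
    if h : i < n then
      if a = 0 then (x ⟨i, h⟩).1 else if a = 1 then (x ⟨i, h⟩).2 else 0
    else 0

/-- The answer of a program that has halted: cell `0` of the `1`-st array of natural numbers. -/
def State.answer (s : State) : ℕ := s.nats 1 0

/-- The program `P` decides the property `Φ` of finite planar point sets within `T n` steps on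
sets of `n` points, in whatever order the points are listed: it always halts within that time,
with answer `1` if the set has the property and with answer `0` otherwise. -/
def DecidesInTime (P : Program) (Φ : Set (ℝ × ℝ) → Prop) (T : ℕ → ℕ) : Prop :=
  ∀ (n : ℕ) (x : Fin n → ℝ × ℝ), Function.Injective x →
    ∃ (t : ℕ) (s : State), Runs P (input x) t s ∧ t ≤ T n ∧
      (Φ (Set.range x) → s.answer = 1) ∧ (¬ Φ (Set.range x) → s.answer = 0)

end RealRAM

/-! Write `m` for the number of points that are left at some stage. By `isNestedAlmostConvex_iff`
the definition is a recursion: a finite nonempty set qualifies iff the set without its outer layer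
does, the set is in general position, and every triangle of outer vertices contains exactly one of
the other points. Cutting the outer polygon into a fan of triangles shows that `h` outer vertices
enclose exactly `h - 2` points (`Pierced.ncard_eq`). So the sizes of the layers are forced: `2 * h =
m + 2`, and fewer than half of the points survive a peeling. One layer is found by a Graham scan
after heap sort in `O(m log m)` steps, a wrong size means rejection, and since `m` at least halves
each time, all layers cost `O(n log n)` together (`peelAll_spec`).

It remains to test the piercing of the triangles in time linear in the size of the layer, although
there are cubically many triangles. In a nested almost convex set every inner point splits the
vertices around it into three consecutive arcs, and the triangles that contain it are those with one
vertex in each arc. Given the arcs, three orientation tests certify this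
(`ConvexCycle.mem_triangle_iff_splits`), because a point beyond a chord is beyond every longer
chord.

The arcs are predicted from the inside. Around a layer with `m` vertices the next layer has `2 * m`
vertices, and each inner vertex lies in exactly two adjacent ears of the outer polygon. Counted from
a suitable vertex, the `i`-th inner vertex belongs to the outer vertices `2 * i` and `2 * i + 1`,
which are two of its arcs, and the arcs of all deeper points double. That these arcs split each
triple of vertices exactly once is pure combinatorics (`ArcSystem.double`). Hence passing the tests
implies the piercing, and general position comes with it (`isNestedAlmostConvex_of_tests`).

Conversely, in a nested almost convex set the ears must pair up in this way (`Ears.odd_eq_even`),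
and a line through two inner vertices cuts off the same points as the corresponding outer chord,
since both cut off equally many (`Ears.right_of_chord_of_right_of_line`). So the doubled arcs pass
the tests (`Pierced.passesTests_double`), and `checkLayer_spec` carries soundness and completeness
from layer to layer.

On the side of the machine, `Computes` bounds the running time and describes the final state. Time
bounds hold for all inputs, since the program must halt on degenerate ones too; geometric
conclusions are conditional on general position or on the set being nested almost convex. -/

/-! ## Orientations of planar point triples -/

/-- Twice the signed area of the triangle `p q r`. -/
def orient (p q r : ℝ × ℝ) : ℝ :=
  (q.1 - p.1) * (r.2 - p.2) - (q.2 - p.2) * (r.1 - p.1)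

theorem orient_rotate (p q r : ℝ × ℝ) : orient q r p = orient p q r := by
  unfold orient; ring

theorem orient_swap_left (p q r : ℝ × ℝ) : orient q p r = -orient p q r := by
  unfold orient; ring

theorem orient_swap_right (p q r : ℝ × ℝ) : orient p r q = -orient p q r := by
  unfold orient; ring

@[simp] theorem orient_self_left (p r : ℝ × ℝ) : orient p p r = 0 := by
  unfold orient; ring

@[simp] theorem orient_self_right (p q : ℝ × ℝ) : orient p q q = 0 := by
  unfold orient; ring

@[simp] theorem orient_self_outer (p q : ℝ × ℝ) : orient p q p = 0 := by
  unfold orient; ring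

/-- With `e` as the origin this is the three-term Grassmann–Plücker relation for four vectors of the
plane. Relations of this kind give the sign of one orientation once the signs of the others are
known. -/
theorem orient_plucker (e a b c d : ℝ × ℝ) :
    orient e a b * orient e c d - orient e a c * orient e b d + orient e a d * orient e b c = 0 := by
  unfold orient; ring

theorem orient_combo (p q x y : ℝ × ℝ) {a b : ℝ} (h : a + b = 1) :
    orient p q (a • x + b • y) = a * orient p q x + b * orient p q y := by
  obtain rfl : b = 1 - a := by linarith
  simp only [orient, Prod.fst_add, Prod.snd_add, Prod.smul_fst, Prod.smul_snd, smul_eq_mul]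
  ring

theorem continuous_orient (p q : ℝ × ℝ) : Continuous (orient p q) := by
  unfold orient; fun_prop

theorem orient_nonneg_of_mem_convexHull {p q x : ℝ × ℝ} {S : Set (ℝ × ℝ)}
    (hS : ∀ y ∈ S, 0 ≤ orient p q y) (hx : x ∈ convexHull ℝ S) : 0 ≤ orient p q x := by
  have hc : Convex ℝ {y | 0 ≤ orient p q y} := by
    intro u hu v hv a b ha hb hab
    simp only [Set.mem_ofPred_eq] at *
    rw [orient_combo p q u v hab]
    positivity
  exact convexHull_min (s := S) hS hc hx

/-- Barycentric coordinates with respect to a triangle. -/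
theorem orient_barycentric (a b c x : ℝ × ℝ) :
    orient a b c • x = orient b c x • a + orient c a x • b + orient a b x • c := by
  ext <;> simp only [orient, Prod.fst_add, Prod.snd_add, Prod.smul_fst, Prod.smul_snd,
    smul_eq_mul] <;> ring

theorem orient_barycentric_orient (u v a b c x : ℝ × ℝ) :
    orient a b c * orient u v x =
      orient b c x * orient u v a + orient c a x * orient u v b + orient a b x * orient u v c := by
  unfold orient; ring

theorem mem_convexHull_triangle {a b c x : ℝ × ℝ} (h : 0 < orient a b c)
    (h₁ : 0 ≤ orient a b x) (h₂ : 0 ≤ orient b c x) (h₃ : 0 ≤ orient c a x) :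
    x ∈ convexHull ℝ {a, b, c} := by
  have hsum : orient b c x + orient c a x + orient a b x = orient a b c := by
    unfold orient; ring
  have hx : (orient b c x / orient a b c) • a + (orient c a x / orient a b c) • b
      + (orient a b x / orient a b c) • c = x := by
    simp only [div_eq_inv_mul, mul_smul]
    rw [← smul_add, ← smul_add, ← orient_barycentric, smul_smul, inv_mul_cancel₀ h.ne', one_smul]
  rw [← hx]
  have hc := convex_convexHull ℝ ({a, b, c} : Set (ℝ × ℝ))
  have hm := fun y hy => subset_convexHull ℝ ({a, b, c} : Set (ℝ × ℝ)) (a := y) hy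
  have := hc.sum_mem (t := Finset.univ) (w := ![orient b c x / orient a b c,
    orient c a x / orient a b c, orient a b x / orient a b c]) (z := ![a, b, c])
    (by intro i _; fin_cases i <;> simp <;> positivity)
    (by simp [Fin.sum_univ_three]; field_simp; linarith)
    (by intro i _; fin_cases i <;> simp <;> apply hm <;> simp)
  simpa [Fin.sum_univ_three] using this

/-- If an interior point were on the line, a small step perpendicular to the line would stay in `S`
and end strictly to the right. -/
theorem interior_le_orient {p q x : ℝ × ℝ} (hpq : p ≠ q) {S : Set (ℝ × ℝ)}
    (hS : ∀ y ∈ S, 0 ≤ orient p q y) (hx : x ∈ interior S) : 0 < orient p q x := by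
  rcases (hS x (interior_subset hx)).lt_or_eq with h | h
  · exact h
  exfalso
  -- move slightly to the right of the line
  let g : ℝ → ℝ × ℝ := fun t => (x.1 + t * (q.2 - p.2), x.2 - t * (q.1 - p.1))
  have hg : Continuous g := by fun_prop
  have hg0 : g 0 = x := by simp [g]
  have hnhds : ∀ᶠ t in nhds (0 : ℝ), g t ∈ S := by
    have : S ∈ nhds (g 0) := by rw [hg0]; exact mem_interior_iff_mem_nhds.mp hx
    exact hg.continuousAt this
  obtain ⟨t, ht, htS⟩ := (hnhds.filter_mono nhdsWithin_le_nhds |>.and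
    (self_mem_nhdsWithin : Set.Ioi (0 : ℝ) ∈ nhdsWithin 0 (Set.Ioi 0))).exists
  have h1 := hS _ ht
  have h2 : orient p q (g t) = orient p q x - t * ((q.1 - p.1) ^ 2 + (q.2 - p.2) ^ 2) := by
    simp only [orient, g]; ring
  have h3 : 0 < (q.1 - p.1) ^ 2 + (q.2 - p.2) ^ 2 := by
    by_contra hcon
    apply hpq
    have e1 : q.1 - p.1 = 0 := by nlinarith [sq_nonneg (q.1 - p.1), sq_nonneg (q.2 - p.2)]
    have e2 : q.2 - p.2 = 0 := by nlinarith [sq_nonneg (q.1 - p.1), sq_nonneg (q.2 - p.2)]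
    ext <;> linarith
  have h4 : 0 < t := htS
  have := mul_pos h4 h3
  linarith

theorem ne_of_orient_pos {a b c : ℝ × ℝ} (h : 0 < orient a b c) : a ≠ b ∧ b ≠ c ∧ c ≠ a := by
  refine ⟨?_, ?_, ?_⟩ <;> rintro rfl <;> simp at h

theorem mem_interior_triangle {a b c : ℝ × ℝ} (h : 0 < orient a b c) (x : ℝ × ℝ) :
    x ∈ interior (convexHull ℝ {a, b, c}) ↔
      0 < orient a b x ∧ 0 < orient b c x ∧ 0 < orient c a x := by
  obtain ⟨hab, hbc, hca⟩ := ne_of_orient_pos h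
  constructor
  · intro hx
    refine ⟨interior_le_orient hab ?_ hx, interior_le_orient hbc ?_ hx,
      interior_le_orient hca ?_ hx⟩ <;> intro y hy <;>
      refine orient_nonneg_of_mem_convexHull ?_ hy <;> rintro z (rfl | rfl | rfl) <;>
      first
      | exact (orient_self_right _ _).ge
      | exact (orient_self_outer _ _).ge
      | exact h.le
      | exact (orient_rotate _ _ _).symm ▸ h.le
      | exact orient_rotate _ _ _ ▸ h.le
  · rintro ⟨h1, h2, h3⟩
    have hopen : IsOpen {y | 0 < orient a b y ∧ 0 < orient b c y ∧ 0 < orient c a y} :=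
      (isOpen_lt continuous_const (continuous_orient a b)).inter
        ((isOpen_lt continuous_const (continuous_orient b c)).inter
          (isOpen_lt continuous_const (continuous_orient c a)))
    exact interior_maximal (fun y hy => mem_convexHull_triangle h hy.1.le hy.2.1.le hy.2.2.le)
      hopen ⟨h1, h2, h3⟩

theorem collinear_iff_orient (p q r : ℝ × ℝ) : Collinear ℝ {p, q, r} ↔ orient p q r = 0 := by
  rw [collinear_iff_of_mem (p₀ := p) (by simp)]
  constructor
  · rintro ⟨v, hv⟩
    obtain ⟨s, hs⟩ := hv q (by simp)
    obtain ⟨t, ht⟩ := hv r (by simp)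
    rw [hs, ht]
    simp only [orient, vadd_eq_add, Prod.fst_add, Prod.snd_add, Prod.smul_fst, Prod.smul_snd,
      smul_eq_mul]
    ring
  · intro h
    by_cases hpq : p = q
    · subst hpq
      refine ⟨r - p, ?_⟩
      rintro y (rfl | rfl | rfl)
      · exact ⟨0, by simp⟩
      · exact ⟨0, by simp⟩
      · exact ⟨1, by simp⟩
    · refine ⟨q - p, ?_⟩
      rintro y (rfl | rfl | rfl)
      · exact ⟨0, by simp⟩
      · exact ⟨1, by simp⟩
      · unfold orient at h
        by_cases h1 : q.1 - p.1 = 0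
        · have h2 : q.2 - p.2 ≠ 0 := fun h2 => hpq (by ext <;> linarith)
          refine ⟨(y.2 - p.2) / (q.2 - p.2), ?_⟩
          have h3 : y.1 - p.1 = 0 := by
            rw [h1] at h
            have : (q.2 - p.2) * (y.1 - p.1) = 0 := by linarith
            exact (mul_eq_zero.mp this).resolve_left h2
          ext
          · simp [h1]; linarith
          · simp [h2]
        · refine ⟨(y.1 - p.1) / (q.1 - p.1), ?_⟩
          ext
          · simp [h1]
          · simp only [vadd_eq_add, Prod.snd_add, Prod.smul_snd, smul_eq_mul, Prod.snd_sub]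
            field_simp
            linarith

/-! ## Convex polygons -/

/-- The `h`-periodic sequence `p` runs counterclockwise through the vertices of a strictly convex
polygon with `h` vertices. -/
structure ConvexCycle (h : ℕ) (p : ℕ → ℝ × ℝ) : Prop where
  periodic : ∀ i, p (i + h) = p i
  pos : ∀ i j k, i < j → j < k → k < i + h → 0 < orient (p i) (p j) (p k)

namespace ConvexCycle

variable {h : ℕ} {p : ℕ → ℝ × ℝ}

theorem shift (hp : ConvexCycle h p) (s : ℕ) : ConvexCycle h (fun i => p (s + i)) where
  periodic i := by rw [← hp.periodic (s + i), Nat.add_assoc]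
  pos i j k h1 h2 h3 := hp.pos _ _ _ (by omega) (by omega) (by omega)

theorem periodic_mul (hp : ConvexCycle h p) (i k : ℕ) : p (i + h * k) = p i := by
  induction k with
  | zero => simp
  | succ k ih => rw [Nat.mul_succ, ← Nat.add_assoc, hp.periodic, ih]

theorem apply_mod (hp : ConvexCycle h p) (i : ℕ) : p (i % h) = p i := by
  conv_rhs => rw [← Nat.mod_add_div i h, hp.periodic_mul]

theorem exists_shift (hp : ConvexCycle h p) (hh : 0 < h) (i j : ℕ) : ∃ k < h, p (i + k) = p j := by
  -- Modulo `h`, the factor `h - 1` acts as `-1`; this avoids truncated subtraction.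
  refine ⟨(j + (h - 1) * i) % h, Nat.mod_lt _ hh, ?_⟩
  rw [← hp.apply_mod (i + _), ← hp.apply_mod j]
  congr 1
  obtain ⟨g, rfl⟩ : ∃ g, h = g + 1 := ⟨h - 1, by omega⟩
  rw [Nat.add_mod_mod]
  have : i + (j + (g + 1 - 1) * i) = j + (g + 1) * i := by simp; ring
  rw [this, Nat.add_mul_mod_self_left]

theorem edge_pos (hp : ConvexCycle h p) {i k : ℕ} (h1 : i + 1 < k) (h2 : k < i + h) :
    0 < orient (p i) (p (i + 1)) (p k) := hp.pos _ _ _ (by omega) h1 h2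

theorem edge_nonneg (hp : ConvexCycle h p) (hh : 0 < h) (i j : ℕ) :
    0 ≤ orient (p i) (p (i + 1)) (p j) := by
  obtain ⟨k, hk, e⟩ := hp.exists_shift hh i j
  rw [← e]
  rcases Nat.lt_trichotomy k 1 with h1 | h1 | h1
  · obtain rfl : k = 0 := by omega
    simp
  · subst h1; simp
  · exact (hp.edge_pos (by omega) (by omega)).le

theorem edge_nonneg_of_mem (hp : ConvexCycle h p) (hh : 0 < h) {x : ℝ × ℝ}
    (hx : x ∈ convexHull ℝ (Set.range p)) (i : ℕ) : 0 ≤ orient (p i) (p (i + 1)) x :=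
  orient_nonneg_of_mem_convexHull (by rintro _ ⟨j, rfl⟩; exact hp.edge_nonneg hh i j) hx

theorem range_eq (hp : ConvexCycle h p) (hh : 0 < h) : Set.range p = p '' Set.Iio h := by
  ext x
  constructor
  · rintro ⟨i, rfl⟩
    exact ⟨i % h, Nat.mod_lt _ hh, hp.apply_mod i⟩
  · rintro ⟨i, _, rfl⟩
    exact ⟨i, rfl⟩

theorem ne (hp : ConvexCycle h p) (hh : 3 ≤ h) {i j : ℕ} (h1 : i < j) (h2 : j < i + h) :
    p i ≠ p j := by
  by_cases h3 : j = i + 1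
  · subst h3
    exact (ne_of_orient_pos (hp.pos i (i + 1) (i + 2) (by omega) (by omega) (by omega))).1
  · exact (ne_of_orient_pos (hp.pos i (i + 1) j (by omega) (by omega) (by omega))).2.2.symm

/-- The chord from `a` to `d` cuts off less than the chord from `a` to `b`, for `a < d ≤ b`. -/
theorem right_of_chord_of_le_right (hp : ConvexCycle h p) {v : ℝ × ℝ} {c d b : ℕ}
    (hv : 0 ≤ orient (p c) (p (c + 1)) v) (h1 : c < d) (h2 : d ≤ b) (h3 : b < c + h)
    (hr : orient (p c) (p d) v < 0) : orient (p c) (p b) v < 0 := by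
  by_contra hcon
  push Not at hcon
  rcases h2.eq_or_lt with rfl | h2
  · linarith
  rcases (Nat.succ_le_of_lt h1).eq_or_lt with h1 | h1
  · rw [← h1] at hr; exact absurd hv (not_le.mpr hr)
  have p1 := hp.pos c (c + 1) b (by omega) (by omega) (by omega)
  have p2 := hp.pos c (c + 1) d (by omega) (by omega) (by omega)
  have p3 := hp.pos c d b (by omega) (by omega) (by omega)
  have := orient_plucker (p c) (p (c + 1)) (p d) (p b) v
  nlinarith [mul_neg_of_pos_of_neg p1 hr, mul_nonneg p2.le hcon, mul_nonneg p3.le hv]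

/-- Mirror image of the preceding lemma: here the first endpoint moves, and the edge that ends at
`b` takes the part of the edge that starts at `c`. -/
theorem right_of_chord_of_le_left (hp : ConvexCycle h p) {v : ℝ × ℝ} {a c b : ℕ}
    (hv : ∀ i, 0 ≤ orient (p i) (p (i + 1)) v) (h1 : a ≤ c) (h2 : c < b) (h3 : b < a + h)
    (hr : orient (p c) (p b) v < 0) : orient (p a) (p b) v < 0 := by
  by_contra hcon
  push Not at hcon
  rcases h1.eq_or_lt with rfl | h1
  · linarith
  obtain ⟨e, rfl⟩ : ∃ e, b = e + 1 := ⟨b - 1, by omega⟩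
  have hv := hv e
  rcases (Nat.le_of_lt_succ h2).eq_or_lt with h2 | h2
  · subst h2; linarith
  have p1 := hp.pos a e (e + 1) (by omega) (by omega) (by omega)
  have p2 := hp.pos a c (e + 1) (by omega) (by omega) (by omega)
  have p3 := hp.pos c e (e + 1) (by omega) (by omega) (by omega)
  have key : orient (p a) (p e) (p (e + 1)) * orient (p c) (p (e + 1)) v =
      orient (p c) (p e) (p (e + 1)) * orient (p a) (p (e + 1)) v +
        orient (p a) (p c) (p (e + 1)) * orient (p e) (p (e + 1)) v := by
    unfold orient; ring
  nlinarith [mul_neg_of_pos_of_neg p1 hr, mul_nonneg p3.le hcon, mul_nonneg p2.le hv]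

/-- Caps of a convex polygon: what is beyond a chord is beyond every longer chord. -/
theorem right_of_chord (hp : ConvexCycle h p) {v : ℝ × ℝ} {a b c d : ℕ}
    (hv : ∀ i, 0 ≤ orient (p i) (p (i + 1)) v) (h1 : a ≤ c) (h2 : c < d) (h3 : d ≤ b)
    (h4 : b < a + h) (hr : orient (p c) (p d) v < 0) : orient (p a) (p b) v < 0 :=
  hp.right_of_chord_of_le_left hv h1 (by omega) h4
    (hp.right_of_chord_of_le_right (hv c) h2 h3 (by omega) hr)

/-- The chord from `b` on to `a + h` is the chord from `a` to `b` reversed. Thus being left of a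
chord is being beyond the complementary one, and the lemmas on caps serve both sides. -/
theorem orient_edge_of_periodic (hp : ConvexCycle h p) {v : ℝ × ℝ} (a b : ℕ) :
    orient (p b) (p (a + h)) v = -orient (p a) (p b) v := by
  rw [hp.periodic, orient_swap_left]

/-- The hull vertices of a set between the vertices of a convex polygon and its hull. -/
theorem hullVertices_eq (hp : ConvexCycle h p) (hh : 3 ≤ h) {S : Set (ℝ × ℝ)}
    (h1 : Set.range p ⊆ S) (h2 : S ⊆ convexHull ℝ (Set.range p)) :
    hullVertices S = Set.range p := by
  have hS : convexHull ℝ S = convexHull ℝ (Set.range p) :=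
    (convexHull_min h2 (convex_convexHull ℝ _)).antisymm (convexHull_mono h1)
  unfold hullVertices
  rw [hS]
  refine extremePoints_convexHull_subset.antisymm ?_
  rintro _ ⟨i, rfl⟩
  rw [mem_extremePoints_iff_left]
  refine ⟨subset_convexHull ℝ _ ⟨i, rfl⟩, ?_⟩
  intro x hx y hy hxy
  -- The cyclic predecessor of `i`, one period later so that `i = 0` is no exception.
  obtain ⟨e, he⟩ : ∃ e, e + 1 = i + h := ⟨i + h - 1, by omega⟩
  have hpi : p i = p (e + 1) := by rw [he, hp.periodic]
  rw [hpi] at hxy ⊢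
  obtain ⟨s, t, hs, ht, hst, hc⟩ := hxy
  -- The polygon is on one side of each edge line. If such a line passes through a point inside a
  -- segment of the polygon, it contains the whole segment. The lines of two consecutive edges meet
  -- only in their common vertex.
  have hedge : ∀ j, (orient (p j) (p (j + 1)) (p (e + 1)) = 0) →
      orient (p j) (p (j + 1)) x = 0 := by
    intro j hj
    rw [← hc, orient_combo _ _ _ _ hst] at hj
    have hx0 := hp.edge_nonneg_of_mem (by omega) hx j
    have hy0 := hp.edge_nonneg_of_mem (by omega) hy j
    have := mul_nonneg hs.le hx0
    have := mul_nonneg ht.le hy0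
    have h0 : s * orient (p j) (p (j + 1)) x = 0 := by linarith
    exact (mul_eq_zero.mp h0).resolve_left hs.ne'
  have e1 := hedge e (by simp)
  have e2 := hedge (e + 1) (by simp)
  have e3 := hp.pos e (e + 1) (e + 2) (by omega) (by omega) (by omega)
  unfold orient at e1 e2 e3
  have k1 : ((p (e + 1)).1 - (p e).1) * ((p (e + 1 + 1)).2 - (p (e + 1)).2) -
      ((p (e + 1)).2 - (p e).2) * ((p (e + 1 + 1)).1 - (p (e + 1)).1) ≠ 0 := by
    intro h0
    have : e + 2 = e + 1 + 1 := rfl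
    rw [this] at e3
    linarith
  have m1 : (((p (e + 1)).1 - (p e).1) * ((p (e + 1 + 1)).2 - (p (e + 1)).2) -
      ((p (e + 1)).2 - (p e).2) * ((p (e + 1 + 1)).1 - (p (e + 1)).1)) *
        (x.1 - (p (e + 1)).1) = 0 := by
    linear_combination ((p (e + 1 + 1)).1 - (p (e + 1)).1) * e1 -
      ((p (e + 1)).1 - (p e).1) * e2
  have m2 : (((p (e + 1)).1 - (p e).1) * ((p (e + 1 + 1)).2 - (p (e + 1)).2) -
      ((p (e + 1)).2 - (p e).2) * ((p (e + 1 + 1)).1 - (p (e + 1)).1)) *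
        (x.2 - (p (e + 1)).2) = 0 := by
    linear_combination ((p (e + 1 + 1)).2 - (p (e + 1)).2) * e1 -
      ((p (e + 1)).2 - (p e).2) * e2
  have n1 := (mul_eq_zero.mp m1).resolve_left k1
  have n2 := (mul_eq_zero.mp m2).resolve_left k1
  ext <;> linarith

end ConvexCycle

/-- A point beyond the chord from `c` to `d` lies in a triangle of the fan at `c`. -/
theorem exists_fan_triangle {p : ℕ → ℝ × ℝ} {v : ℝ × ℝ} {c d : ℕ} (hcd : c < d)
    (h1 : 0 ≤ orient (p c) (p (c + 1)) v) (h2 : orient (p c) (p d) v < 0) :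
    ∃ t, c < t ∧ t < d ∧ 0 ≤ orient (p c) (p t) v ∧ orient (p c) (p (t + 1)) v < 0 := by
  by_contra hcon
  push Not at hcon
  have : ∀ k, c + 1 + k ≤ d → 0 ≤ orient (p c) (p (c + 1 + k)) v := by
    intro k
    induction k with
    | zero => intro _; exact h1
    | succ k ih => exact fun hk => hcon (c + 1 + k) (by omega) (by omega) (ih (by omega))
  have := this (d - c - 1) (by omega)
  rw [show c + 1 + (d - c - 1) = d by omega] at this
  linarith

/-- Affine functions do not alternate in sign along four points in convex position. -/
theorem not_alternating {a b c d u v : ℝ × ℝ} (h1 : 0 < orient a b c) (h2 : 0 < orient b c d)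
    (h3 : 0 < orient a c d) (h4 : 0 < orient a b d) (ha : 0 ≤ orient u v a)
    (hb : orient u v b < 0) (hc : 0 ≤ orient u v c) (hd : orient u v d < 0) : False := by
  -- The affine dependence of four points in convex position: the two diagonals cross, so `a`, `c`
  -- balance `b`, `d` with positive weights.
  have key : orient b c d * orient u v a + orient a b d * orient u v c =
      orient a c d * orient u v b + orient a b c * orient u v d := by
    unfold orient; ring
  nlinarith [mul_nonneg h2.le ha, mul_nonneg h4.le hc, mul_neg_of_pos_of_neg h3 hb,
    mul_neg_of_pos_of_neg h1 hd]

/-! ## Convex polygons from local conditions -/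

/-- Reduced modulo `h`, three increasing indices within one period become a cyclic rotation of an
increasing triple, and orientations are invariant under rotation. -/
theorem convexCycle_of_slice {h : ℕ} {f : ℕ → ℝ × ℝ}
    (hf : ∀ i j k, i < j → j < k → k < h → 0 < orient (f i) (f j) (f k)) :
    ConvexCycle h (fun i => f (i % h)) where
  periodic i := by simp
  pos i j k h1 h2 h3 := by
    have hh : 0 < h := by omega
    obtain ⟨a, rfl⟩ : ∃ a, j = i + a := ⟨j - i, by omega⟩
    obtain ⟨b, rfl⟩ : ∃ b, k = i + b := ⟨k - i, by omega⟩
    rw [← Nat.mod_add_mod i h a, ← Nat.mod_add_mod i h b]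
    have hr := Nat.mod_lt i hh
    generalize i % h = r at hr
    have hmod : ∀ c, c < h → (r + c) % h = if r + c < h then r + c else r + c - h := by
      intro c hc
      split_ifs with hlt
      · exact Nat.mod_eq_of_lt hlt
      · rw [Nat.mod_eq_sub_mod (by omega), Nat.mod_eq_of_lt (by omega)]
    rw [hmod a (by omega), hmod b (by omega)]
    split_ifs with ha hb hb
    · exact hf _ _ _ (by omega) (by omega) (by omega)
    · rw [← orient_rotate, ← orient_rotate]
      exact hf (r + b - h) r (r + a) (by omega) (by omega) (by omega)
    · omega
    · rw [← orient_rotate]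
      exact hf (r + a - h) (r + b - h) r (by omega) (by omega) (by omega)

/-- A sequence that is seen in counterclockwise order from its first point and turns left everywhere
is in convex position. -/
theorem orient_pos_of_star {h : ℕ} {f : ℕ → ℝ × ℝ}
    (hstar : ∀ i j, 0 < i → i < j → j < h → 0 < orient (f 0) (f i) (f j))
    (hturn : ∀ i, i + 2 < h → 0 < orient (f i) (f (i + 1)) (f (i + 2))) :
    ∀ i j k, i < j → j < k → k < h → 0 < orient (f i) (f j) (f k) := by
  -- Induction on the span `k - i`. Seen from `f 0`, the identities `key` write a triple as a
  -- positive combination of two triples of smaller span or of consecutive points.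
  have main : ∀ d i j k, k ≤ i + d → i < j → j < k → k < h → 0 < orient (f i) (f j) (f k) := by
    intro d
    induction d with
    | zero => intros; omega
    | succ d ih =>
      intro i j k hd hij hjk hk
      rcases Nat.eq_zero_or_pos i with rfl | hi
      · exact hstar j k hij hjk hk
      by_cases h1 : j + 1 < k
      · have a1 := ih i j (j + 1) (by omega) hij (by omega) (by omega)
        have a2 := ih j (j + 1) k (by omega) (by omega) h1 hk
        have b1 := hstar i j hi hij (by omega)
        have b2 := hstar j (j + 1) (by omega) (by omega) (by omega)
        have b3 := hstar j k (by omega) (by omega) (by omega)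
        have key : orient (f 0) (f j) (f (j + 1)) * orient (f i) (f j) (f k) =
            orient (f 0) (f j) (f k) * orient (f i) (f j) (f (j + 1)) +
              orient (f 0) (f i) (f j) * orient (f j) (f (j + 1)) (f k) := by
          unfold orient; ring
        have := mul_pos b3 a1
        have := mul_pos b1 a2
        exact pos_of_mul_pos_right (by linarith) b2.le
      · obtain rfl : k = j + 1 := by omega
        obtain ⟨e, rfl⟩ : ∃ e, j = e + 1 := ⟨j - 1, by omega⟩
        by_cases h2 : i = e
        · subst h2; exact hturn i hk
        have a1 := ih i e (e + 1) (by omega) (by omega) (by omega) (by omega)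
        have a2 := hturn e hk
        have b1 := hstar i (e + 1) hi hij (by omega)
        have b2 := hstar e (e + 1) (by omega) (by omega) (by omega)
        have b3 := hstar (e + 1) (e + 2) (by omega) (by omega) (by omega)
        have key : orient (f 0) (f e) (f (e + 1)) * orient (f i) (f (e + 1)) (f (e + 2)) =
            orient (f 0) (f (e + 1)) (f (e + 2)) * orient (f i) (f e) (f (e + 1)) +
              orient (f 0) (f i) (f (e + 1)) * orient (f e) (f (e + 1)) (f (e + 2)) := by
          unfold orient; ring
        have := mul_pos b3 a1
        have := mul_pos b1 a2
        exact pos_of_mul_pos_right (by linarith) b2.le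
  intro i j k
  exact main k i j k (by omega)

/-- The angular order around a point is transitive within a half plane. -/
theorem orient_trans {o e a b c : ℝ × ℝ} (ha : 0 ≤ orient o e a) (hb : 0 < orient o e b)
    (hc : 0 ≤ orient o e c) (hab : 0 < orient o a b) (hbc : 0 < orient o b c)
    (hac : 0 < orient o e a ∨ 0 < orient o e c) : 0 < orient o a c := by
  have key : orient o e b * orient o a c =
      orient o e a * orient o b c + orient o e c * orient o a b := by
    unfold orient; ring
  refine pos_of_mul_pos_right ?_ hb.le
  rw [key]
  rcases hac with h | h
  · have := mul_pos h hbc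
    have := mul_nonneg hc hab.le
    linarith
  · have := mul_pos h hab
    have := mul_nonneg ha hbc.le
    linarith

/-- A linear number of orientation tests for convex position. -/
theorem orient_pos_of_tests {h : ℕ} {f : ℕ → ℝ × ℝ}
    (htest : ∀ i, i + 2 < h → 0 < orient (f i) (f (i + 1)) (f (i + 2)) ∧
      0 < orient (f 0) (f (i + 1)) (f (i + 2)) ∧ 0 < orient (f 0) (f 1) (f (i + 2))) :
    ∀ i j k, i < j → j < k → k < h → 0 < orient (f i) (f j) (f k) := by
  refine orient_pos_of_star ?_ (fun i hi => (htest i hi).1)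
  -- All later points are on one side of the line through the first two. Without this half plane the
  -- sequence could wind around `f 0` repeatedly, and the angular order would not be transitive.
  have hone : ∀ j, 1 < j → j < h → 0 < orient (f 0) (f 1) (f j) := by
    intro j h1 h2
    obtain ⟨e, rfl⟩ : ∃ e, j = e + 2 := ⟨j - 2, by omega⟩
    exact (htest e h2).2.2
  intro i j hi hij hj
  obtain ⟨d, rfl⟩ : ∃ d, j = i + 1 + d := ⟨j - i - 1, by omega⟩
  induction d with
  | zero =>
    obtain ⟨e, rfl⟩ : ∃ e, i = e + 1 := ⟨i - 1, by omega⟩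
    exact (htest e hj).2.1
  | succ d ih =>
    have h1 := ih (by omega) (by omega)
    rcases Nat.lt_or_ge 1 i with h2 | h2
    · refine orient_trans (hone i h2 (by omega)).le (hone _ (by omega) (by omega : i + 1 + d < h))
        (hone _ (by omega) hj).le h1 ?_ (Or.inl (hone i h2 (by omega)))
      have := (htest (i + d) (by omega)).2.1
      rwa [show i + d + 1 = i + 1 + d by omega, show i + d + 2 = i + 1 + (d + 1) by omega] at this
    · obtain rfl : i = 1 := by omega
      exact hone _ (by omega) hj

/-! ## Peeling layers one at a time -/

theorem hullVertices_subset (S : Set (ℝ × ℝ)) : hullVertices S ⊆ S := by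
  unfold hullVertices
  exact fun _ hx => extremePoints_convexHull_subset (𝕜 := ℝ) hx

theorem hullVertices_nonempty {S : Set (ℝ × ℝ)} (hS : S.Finite) (hne : S.Nonempty) :
    (hullVertices S).Nonempty :=
  (hS.isCompact_convexHull (𝕜 := ℝ)).extremePoints_nonempty (convexHull_nonempty_iff.mpr hne)

theorem peel_subset (S : Set (ℝ × ℝ)) : peel S ⊆ S := Set.sdiff_subset

theorem peel_union (S : Set (ℝ × ℝ)) : peel S ∪ hullVertices S = S :=
  Set.sdiff_union_of_subset (hullVertices_subset S)

theorem exists_peel_eq_empty {X : Set (ℝ × ℝ)} (hX : X.Finite) : ∃ i, peel^[i] X = ∅ := by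
  induction hn : X.ncard using Nat.strong_induction_on generalizing X with
  | _ n ih =>
    rcases X.eq_empty_or_nonempty with rfl | hne
    · exact ⟨0, rfl⟩
    · have hlt : (peel X).ncard < n := by
        rw [← hn]
        obtain ⟨x, hx⟩ := hullVertices_nonempty hX hne
        refine Set.ncard_lt_ncard ⟨peel_subset X, fun hsub => ?_⟩ hX
        exact (hsub (hullVertices_subset X hx)).2 hx
      obtain ⟨i, hi⟩ := ih _ hlt (hX.subset (peel_subset X)) rfl
      exact ⟨i + 1, hi⟩

theorem peel_iterate_layerCount {X : Set (ℝ × ℝ)} (hX : X.Finite) :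
    peel^[layerCount X] X = ∅ :=
  Nat.sInf_mem (s := {i : ℕ | peel^[i] X = ∅}) (exists_peel_eq_empty hX)

theorem layerCount_empty : layerCount ∅ = 0 :=
  Nat.sInf_eq_zero.mpr (Or.inl rfl)

theorem layerCount_eq_succ {X : Set (ℝ × ℝ)} (hX : X.Finite) (hne : X.Nonempty) :
    layerCount X = layerCount (peel X) + 1 := by
  apply le_antisymm
  · exact Nat.sInf_le (peel_iterate_layerCount (hX.subset (peel_subset X)))
  · have h := peel_iterate_layerCount hX
    rcases hL : layerCount X with _ | k
    · rw [hL] at h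
      exact absurd h hne.ne_empty
    · rw [hL] at h
      exact Nat.succ_le_succ (Nat.sInf_le h)

theorem innerLayers_zero (X : Set (ℝ × ℝ)) : innerLayers X 0 = ∅ := by
  simp [innerLayers]

theorem innerLayers_succ (X : Set (ℝ × ℝ)) (j : ℕ) :
    innerLayers X (j + 1) = innerLayers X j ∪ layer X (j + 1) := by
  have : Set.Icc 1 (j + 1) = insert (j + 1) (Set.Icc 1 j) := by
    ext i; simp only [Set.mem_Icc, Set.mem_insert_iff]; omega
  rw [innerLayers, this, Set.biUnion_insert, Set.union_comm, innerLayers]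

/-- The inner layers are what peeling leaves over. In particular, the condition on the hull vertices
in the definition is automatic. -/
theorem innerLayers_eq {X : Set (ℝ × ℝ)} (hX : X.Finite) {j : ℕ} (hj : j ≤ layerCount X) :
    innerLayers X j = peel^[layerCount X - j] X := by
  induction j with
  | zero => rw [innerLayers_zero, Nat.sub_zero, peel_iterate_layerCount hX]
  | succ j ih =>
    rw [innerLayers_succ, ih (by omega), layer]
    have : layerCount X - j = (layerCount X - (j + 1)) + 1 := by omega
    rw [this, Function.iterate_succ_apply', peel_union]

theorem layer_peel {X : Set (ℝ × ℝ)} (hX : X.Finite) (hne : X.Nonempty) {j : ℕ}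
    (hj : j ≤ layerCount (peel X)) : layer (peel X) j = layer X j := by
  unfold layer
  rw [layerCount_eq_succ hX hne, ← Function.iterate_succ_apply]
  congr 2
  omega

theorem innerLayers_peel {X : Set (ℝ × ℝ)} (hX : X.Finite) (hne : X.Nonempty) {j : ℕ}
    (hj : j ≤ layerCount (peel X)) : innerLayers (peel X) j = innerLayers X j := by
  unfold innerLayers
  exact Set.iUnion₂_congr fun i hi => layer_peel hX hne (hi.2.trans hj)

theorem isNestedAlmostConvex_empty : IsNestedAlmostConvex ∅ where
  finite := Set.finite_empty
  generalPosition j h1 h2 := by rw [layerCount_empty] at h2; omega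
  hull j h1 h2 := by rw [layerCount_empty] at h2; omega
  triangle j h1 h2 := by rw [layerCount_empty] at h2; omega

/-- Every triangle spanned by hull vertices has exactly one of the other points in its interior. -/
def TrianglesPierced (X : Set (ℝ × ℝ)) : Prop :=
  ∀ p ∈ hullVertices X, ∀ q ∈ hullVertices X, ∀ r ∈ hullVertices X, p ≠ q → p ≠ r → q ≠ r →
    ∃! x, x ∈ peel X ∧ x ∈ interior (convexHull ℝ {p, q, r})

/-- The layers of `peel X` are those of `X` except for the outermost one, so the conditions below
the top level are those for `peel X`. At the top level general position and the triangles remain. -/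
theorem isNestedAlmostConvex_iff {X : Set (ℝ × ℝ)} (hX : X.Finite) (hne : X.Nonempty) :
    IsNestedAlmostConvex X ↔
      IsNestedAlmostConvex (peel X) ∧ InGeneralPosition X ∧ TrianglesPierced X := by
  have hL := layerCount_eq_succ hX hne
  have hpX := hX.subset (peel_subset X)
  have htop : innerLayers X (layerCount X) = X := by
    rw [innerLayers_eq hX le_rfl, Nat.sub_self]; rfl
  have hsub : innerLayers X (layerCount X - 1) = peel X := by
    rw [innerLayers_eq hX (by omega), show layerCount X - (layerCount X - 1) = 1 by omega]; rfl
  have hlay : layer X (layerCount X) = hullVertices X := by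
    rw [layer, Nat.sub_self]; rfl
  constructor
  · intro H
    refine ⟨⟨hpX, ?_, ?_, ?_⟩, ?_, ?_⟩
    · intro j h1 h2
      rw [innerLayers_peel hX hne h2]
      exact H.generalPosition j h1 (by omega)
    · intro j h1 h2
      rw [innerLayers_peel hX hne h2, layer_peel hX hne h2]
      exact H.hull j h1 (by omega)
    · intro j h1 h2
      rw [innerLayers_peel hX hne (by omega), layer_peel hX hne h2]
      exact H.triangle j h1 (by omega)
    · have := H.generalPosition (layerCount X) (by omega) le_rfl
      rwa [htop] at this
    · have := H.triangle (layerCount X) (by omega) le_rfl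
      rwa [hlay, hsub] at this
  · rintro ⟨H, hgp, htri⟩
    refine ⟨hX, ?_, ?_, ?_⟩
    · intro j h1 h2
      rcases h2.eq_or_lt with rfl | h2
      · rwa [htop]
      · rw [← innerLayers_peel hX hne (by omega)]
        exact H.generalPosition j h1 (by omega)
    · intro j h1 h2
      rw [innerLayers_eq hX h2]; rfl
    · intro j h1 h2
      rcases h2.eq_or_lt with rfl | h2
      · rwa [hlay, hsub]
      · rw [← innerLayers_peel hX hne (by omega), ← layer_peel hX hne (by omega)]
        exact H.triangle j h1 (by omega)

/-! ## The linear-time test for one layer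

Each point `v` inside a convex polygon `p 0, …, p (h - 1)` carries three consecutive arcs
`[lo, mid)`, `[mid, hi)` and the rest of the vertices; the test asks that `v` lies beyond the three
chords that cut off these arcs together with one more vertex at each end. -/

/-- `a < b < c` lie in three different arcs. -/
def Splits (lo mid hi a b c : ℕ) : Prop :=
  (lo ≤ a ∧ a < mid ∧ mid ≤ b ∧ b < hi ∧ hi ≤ c) ∨
    (a < lo ∧ lo ≤ b ∧ b < mid ∧ mid ≤ c ∧ c < hi)

/-- Every three of `h` vertices are split by the arcs of exactly one of the points in `I`. -/
structure ArcSystem (I : Set ℕ) (h : ℕ) (lo mid hi : ℕ → ℕ) : Prop where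
  bounds : ∀ t ∈ I, lo t < mid t ∧ mid t < hi t ∧ hi t ≤ h ∧ hi t < lo t + h
  split : ∀ a b c, a < b → b < c → c < h →
    ∃! t, t ∈ I ∧ Splits (lo t) (mid t) (hi t) a b c

/-- The three orientation tests for a point, with the vertices counted from `s` on. -/
def PassesTests (p : ℕ → ℝ × ℝ) (s lo mid hi : ℕ) (v : ℝ × ℝ) : Prop :=
  orient (p (s + lo - 1)) (p (s + mid)) v < 0 ∧ orient (p (s + mid - 1)) (p (s + hi)) v < 0 ∧
    0 < orient (p (s + lo)) (p (s + hi - 1)) v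

namespace ConvexCycle

variable {h s lo mid hi : ℕ} {p : ℕ → ℝ × ℝ} {v : ℝ × ℝ}

/-- The chord is at least as long as one of the first two test chords, so `right_of_chord` applies.
The assumption `1 ≤ s` prevents truncation in `s + lo - 1` when `lo = 0`. -/
theorem right_of_tests (hp : ConvexCycle h p) (hs : 1 ≤ s)
    (hv : ∀ i, 0 ≤ orient (p i) (p (i + 1)) v)
    (hb : lo < mid ∧ mid < hi ∧ hi ≤ h ∧ hi < lo + h) (ht : PassesTests p s lo mid hi v)
    {a b : ℕ} (hbh : b < h) (hc : (a < lo ∧ mid ≤ b) ∨ (a < mid ∧ hi ≤ b)) :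
    orient (p (s + a)) (p (s + b)) v < 0 := by
  obtain ⟨h1, h2, h3⟩ := ht
  rcases hc with hc | hc
  · exact hp.right_of_chord hv (by omega) (by omega) (by omega) (by omega) h1
  · exact hp.right_of_chord hv (by omega) (by omega) (by omega) (by omega) h2

/-- In each case the complementary chord contains one of the three test chords, possibly a period
later. Together with `right_of_tests` this settles all pairs of vertices. -/
theorem left_of_tests (hp : ConvexCycle h p) (hs : 1 ≤ s)
    (hv : ∀ i, 0 ≤ orient (p i) (p (i + 1)) v)
    (hb : lo < mid ∧ mid < hi ∧ hi ≤ h ∧ hi < lo + h) (ht : PassesTests p s lo mid hi v)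
    {a b : ℕ} (hab : a < b) (hbh : b < h)
    (hc : b < lo ∨ mid ≤ a ∨ b < mid ∨ hi ≤ a ∨ (lo ≤ a ∧ b < hi)) :
    0 < orient (p (s + a)) (p (s + b)) v := by
  obtain ⟨h1, h2, h3⟩ := ht
  have key : orient (p (s + b)) (p (s + a + h)) v < 0 := by
    rcases hc with hc | hc | hc | hc | hc
    · exact hp.right_of_chord hv (by omega) (by omega) (by omega) (by omega) h1
    · rw [← hp.periodic (s + lo - 1), ← hp.periodic (s + mid)] at h1
      exact hp.right_of_chord hv (by omega) (by omega) (by omega) (by omega) h1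
    · exact hp.right_of_chord hv (by omega) (by omega) (by omega) (by omega) h2
    · rw [← hp.periodic (s + mid - 1), ← hp.periodic (s + hi)] at h2
      exact hp.right_of_chord hv (by omega) (by omega) (by omega) (by omega) h2
    · have h4 : orient (p (s + hi - 1)) (p (s + lo + h)) v < 0 := by
        rw [hp.orient_edge_of_periodic]; linarith
      exact hp.right_of_chord hv (by omega) (by omega) (by omega) (by omega) h4
  rw [hp.orient_edge_of_periodic] at key
  linarith

theorem orient_ne_zero_of_tests (hp : ConvexCycle h p) (hs : 1 ≤ s)
    (hv : ∀ i, 0 ≤ orient (p i) (p (i + 1)) v)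
    (hb : lo < mid ∧ mid < hi ∧ hi ≤ h ∧ hi < lo + h) (ht : PassesTests p s lo mid hi v)
    {a b : ℕ} (hab : a < b) (hbh : b < a + h) : orient (p (s + a)) (p (s + b)) v ≠ 0 := by
  have main : ∀ a b, a < b → b < h → orient (p (s + a)) (p (s + b)) v ≠ 0 := by
    intro a b hab hbh
    by_cases hc : (a < lo ∧ mid ≤ b) ∨ (a < mid ∧ hi ≤ b)
    · exact (hp.right_of_tests hs hv hb ht hbh hc).ne
    · exact (hp.left_of_tests hs hv hb ht hab hbh (by omega)).ne'
  have hsh := hp.shift s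
  have hpos : 0 < h := by omega
  have e1 := hsh.apply_mod a
  have e2 := hsh.apply_mod b
  rw [← e1, ← e2]
  have hne : a % h ≠ b % h := by
    intro heq
    have : (b - a) % h = 0 := by
      have := (Nat.modEq_iff_dvd' hab.le).mp heq
      exact Nat.mod_eq_zero_of_dvd this
    rw [Nat.mod_eq_of_lt (by omega)] at this
    omega
  rcases Nat.lt_or_gt_of_ne hne with hlt | hlt
  · exact main _ _ hlt (Nat.mod_lt _ hpos)
  · rw [orient_swap_left]
    exact neg_ne_zero.mpr (main _ _ hlt (Nat.mod_lt _ hpos))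

/-- The arcs determine the side of every chord on which `v` lies, so membership in a triangle
reduces to comparisons of indices. -/
theorem mem_triangle_iff_splits (hp : ConvexCycle h p) (hs : 1 ≤ s)
    (hv : ∀ i, 0 ≤ orient (p i) (p (i + 1)) v)
    (hb : lo < mid ∧ mid < hi ∧ hi ≤ h ∧ hi < lo + h) (ht : PassesTests p s lo mid hi v)
    {a b c : ℕ} (hab : a < b) (hbc : b < c) (hch : c < h) :
    v ∈ interior (convexHull ℝ {p (s + a), p (s + b), p (s + c)}) ↔ Splits lo mid hi a b c := by
  rw [mem_interior_triangle (hp.pos _ _ _ (by omega) (by omega) (by omega))]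
  constructor
  · rintro ⟨h1, h2, h3⟩
    rw [orient_swap_left] at h3
    have r1 : ¬ ((a < lo ∧ mid ≤ b) ∨ (a < mid ∧ hi ≤ b)) := fun hc =>
      absurd (hp.right_of_tests hs hv hb ht (by omega) hc) (by linarith)
    have r2 : ¬ ((b < lo ∧ mid ≤ c) ∨ (b < mid ∧ hi ≤ c)) := fun hc =>
      absurd (hp.right_of_tests hs hv hb ht (by omega) hc) (by linarith)
    have r3 : ¬ (c < lo ∨ mid ≤ a ∨ c < mid ∨ hi ≤ a ∨ (lo ≤ a ∧ c < hi)) := fun hc =>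
      absurd (hp.left_of_tests hs hv hb ht (by omega : a < c) (by omega) hc) (by linarith)
    unfold Splits
    omega
  · intro hsp
    unfold Splits at hsp
    refine ⟨hp.left_of_tests hs hv hb ht hab (by omega) (by omega),
      hp.left_of_tests hs hv hb ht hbc hch (by omega), ?_⟩
    rw [orient_swap_left]
    have := hp.right_of_tests (a := a) (b := c) hs hv hb ht hch (by omega)
    linarith

/-- The other lemmas on the tests assume that `v` is in the polygon; for arcs of this special form
the tests imply it. They place `v` in the triangle of three consecutive vertices: inside one edge by
the third test, inside the preceding edge by the second one extended to a longer chord, and within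
the ear by the first. -/
theorem mem_convexHull_of_ear_tests (hp : ConvexCycle h p) (hh : 3 ≤ h) (hs : 1 ≤ s) {i : ℕ}
    (ht : PassesTests p s (2 * i) (2 * i + 1) (2 * i + 2) v) :
    v ∈ convexHull ℝ (Set.range p) := by
  obtain ⟨h1, h2, h3⟩ := ht
  obtain ⟨k, hk⟩ : ∃ k, k + 1 = s + 2 * i := ⟨s + 2 * i - 1, by omega⟩
  rw [show s + 2 * i - 1 = k by omega, show s + (2 * i + 1) = k + 2 by omega] at h1
  rw [show s + (2 * i + 1) - 1 = k + 1 by omega, show s + (2 * i + 2) = k + 3 by omega] at h2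
  rw [show s + (2 * i + 2) - 1 = k + 2 by omega, ← hk] at h3
  have h4 := hp.right_of_chord_of_le_right (c := k + 1) (d := k + 3) (b := k + h) h3.le (by omega)
    (by omega) (by omega) h2
  have h5 := hp.pos (k + 1) (k + 2) (k + h) (by omega) (by omega) (by omega)
  rw [hp.periodic] at h4 h5
  refine convexHull_mono ?_ (mem_convexHull_triangle h5 h3.le ?_ ?_)
  · rintro x (rfl | rfl | rfl) <;> exact ⟨_, rfl⟩
  · rw [orient_swap_left]; linarith
  · rw [orient_swap_left]; linarith

end ConvexCycle

theorem orient_eq_zero_comm_left {p q r : ℝ × ℝ} : orient p q r = 0 ↔ orient q p r = 0 := by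
  rw [orient_swap_left q p, neg_eq_zero]

theorem orient_eq_zero_comm_right {p q r : ℝ × ℝ} : orient p q r = 0 ↔ orient p r q = 0 := by
  rw [orient_swap_right p r, neg_eq_zero]

theorem inGeneralPosition_iff {S : Set (ℝ × ℝ)} : InGeneralPosition S ↔
    ∀ p ∈ S, ∀ q ∈ S, ∀ r ∈ S, p ≠ q → p ≠ r → q ≠ r → orient p q r ≠ 0 := by
  simp only [InGeneralPosition, collinear_iff_orient, ne_eq]

theorem inGeneralPosition_union {A B : Set (ℝ × ℝ)} (hA : InGeneralPosition A)
    (hB : InGeneralPosition B)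
    (hAB : ∀ p ∈ A, ∀ q ∈ A, ∀ r ∈ B, p ≠ q → orient p q r ≠ 0)
    (hBA : ∀ p ∈ A, ∀ q ∈ B, ∀ r ∈ B, q ≠ r → orient p q r ≠ 0) :
    InGeneralPosition (A ∪ B) := by
  rw [inGeneralPosition_iff] at *
  rintro p (hp | hp) q (hq | hq) r (hr | hr) h1 h2 h3
  · exact hA p hp q hq r hr h1 h2 h3
  · exact hAB p hp q hq r hr h1
  · rw [Ne, orient_eq_zero_comm_right]; exact hAB p hp r hr q hq h2
  · exact hBA p hp q hq r hr h3
  · rw [Ne, orient_eq_zero_comm_left, orient_eq_zero_comm_right]; exact hAB q hq r hr p hp h3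
  · rw [Ne, orient_eq_zero_comm_left]; exact hBA q hq p hp r hr h2
  · rw [Ne, orient_eq_zero_comm_right, orient_eq_zero_comm_left]; exact hBA r hr p hp q hq h1
  · exact hB p hp q hq r hr h1 h2 h3

/-- If the points inside a convex polygon pass the tests for a system of arcs, they pierce the
triangles of the polygon. -/
theorem existsUnique_mem_triangle {h s : ℕ} {p : ℕ → ℝ × ℝ} (hp : ConvexCycle h p) (hh : 3 ≤ h)
    (hs : 1 ≤ s) {f : ℕ → ℝ × ℝ} {I : Set ℕ} {lo mid hi : ℕ → ℕ}
    (harc : ArcSystem I h lo mid hi)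
    (hv : ∀ t ∈ I, ∀ i, 0 ≤ orient (p i) (p (i + 1)) (f t))
    (htest : ∀ t ∈ I, PassesTests p s (lo t) (mid t) (hi t) (f t))
    {P Q R : ℝ × ℝ} (hP : P ∈ Set.range p) (hQ : Q ∈ Set.range p) (hR : R ∈ Set.range p)
    (hPQ : P ≠ Q) (hPR : P ≠ R) (hQR : Q ≠ R) :
    ∃! x, x ∈ f '' I ∧ x ∈ interior (convexHull ℝ {P, Q, R}) := by
  have main : ∀ a b c, a < b → b < c → c < h → ∃! x, x ∈ f '' I ∧
      x ∈ interior (convexHull ℝ {p (s + a), p (s + b), p (s + c)}) := by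
    intro a b c hab hbc hch
    obtain ⟨t, ⟨htI, hts⟩, hu⟩ := harc.split a b c hab hbc hch
    refine ⟨f t, ⟨⟨t, htI, rfl⟩, ?_⟩, ?_⟩
    · exact (hp.mem_triangle_iff_splits hs (hv t htI) (harc.bounds t htI) (htest t htI) hab hbc
        hch).mpr hts
    · rintro _ ⟨⟨t', ht'I, rfl⟩, ht'⟩
      rw [hu t' ⟨ht'I, (hp.mem_triangle_iff_splits hs (hv t' ht'I) (harc.bounds t' ht'I)
        (htest t' ht'I) hab hbc hch).mp ht'⟩]
  have hidx : ∀ x ∈ Set.range p, ∃ a < h, p (s + a) = x := by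
    rintro _ ⟨i, rfl⟩
    exact hp.exists_shift (by omega) s i
  obtain ⟨a, ha, rfl⟩ := hidx P hP
  obtain ⟨b, hb, rfl⟩ := hidx Q hQ
  obtain ⟨c, hc, rfl⟩ := hidx R hR
  have hab : a ≠ b := fun e => hPQ (by rw [e])
  have hac : a ≠ c := fun e => hPR (by rw [e])
  have hbc : b ≠ c := fun e => hQR (by rw [e])
  have perm12 : ∀ x y z : ℝ × ℝ, ({x, y, z} : Set (ℝ × ℝ)) = {y, x, z} :=
    fun x y z => Set.insert_comm x y {z}
  have perm23 : ∀ x y z : ℝ × ℝ, ({x, y, z} : Set (ℝ × ℝ)) = {x, z, y} :=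
    fun x y z => by rw [Set.pair_comm y z]
  rcases Nat.lt_or_gt_of_ne hab with h1 | h1 <;> rcases Nat.lt_or_gt_of_ne hac with h2 | h2 <;>
    rcases Nat.lt_or_gt_of_ne hbc with h3 | h3
  · exact main a b c h1 h3 hc
  · rw [perm23]; exact main a c b h2 h3 hb
  · omega
  · rw [perm23, perm12]; exact main c a b h2 h1 hb
  · rw [perm12]; exact main b a c h1 h2 hc
  · omega
  · rw [perm12, perm23]; exact main b c a h3 h2 ha
  · rw [perm12, perm23, perm12]; exact main c b a h3 h1 ha

/-- Soundness of the test for one layer. -/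
theorem isNestedAlmostConvex_of_tests {h s : ℕ} {p : ℕ → ℝ × ℝ} (hp : ConvexCycle h p)
    (hh : 3 ≤ h) (hs : 1 ≤ s) {f : ℕ → ℝ × ℝ} {I : Set ℕ} (hI : I.Finite) {lo mid hi : ℕ → ℕ}
    (harc : ArcSystem I h lo mid hi)
    (htest : ∀ t ∈ I, PassesTests p s (lo t) (mid t) (hi t) (f t))
    (hnac : IsNestedAlmostConvex (f '' I)) (hdisj : Disjoint (Set.range p) (f '' I))
    {J : Set ℕ} (hJ : J ⊆ I) (hIJ : f '' I ⊆ convexHull ℝ (f '' J))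
    (hear : ∀ t ∈ J, ∃ i, lo t = 2 * i ∧ mid t = 2 * i + 1 ∧ hi t = 2 * i + 2) :
    IsNestedAlmostConvex (Set.range p ∪ f '' I) ∧
      Set.range p ∪ f '' I ⊆ convexHull ℝ (Set.range p) := by
  -- Only the points of `J` are located by their tests; all others are in their convex hull.
  have hin : f '' I ⊆ convexHull ℝ (Set.range p) := by
    refine hIJ.trans (convexHull_min ?_ (convex_convexHull ℝ _))
    rintro _ ⟨t, ht, rfl⟩
    obtain ⟨i, e1, e2, e3⟩ := hear t ht
    have := htest t (hJ ht)
    rw [e1, e2, e3] at this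
    exact hp.mem_convexHull_of_ear_tests hh hs this
  have hsub : Set.range p ∪ f '' I ⊆ convexHull ℝ (Set.range p) :=
    Set.union_subset (subset_convexHull ℝ _) hin
  refine ⟨?_, hsub⟩
  have hhull := hp.hullVertices_eq hh Set.subset_union_left hsub
  have hpeel : peel (Set.range p ∪ f '' I) = f '' I := by
    rw [peel, hhull, Set.union_sdiff_left, hdisj.symm.sdiff_eq_left]
  have hv : ∀ t ∈ I, ∀ i, 0 ≤ orient (p i) (p (i + 1)) (f t) := fun t ht i =>
    hp.edge_nonneg_of_mem (by omega) (hin ⟨t, ht, rfl⟩) i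
  have htri := fun {P Q R} => existsUnique_mem_triangle hp hh hs harc hv htest (P := P) (Q := Q)
    (R := R)
  have hfin : (Set.range p).Finite := by
    rw [hp.range_eq (by omega)]; exact (Set.finite_Iio h).image p
  rw [isNestedAlmostConvex_iff (hfin.union (hI.image f)) ⟨p 0, Or.inl ⟨0, rfl⟩⟩, hpeel]
  refine ⟨hnac, ?_, ?_⟩
  · have hgpI : InGeneralPosition (f '' I) := by
      rcases (f '' I).eq_empty_or_nonempty with he | hne
      · rw [he]; intro x hx; exact absurd hx (Set.notMem_empty x)
      · exact ((isNestedAlmostConvex_iff (hI.image f) hne).mp hnac).2.1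
    have hnz : ∀ t ∈ I, ∀ a b, a < b → b < a + h → orient (p (s + a)) (p (s + b)) (f t) ≠ 0 :=
      fun t ht a b => hp.orient_ne_zero_of_tests hs (hv t ht) (harc.bounds t ht) (htest t ht)
    refine inGeneralPosition_union ?_ hgpI ?_ ?_
    · rw [inGeneralPosition_iff]
      rintro _ ⟨i, rfl⟩ _ ⟨j, rfl⟩ _ ⟨k, rfl⟩ h1 h2 h3
      obtain ⟨j', hj', e⟩ := hp.exists_shift (by omega) i j
      obtain ⟨k', hk', e'⟩ := hp.exists_shift (by omega) i k
      rw [← e, ← e']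
      have hj0 : j' ≠ 0 := by rintro rfl; exact h1 e
      have hk0 : k' ≠ 0 := by rintro rfl; exact h2 e'
      have hjk : j' ≠ k' := by rintro rfl; exact h3 (e.symm.trans e')
      rcases Nat.lt_or_gt_of_ne hjk with hlt | hlt
      · exact (hp.pos i _ _ (by omega) (by omega) (by omega)).ne'
      · rw [Ne, orient_eq_zero_comm_right]
        exact (hp.pos i _ _ (by omega) (by omega) (by omega)).ne'
    · rintro _ ⟨i, rfl⟩ _ ⟨j, rfl⟩ _ ⟨t, ht, rfl⟩ h1
      obtain ⟨i', hi', e⟩ := hp.exists_shift (by omega) s i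
      obtain ⟨j', hj', e'⟩ := hp.exists_shift (by omega) (s + i') j
      rw [← e, ← e']
      have hj0 : j' ≠ 0 := by rintro rfl; exact h1 (e.symm.trans e')
      rw [Nat.add_assoc]
      exact hnz t ht _ _ (by omega) (by omega)
    · rintro _ ⟨i, rfl⟩ _ ⟨t, ht, rfl⟩ _ ⟨u, hu, rfl⟩ hne hz
      apply hne
      obtain ⟨a, -, e⟩ := hp.exists_shift (by omega) s i
      rw [← e] at hz
      have base : ∀ w ∈ I, 0 < orient (p (s + a)) (p (s + a + 1)) (f w) := fun w hw =>
        (hv w hw _).lt_of_ne' (hnz w hw a (a + 1) (by omega) (by omega))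
      have hlast : orient (p (s + a)) (p (s + a + (h - 1))) (f t) < 0 := by
        have h0 := hnz t ht (a + (h - 1)) (a + (h - 1) + 1) (by omega) (by omega)
        rw [← Nat.add_assoc, ← Nat.add_assoc, ← Nat.add_assoc] at h0
        have := (hv t ht (s + a + (h - 1))).lt_of_ne' h0
        rw [show s + a + (h - 1) + 1 = s + a + h by omega, hp.periodic, orient_swap_left] at this
        linarith
      -- The last case of general position: a vertex in line with two inner points `f t` and `f u`.
      -- By `trans` the chords of the fan at the vertex have both points on the same side, so the
      -- fan triangle around `f t` also contains `f u`; as it is pierced only once, the points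
      -- agree.
      obtain ⟨k, hk1, hk2, hk3, hk4⟩ := exists_fan_triangle (by omega) (hv t ht (s + a)) hlast
      obtain ⟨k', rfl⟩ : ∃ k', k = s + k' := ⟨k - s, by omega⟩
      have hk3 := hk3.lt_of_ne' (hnz t ht _ _ (by omega) (by omega))
      have trans : ∀ j, orient (p (s + a)) (p (s + a + 1)) (f t) *
          orient (p (s + a)) (p j) (f u) =
          orient (p (s + a)) (p (s + a + 1)) (f u) * orient (p (s + a)) (p j) (f t) := by
        intro j
        have := orient_plucker (p (s + a)) (p (s + a + 1)) (p j) (f t) (f u)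
        rw [hz, mul_zero] at this
        linarith
      have bt := base t ht
      have bu := base u hu
      have hu3 : 0 < orient (p (s + a)) (p (s + k')) (f u) :=
        pos_of_mul_pos_right (by rw [trans]; exact mul_pos bu hk3) bt.le
      have hu4 : orient (p (s + a)) (p (s + k' + 1)) (f u) < 0 := by
        by_contra hcon
        have h1 := mul_nonneg bt.le (not_lt.mp hcon)
        rw [trans] at h1
        linarith [mul_neg_of_pos_of_neg bu hk4]
      have hedge : ∀ w ∈ I, 0 < orient (p (s + k')) (p (s + k' + 1)) (f w) := fun w hw =>
        (hv w hw _).lt_of_ne' (hnz w hw k' (k' + 1) (by omega) (by omega))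
      have htripos := hp.pos (s + a) (s + k') (s + k' + 1) (by omega) (by omega) (by omega)
      obtain ⟨n1, n2, n3⟩ := ne_of_orient_pos htripos
      refine (htri ⟨_, rfl⟩ ⟨_, rfl⟩ ⟨_, rfl⟩ n1 n3.symm n2).unique ⟨⟨t, ht, rfl⟩, ?_⟩
        ⟨⟨u, hu, rfl⟩, ?_⟩ <;> rw [mem_interior_triangle htripos]
      · exact ⟨hk3, hedge t ht, by rw [orient_swap_left]; linarith⟩
      · exact ⟨hu3, hedge u hu, by rw [orient_swap_left]; linarith⟩
  · intro P hP Q hQ R hR h1 h2 h3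
    rw [hhull] at hP hQ hR
    rw [hpeel]
    exact htri hP hQ hR h1 h2 h3

/-! ## Doubling the number of vertices -/

/-- Two vertices have no triples. Doubling this degenerate system yields the one for the
quadrilateral around two innermost points. -/
theorem arcSystem_empty : ArcSystem ∅ 2 0 0 0 where
  bounds t ht := absurd ht (Set.notMem_empty t)
  split a b c h1 h2 h3 := by omega

theorem arcSystem_singleton {t : ℕ} {lo mid hi : ℕ → ℕ} (h0 : lo t = 0) (h1 : mid t = 1)
    (h2 : hi t = 2) : ArcSystem {t} 3 lo mid hi where
  bounds u hu := by
    obtain rfl : u = t := hu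
    omega
  split a b c hab hbc hc := by
    refine ⟨t, ⟨rfl, ?_⟩, fun u hu => hu.1⟩
    unfold Splits
    omega

/-- Halve the indices of a triple. If two halves coincide, the triple contains a pair `2 * i`, `2 *
i + 1`, and the new point of this pair alone splits it: new points split nothing else, and old
points keep a pair together. If the halves are distinct, the old point that splits them is the only
one. -/
theorem ArcSystem.double {I : Set ℕ} {h : ℕ} {lo mid hi lo' mid' hi' : ℕ → ℕ}
    (hA : ArcSystem I h lo mid hi) (hh : 2 ≤ h) {g : ℕ → ℕ}
    (hI : ∀ t ∈ I, lo' t = 2 * lo t ∧ mid' t = 2 * mid t ∧ hi' t = 2 * hi t)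
    (hJ : ∀ i < h, lo' (g i) = 2 * i ∧ mid' (g i) = 2 * i + 1 ∧ hi' (g i) = 2 * i + 2) :
    ArcSystem (g '' Set.Iio h ∪ I) (2 * h) lo' mid' hi' where
  bounds := by
    rintro t (⟨i, hi, rfl⟩ | ht)
    · have := hJ i hi
      have : i < h := hi
      omega
    · have := hI t ht
      have := hA.bounds t ht
      omega
  split a b c hab hbc hc := by
    have old : ∀ t ∈ I, Splits (lo' t) (mid' t) (hi' t) a b c →
        Splits (lo t) (mid t) (hi t) (a / 2) (b / 2) (c / 2) ∧ a / 2 < b / 2 ∧ b / 2 < c / 2 := by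
      intro t ht hs
      obtain ⟨e1, e2, e3⟩ := hI t ht
      unfold Splits at *
      omega
    have new : ∀ i < h, Splits (lo' (g i)) (mid' (g i)) (hi' (g i)) a b c →
        (a / 2 = i ∧ b / 2 = i) ∨ (b / 2 = i ∧ c / 2 = i) := by
      intro i hi hs
      obtain ⟨e1, e2, e3⟩ := hJ i hi
      unfold Splits at hs
      omega
    by_cases h1 : a / 2 = b / 2 ∨ b / 2 = c / 2
    · have hb : b / 2 < h := by omega
      refine ⟨g (b / 2), ⟨Or.inl ⟨b / 2, hb, rfl⟩, ?_⟩, ?_⟩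
      · obtain ⟨e1, e2, e3⟩ := hJ (b / 2) hb
        unfold Splits
        omega
      · rintro t ⟨⟨i, hi, rfl⟩ | ht, hs⟩
        · have := new i hi hs
          congr 1
          omega
        · have := old t ht hs
          omega
    · obtain ⟨t, ⟨ht, hs⟩, hu⟩ := hA.split (a / 2) (b / 2) (c / 2) (by omega) (by omega) (by omega)
      refine ⟨t, ⟨Or.inr ht, ?_⟩, ?_⟩
      · obtain ⟨e1, e2, e3⟩ := hI t ht
        unfold Splits at *
        omega
      · rintro u ⟨⟨i, hi, rfl⟩ | hu', hs'⟩
        · have := new i hi hs'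
          omega
        · exact hu u ⟨hu', (old u hu' hs').1⟩

/-! ## Pierced polygons -/

/-- A convex polygon each of whose triangles contains exactly one point of `Y`, where `Y` lies
inside the polygon and off its chords. -/
structure Pierced (h : ℕ) (p : ℕ → ℝ × ℝ) (Y : Set (ℝ × ℝ)) : Prop where
  cycle : ConvexCycle h p
  three_le : 3 ≤ h
  finite : Y.Finite
  edge : ∀ v ∈ Y, ∀ i, 0 < orient (p i) (p (i + 1)) v
  chord : ∀ v ∈ Y, ∀ i j, i < j → j < i + h → orient (p i) (p j) v ≠ 0
  triangle : ∀ i j k, i < j → j < k → k < i + h → ∃! x, x ∈ Y ∧ 0 < orient (p i) (p j) x ∧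
    0 < orient (p j) (p k) x ∧ 0 < orient (p k) (p i) x

theorem IsNestedAlmostConvex.pierced {X : Set (ℝ × ℝ)} (hX : IsNestedAlmostConvex X) {h : ℕ}
    {p : ℕ → ℝ × ℝ} (hp : ConvexCycle h p) (hh : 3 ≤ h) (hsub : Set.range p ⊆ X)
    (hin : X ⊆ convexHull ℝ (Set.range p)) :
    hullVertices X = Set.range p ∧ Pierced h p (peel X) := by
  have hhull := hp.hullVertices_eq hh hsub hin
  refine ⟨hhull, ?_⟩
  have hne : X.Nonempty := ⟨p 0, hsub ⟨0, rfl⟩⟩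
  obtain ⟨-, hgp, htri⟩ := (isNestedAlmostConvex_iff hX.finite hne).mp hX
  rw [inGeneralPosition_iff] at hgp
  have hchord : ∀ v ∈ peel X, ∀ i j, i < j → j < i + h → orient (p i) (p j) v ≠ 0 := by
    intro v hv i j h1 h2
    have hvp : ∀ k, p k ≠ v := by
      rintro k rfl
      exact hv.2 (hhull ▸ ⟨k, rfl⟩)
    exact hgp _ (hsub ⟨i, rfl⟩) _ (hsub ⟨j, rfl⟩) v hv.1 (hp.ne hh h1 h2) (hvp i) (hvp j)
  refine ⟨hp, hh, hX.finite.subset (peel_subset X), ?_, hchord, ?_⟩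
  · intro v hv i
    exact (hp.edge_nonneg_of_mem (by omega) (hin hv.1) i).lt_of_ne'
      (hchord v hv i (i + 1) (by omega) (by omega))
  · intro i j k h1 h2 h3
    have hpos := hp.pos i j k h1 h2 h3
    obtain ⟨n1, n2, n3⟩ := ne_of_orient_pos hpos
    have := htri (p i) (hhull ▸ ⟨i, rfl⟩) (p j) (hhull ▸ ⟨j, rfl⟩) (p k) (hhull ▸ ⟨k, rfl⟩) n1
      n3.symm n2
    simpa only [mem_interior_triangle hpos] using this

namespace Pierced

variable {h : ℕ} {p : ℕ → ℝ × ℝ} {Y : Set (ℝ × ℝ)}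

theorem shift (hp : Pierced h p Y) (s : ℕ) : Pierced h (fun i => p (s + i)) Y where
  cycle := hp.cycle.shift s
  three_le := hp.three_le
  finite := hp.finite
  edge v hv i := hp.edge v hv (s + i)
  chord v hv i j h1 h2 := hp.chord v hv _ _ (by omega) (by omega)
  triangle i j k h1 h2 h3 := hp.triangle _ _ _ (by omega) (by omega) (by omega)

theorem right_of_chord (hp : Pierced h p Y) {v : ℝ × ℝ} (hv : v ∈ Y) {a b c d : ℕ} (h1 : a ≤ c)
    (h2 : c < d) (h3 : d ≤ b) (h4 : b < a + h) (hr : orient (p c) (p d) v < 0) :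
    orient (p a) (p b) v < 0 :=
  hp.cycle.right_of_chord (fun i => (hp.edge v hv i).le) h1 h2 h3 h4 hr

/-- What is beyond a chord is on the left of every chord on the other side. -/
theorem left_of_chord (hp : Pierced h p Y) {v : ℝ × ℝ} (hv : v ∈ Y) {a b c d : ℕ} (h1 : b ≤ c)
    (h2 : c < d) (h3 : d ≤ a + h) (h4 : a < b) (hr : orient (p c) (p d) v < 0) :
    0 < orient (p a) (p b) v := by
  have := hp.right_of_chord hv h1 h2 h3 (by omega) hr
  rw [hp.cycle.orient_edge_of_periodic] at this
  linarith

/-- The cap beyond the chord consists of the `b - a - 1` triangles of the fan at `a`, with one point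
each. Moving `b` to the next vertex adds one triangle. -/
theorem ncard_right_of_chord (hp : Pierced h p Y) {a b : ℕ} (hab : a < b) (hb : b < a + h) :
    {v ∈ Y | orient (p a) (p b) v < 0}.ncard = b - a - 1 := by
  obtain ⟨d, rfl⟩ : ∃ d, b = a + 1 + d := ⟨b - a - 1, by omega⟩
  induction d with
  | zero =>
    have : {v ∈ Y | orient (p a) (p (a + 1 + 0)) v < 0} = ∅ := by
      ext v
      simp only [Set.mem_ofPred_eq, Set.mem_empty_iff_false, iff_false, not_and, not_lt]
      exact fun hv => (hp.edge v hv a).le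
    rw [this]
    simp
  | succ d ih =>
    have ih := ih (by omega) (by omega)
    obtain ⟨x, ⟨hxY, hx1, hx2, hx3⟩, hu⟩ := hp.triangle a (a + 1 + d) (a + 1 + d + 1) (by omega)
      (by omega) (by omega)
    have : {v ∈ Y | orient (p a) (p (a + 1 + (d + 1))) v < 0} =
        insert x {v ∈ Y | orient (p a) (p (a + 1 + d)) v < 0} := by
      ext v
      simp only [Set.mem_ofPred_eq, Set.mem_insert_iff]
      constructor
      · rintro ⟨hv, hr⟩
        by_cases hc : orient (p a) (p (a + 1 + d)) v < 0
        · exact Or.inr ⟨hv, hc⟩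
        · refine Or.inl (hu v ⟨hv, ?_, hp.edge v hv _, ?_⟩)
          · exact (not_lt.mp hc).lt_of_ne' (hp.chord v hv _ _ (by omega) (by omega))
          · rw [orient_swap_left]; exact neg_pos.mpr hr
      · rintro (rfl | ⟨hv, hr⟩)
        · refine ⟨hxY, ?_⟩
          rw [orient_swap_left] at hx3
          exact neg_pos.mp hx3
        · exact ⟨hv, hp.right_of_chord hv le_rfl (by omega) (by omega) (by omega) hr⟩
    rw [this, Set.ncard_insert_of_notMem _ (hp.finite.subset (Set.sep_subset _ _)), ih]
    · omega
    · rintro ⟨-, hr⟩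
      linarith

/-- The chord from `0` to `h - 1` is an edge reversed, so all of `Y` is beyond it. -/
theorem ncard_eq (hp : Pierced h p Y) : Y.ncard = h - 2 := by
  have hh := hp.three_le
  have := hp.ncard_right_of_chord (a := 0) (b := h - 1) (by omega) (by omega)
  rw [show {v ∈ Y | orient (p 0) (p (h - 1)) v < 0} = Y from ?_] at this
  · omega
  · ext v
    refine ⟨fun hv => hv.1, fun hv => ⟨hv, ?_⟩⟩
    have := hp.edge v hv (h - 1)
    rw [show h - 1 + 1 = 0 + h by omega, hp.cycle.orient_edge_of_periodic] at this
    linarith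

theorem exists_ear (hp : Pierced h p Y) (k : ℕ) :
    ∃! x, x ∈ Y ∧ orient (p k) (p (k + 2)) x < 0 := by
  have hh := hp.three_le
  obtain ⟨x, ⟨hxY, -, -, hx3⟩, hu⟩ := hp.triangle k (k + 1) (k + 2) (by omega) (by omega) (by omega)
  rw [orient_swap_left] at hx3
  refine ⟨x, ⟨hxY, neg_pos.mp hx3⟩, ?_⟩
  rintro y ⟨hyY, hy⟩
  refine hu y ⟨hyY, hp.edge y hyY k, hp.edge y hyY (k + 1), ?_⟩
  rw [orient_swap_left]
  exact neg_pos.mpr hy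

end Pierced

/-- A point that a line separates from all others is a hull vertex. -/
theorem mem_hullVertices_of_separated {Y : Set (ℝ × ℝ)} {v a b : ℝ × ℝ} (hv : v ∈ Y)
    (hneg : orient a b v < 0) (hpos : ∀ w ∈ Y, w ≠ v → 0 ≤ orient a b w) :
    v ∈ hullVertices Y := by
  -- The affine function `orient a b` has its minimum over the hull at `v` only.
  have key : ∀ x ∈ convexHull ℝ Y, orient a b v ≤ orient a b x ∧
      (orient a b x = orient a b v → x = v) := by
    intro x hx
    rcases (Y \ {v}).eq_empty_or_nonempty with he | hne
    · have : Y ⊆ {v} := Set.sdiff_eq_empty.mp he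
      have := convexHull_mono this hx
      rw [convexHull_singleton] at this
      obtain rfl : x = v := this
      exact ⟨le_rfl, fun _ => rfl⟩
    · rw [show Y = insert v (Y \ {v}) by simp [Set.insert_eq_of_mem hv],
        convexHull_insert hne, mem_convexJoin] at hx
      obtain ⟨v', hv', w, hw, s, t, hs, ht, hst, rfl⟩ := hx
      have hv' : v' = v := hv'
      have hw0 : 0 ≤ orient a b w :=
        orient_nonneg_of_mem_convexHull (fun y hy => hpos y hy.1 hy.2) hw
      rw [hv', orient_combo _ _ _ _ hst]
      obtain rfl : s = 1 - t := by linarith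
      constructor
      · nlinarith
      · intro he
        have : t * (orient a b w - orient a b v) = 0 := by linarith
        rcases mul_eq_zero.mp this with h0 | h0
        · subst h0; simp
        · linarith
  unfold hullVertices
  rw [mem_extremePoints_iff_left]
  refine ⟨subset_convexHull ℝ _ hv, ?_⟩
  rintro x hx y hy ⟨s, t, hs, ht, hst, he⟩
  refine (key x hx).2 ?_
  have h1 := orient_combo a b x y hst
  rw [he] at h1
  have h2 := (key x hx).1
  have h3 := (key y hy).1
  obtain rfl : s = 1 - t := by linarith
  have : 0 ≤ t * (orient a b y - orient a b v) := mul_nonneg ht.le (by linarith)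
  nlinarith

/-- A convex polygon is determined by its vertex set and its first vertex. -/
theorem ConvexCycle.ext {m : ℕ} {q q' : ℕ → ℝ × ℝ} (hq : ConvexCycle m q) (hq' : ConvexCycle m q')
    (hinj : Set.InjOn q (Set.Iio m)) (hinj' : Set.InjOn q' (Set.Iio m))
    (hr : Set.range q = Set.range q') (h0 : q 0 = q' 0) (hm : 0 < m) : q = q' := by
  -- The index of a vertex can be read off from the vertex set and the first vertex: it is one more
  -- than the number of vertices before it in angular order.
  have rank : ∀ {r : ℕ → ℝ × ℝ}, ConvexCycle m r → Set.InjOn r (Set.Iio m) → ∀ i, 0 < i → i < m →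
      {y ∈ Set.range r | 0 < orient (r 0) y (r i)}.ncard = i - 1 := by
    intro r hr hinj i hi him
    have : {y ∈ Set.range r | 0 < orient (r 0) y (r i)} = r '' Set.Ioo 0 i := by
      ext y
      constructor
      · rintro ⟨⟨j, rfl⟩, hpos⟩
        obtain ⟨k, hk, e⟩ := hr.exists_shift hm 0 j
        rw [Nat.zero_add] at e
        rw [← e] at hpos ⊢
        refine ⟨k, ⟨?_, ?_⟩, rfl⟩
        · by_contra h0
          obtain rfl : k = 0 := by omega
          simp at hpos
        · by_contra hlt
          rcases (not_lt.mp hlt).eq_or_lt with rfl | hlt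
          · simp at hpos
          · have := hr.pos 0 i k hi hlt (by omega)
            rw [orient_swap_right] at this
            linarith
      · rintro ⟨j, ⟨h1, h2⟩, rfl⟩
        exact ⟨⟨j, rfl⟩, hr.pos 0 j i h1 h2 (by omega)⟩
    rw [this, (hinj.mono fun j hj => lt_trans hj.2 him : Set.InjOn r (Set.Ioo 0 i)).ncard_image]
    rw [← Finset.coe_Ioo, Set.ncard_coe_finset, Nat.card_Ioo]
    omega
  have main : ∀ i < m, q i = q' i := by
    intro i hi
    rcases Nat.eq_zero_or_pos i with rfl | hi0
    · exact h0
    obtain ⟨j, hj⟩ : q i ∈ Set.range q' := hr ▸ ⟨i, rfl⟩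
    rw [← hq'.apply_mod] at hj
    have hjm := Nat.mod_lt j hm
    generalize j % m = k at hj hjm
    have hk0 : 0 < k := by
      rcases Nat.eq_zero_or_pos k with rfl | hk
      · rw [← h0] at hj
        exact absurd (hinj hm hi hj) (by omega)
      · exact hk
    have r1 := rank hq hinj i hi0 hi
    have r2 := rank hq' hinj' k hk0 hjm
    rw [hr, h0, ← hj, r2] at r1
    obtain rfl : k = i := by omega
    exact hj.symm
  funext i
  rw [← hq.apply_mod, ← hq'.apply_mod]
  exact main _ (Nat.mod_lt _ hm)

/-! ## Ears of a pierced polygon -/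

/-- `g k` is the point of `Y` in the ear of the polygon at the vertex `k + 1`. -/
structure Ears (m : ℕ) (p : ℕ → ℝ × ℝ) (Y : Set (ℝ × ℝ)) (g : ℕ → ℝ × ℝ) : Prop where
  pierced : Pierced (2 * m) p Y
  mem : ∀ k, g k ∈ Y
  right : ∀ k, orient (p k) (p (k + 2)) (g k) < 0

theorem Pierced.exists_ears {m : ℕ} {p : ℕ → ℝ × ℝ} {Y : Set (ℝ × ℝ)}
    (hp : Pierced (2 * m) p Y) : ∃ g, Ears m p Y g := by
  choose g hg using fun k => (hp.exists_ear k).exists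
  exact ⟨g, hp, fun k => (hg k).1, fun k => (hg k).2⟩

namespace Ears

variable {m : ℕ} {p g : ℕ → ℝ × ℝ} {Y : Set (ℝ × ℝ)}

theorem two_le (hg : Ears m p Y g) : 2 ≤ m := by
  have := hg.pierced.three_le
  omega

theorem eq_of_right (hg : Ears m p Y g) {y : ℝ × ℝ} (hy : y ∈ Y) {k : ℕ}
    (hr : orient (p k) (p (k + 2)) y < 0) : g k = y :=
  (hg.pierced.exists_ear k).unique ⟨hg.mem k, hg.right k⟩ ⟨hy, hr⟩

theorem shift (hg : Ears m p Y g) (s : ℕ) : Ears m (fun i => p (s + i)) Y (fun i => g (s + i)) where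
  pierced := hg.pierced.shift s
  mem _ := hg.mem _
  right k := hg.right (s + k)

theorem periodic (hg : Ears m p Y g) (k : ℕ) : g (k + 2 * m) = g k := by
  refine hg.eq_of_right (hg.mem _) ?_
  rw [show k + 2 * m + 2 = k + 2 + 2 * m by omega, hg.pierced.cycle.periodic,
    hg.pierced.cycle.periodic]
  exact hg.right k

/-- Ears at distance at least two in both directions are on different sides of the chord from `p k`
to `p l`, so they share no point. -/
theorem adjacent (hg : Ears m p Y g) {k l : ℕ} (h1 : k < l) (h2 : l < k + 2 * m)
    (he : g k = g l) : l = k + 1 ∨ l + 1 = k + 2 * m := by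
  by_contra hcon
  have r1 := hg.pierced.right_of_chord (hg.mem k) (a := k) (b := l) le_rfl (by omega) (by omega) h2
    (hg.right k)
  have r2 := hg.pierced.left_of_chord (hg.mem l) (a := k) (b := l) le_rfl (by omega) (by omega) h1
    (hg.right l)
  rw [he] at r1
  linarith

/-- The short diagonal of an ear separates its point from all others. -/
theorem mem_hullVertices (hg : Ears m p Y g) (k : ℕ) : g k ∈ hullVertices Y := by
  have := hg.two_le
  refine mem_hullVertices_of_separated (hg.mem k) (hg.right k) fun w hw hne => ?_
  by_contra hcon
  exact hne (hg.eq_of_right hw (not_le.mp hcon)).symm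

variable {q : ℕ → ℝ × ℝ}

theorem injOn_even (hg : Ears m p Y g) : Set.InjOn (fun i => g (2 * i)) (Set.Iio m) := by
  have main : ∀ i j, i < j → j < m → g (2 * i) ≠ g (2 * j) := by
    intro i j h1 h2 he
    have := hg.adjacent (by omega) (by omega) he
    omega
  intro i hi j hj he
  rcases Nat.lt_trichotomy i j with h | h | h
  · exact absurd he (main i j h hj)
  · exact h
  · exact absurd he.symm (main j i h hi)

/-- No two even ears are adjacent, so they hold `m` different hull vertices; there are only `m`. -/
theorem image_even (hg : Ears m p Y g) (hinj : Set.InjOn q (Set.Iio m))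
    (hq : hullVertices Y = q '' Set.Iio m) :
    (fun i => g (2 * i)) '' Set.Iio m = hullVertices Y := by
  refine Set.eq_of_subset_of_ncard_le ?_ ?_ (hg.pierced.finite.subset (hullVertices_subset Y))
  · rintro _ ⟨i, _, rfl⟩
    exact hg.mem_hullVertices _
  · rw [hg.injOn_even.ncard_image, hq, hinj.ncard_image]

/-- A hull vertex of the inner points lies in two consecutive ears. -/
theorem exists_double_ear (hg : Ears m p Y g) (hinj : Set.InjOn q (Set.Iio m))
    (hq : hullVertices Y = q '' Set.Iio m) {y : ℝ × ℝ} (hy : y ∈ hullVertices Y) :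
    ∃ r < 2 * m, g r = y ∧ g (r + 1) = y := by
  have h1 := hg.image_even hinj hq
  have h2 := (hg.shift 1).image_even hinj hq
  obtain ⟨i, hi, e⟩ := h1.symm ▸ hy
  obtain ⟨j, hj, e'⟩ := h2.symm ▸ hy
  have hi : i < m := hi
  have hj : j < m := hj
  simp only at e e'
  rcases Nat.lt_or_ge (2 * i) (1 + 2 * j) with hlt | hlt
  · rcases hg.adjacent hlt (by omega) (e.trans e'.symm) with h | h
    · exact ⟨2 * i, by omega, e, by rw [← h]; exact e'⟩
    · refine ⟨1 + 2 * j, by omega, e', ?_⟩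
      rw [h, hg.periodic]
      exact e
  · rcases hg.adjacent (by omega : 1 + 2 * j < 2 * i) (by omega) (e'.trans e.symm) with h | h
    · exact ⟨1 + 2 * j, by omega, e', by rw [← h]; exact e⟩
    · omega

/-- The point of an odd ear is that of one of the two even neighbours. If an odd ear agreed with its
successor although the next odd ear agrees with its predecessor, two odd ears would share a point.
So the choice at the ears `0` and `1` propagates backwards around the whole polygon. -/
theorem odd_eq_even (hg : Ears m p Y g) (hinj : Set.InjOn q (Set.Iio m))
    (hq : hullVertices Y = q '' Set.Iio m) (h0 : g 1 = g 0) (i : ℕ) :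
    g (2 * i + 1) = g (2 * i) := by
  have hm := hg.two_le
  have hodd : Set.InjOn (fun i => g (2 * i + 1)) (Set.Iio m) := by
    have := (hg.shift 1).injOn_even
    simpa only [Nat.add_comm 1] using this
  have alt : ∀ i < m, g (2 * i + 1) = g (2 * i) ∨ g (2 * i + 1) = g (2 * i + 2) := by
    intro i hi
    obtain ⟨j, hj, e⟩ := (hg.image_even hinj hq).symm ▸ hg.mem_hullVertices (2 * i + 1)
    have hj : j < m := hj
    simp only at e
    rcases Nat.lt_or_ge (2 * j) (2 * i + 1) with hlt | hlt
    · rcases hg.adjacent hlt (by omega) e with h | h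
      · obtain rfl : j = i := by omega
        exact Or.inl e.symm
      · right
        rw [← e, show 2 * i + 2 = 2 * j + 2 * m by omega, hg.periodic]
    · rcases hg.adjacent (by omega : 2 * i + 1 < 2 * j) (by omega) e.symm with h | h
      · right
        rw [← e, h]
      · omega
  have main : ∀ d i, i + d + 1 = m → g (2 * i + 1) = g (2 * i) := by
    intro d
    induction d with
    | zero =>
      intro i hi
      rcases alt i (by omega) with h | h
      · exact h
      · rw [show 2 * i + 2 = 0 + 2 * m by omega, hg.periodic, ← h0] at h
        exact absurd (hodd (by simp; omega : i ∈ Set.Iio m) (by simp; omega : 0 ∈ Set.Iio m) h)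
          (by omega)
    | succ d ih =>
      intro i hi
      rcases alt i (by omega) with h | h
      · exact h
      · have := ih (i + 1) (by omega)
        rw [show 2 * (i + 1) = 2 * i + 2 by ring] at this
        rw [← this] at h
        exact absurd (hodd (by simp; omega : i ∈ Set.Iio m) (by simp; omega : i + 1 ∈ Set.Iio m) h)
          (by omega)
  have hper : ∀ a k, g (a + 2 * m * k) = g a := by
    intro a k
    induction k with
    | zero => simp
    | succ k ih => rw [Nat.mul_succ, ← Nat.add_assoc, hg.periodic, ih]
  have hi := Nat.mod_add_div i m
  have hlt := Nat.mod_lt i (by omega : 0 < m)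
  have e1 : 2 * i = 2 * (i % m) + 2 * m * (i / m) := by
    conv_lhs => rw [← hi]
    ring
  have e2 : 2 * i + 1 = 2 * (i % m) + 1 + 2 * m * (i / m) := by omega
  rw [e2, e1, hper, hper]
  exact main (m - 1 - i % m) _ (by omega)

section Aligned

variable (hg : Ears m p Y g) (ha : ∀ i, g (2 * i + 1) = g (2 * i)) {A B : ℕ}
include hg ha

/-- The line through two ear points separates the vertices on one side from those on the other. -/
theorem right_of_line (hAB : A < B) (hB : B < A + m) {t : ℕ} (h1 : 2 * A + 2 ≤ t)
    (h2 : t ≤ 2 * B + 1) : orient (g (2 * A)) (g (2 * B)) (p t) < 0 := by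
  have hp := hg.pierced
  have hc := hp.cycle
  have u1 := hg.right (2 * A)
  have u2 := hg.right (2 * A + 1)
  have w1 := hg.right (2 * B)
  have w2 := hg.right (2 * B + 1)
  rw [ha] at u2 w2
  have hu := hg.mem (2 * A)
  have hw := hg.mem (2 * B)
  generalize g (2 * A) = u at *
  generalize g (2 * B) = w at *
  -- The ears of `u` and `w` fix on which side these points are of the chords near both ends of the
  -- range. Angular transitivity at a vertex then gives the sides `fb`, `fa`, `fc` of the line
  -- through `u` and `w`.
  have uac := hp.right_of_chord hu (a := 2 * A + 1) (b := 2 * B + 1) le_rfl (by omega) (by omega)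
    (by omega) u2
  have u1' := u1
  rw [← hc.periodic, ← hc.periodic (2 * A + 2)] at u1'
  have ubc := hp.left_of_chord hu (a := 2 * A + 2) (b := 2 * B + 1) (by omega) (by omega) (by omega)
    (by omega) u1'
  have ubd := hp.left_of_chord hu (a := 2 * A + 2) (b := 2 * B + 2) (by omega) (by omega) (by omega)
    (by omega) u1'
  have wac := hp.left_of_chord hw (a := 2 * A + 1) (b := 2 * B + 1) le_rfl (by omega) (by omega)
    (by omega) w2
  have wbc := hp.left_of_chord hw (a := 2 * A + 2) (b := 2 * B + 1) le_rfl (by omega) (by omega)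
    (by omega) w2
  have wbd := hp.right_of_chord hw (a := 2 * A + 2) (b := 2 * B + 2) (by omega) (by omega) le_rfl
    (by omega) w1
  have fb : orient u w (p (2 * A + 2)) < 0 := by
    have := orient_trans wbc.le
      (hc.pos (2 * A + 2) (2 * B + 1) (2 * B + 2) (by omega) (by omega) (by omega)) ubc.le
      (by rw [orient_swap_right]; linarith) ubd (Or.inl wbc)
    rw [orient_swap_right, orient_rotate (p _) u w |>.symm] at this
    linarith
  have fa : 0 < orient u w (p (2 * A + 1)) := by
    have := orient_trans (hp.edge u hu (2 * A + 1)).le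
      (hc.pos (2 * A + 1) (2 * A + 2) (2 * B + 1) (by omega) (by omega) (by omega))
      (hp.edge w hw (2 * A + 1)).le (by rw [orient_swap_right]; linarith) wac
      (Or.inl (hp.edge u hu (2 * A + 1)))
    rwa [← orient_rotate] at this
  have fc : orient u w (p (2 * B + 1)) < 0 := by
    have hpos := hc.pos (2 * B + 1) (2 * B + 2) (2 * A + 1 + 2 * m) (by omega) (by omega) (by omega)
    rw [hc.periodic] at hpos
    have := orient_trans (hp.edge w hw (2 * B + 1)).le hpos (hp.edge u hu (2 * B + 1)).le
      (by rw [orient_rotate]; exact wac)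
      (by rw [orient_swap_left]; linarith) (Or.inl (hp.edge w hw (2 * B + 1)))
    rw [orient_swap_right, orient_rotate (p _) u w |>.symm] at this
    linarith
  rcases h1.eq_or_lt with rfl | h1
  · exact fb
  rcases h2.eq_or_lt with rfl | h2
  · exact fc
  -- Otherwise the vertices `2 * A + 1`, `2 * A + 2`, `t`, `2 * B + 1` would alternate with respect
  -- to the line.
  by_contra hcon
  exact not_alternating (hc.pos (2 * A + 1) (2 * A + 2) t (by omega) (by omega) (by omega))
    (hc.pos (2 * A + 2) t (2 * B + 1) (by omega) (by omega) (by omega))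
    (hc.pos (2 * A + 1) t (2 * B + 1) (by omega) (by omega) (by omega))
    (hc.pos (2 * A + 1) (2 * A + 2) (2 * B + 1) (by omega) (by omega) (by omega)) fa.le fb
    (not_lt.mp hcon) fc

/-- The point lies in a triangle of polygon vertices that are all to the right of the line, by
`right_of_line`. -/
theorem right_of_line_of_right_of_chord (hAB : A < B) (hB : B < A + m) {v : ℝ × ℝ} (hv : v ∈ Y)
    (hr : orient (p (2 * A + 2)) (p (2 * B + 1)) v < 0) :
    orient (g (2 * A)) (g (2 * B)) v < 0 := by
  have hp := hg.pierced
  obtain ⟨t, h1, h2, h3, h4⟩ := exists_fan_triangle (by omega) (hp.edge v hv _).le hr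
  have f1 := hg.right_of_line ha hAB hB (t := 2 * A + 2) (by omega) (by omega)
  have f2 := hg.right_of_line ha hAB hB (t := t) (by omega) (by omega)
  have f3 := hg.right_of_line ha hAB hB (t := t + 1) (by omega) (by omega)
  have key := orient_barycentric_orient (g (2 * A)) (g (2 * B)) (p (2 * A + 2)) (p t) (p (t + 1)) v
  have hpos := hp.cycle.pos (2 * A + 2) t (t + 1) (by omega) (by omega) (by omega)
  have he := hp.edge v hv t
  rw [orient_swap_left] at h4
  have h4 := neg_lt_zero.mp h4
  by_contra hcon
  have := mul_nonneg hpos.le (not_lt.mp hcon)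
  linarith [mul_neg_of_pos_of_neg he f1, mul_neg_of_pos_of_neg h4 f2,
    mul_nonpos_of_nonneg_of_nonpos h3 f3.le]

/-- The middle point is beyond the short diagonal of its ear, hence beyond the longer chord between
the ears of the outer two points, hence to the right of the line through these two. -/
theorem convexCycle : ConvexCycle m (fun i => g (2 * i)) where
  periodic i := by rw [Nat.mul_add, hg.periodic]
  pos i j k h1 h2 h3 := by
    rw [orient_swap_right]
    have := hg.right_of_line_of_right_of_chord ha (h1.trans h2) h3 (hg.mem (2 * j))
      (hg.pierced.right_of_chord (hg.mem _) (by omega) (by omega) (by omega) (by omega)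
        (hg.right (2 * j)))
    linarith

/-- The points beyond the line through two ear points are those beyond the chord of the polygon. -/
theorem right_of_chord_of_right_of_line {Z : Set (ℝ × ℝ)} (hYZ : Y ⊆ Set.range (fun i => g (2 * i)) ∪ Z)
    (hZ : Pierced m (fun i => g (2 * i)) Z) (hAB : A < B) (hB : B < A + m) {v : ℝ × ℝ}
    (hv : v ∈ Y) (hr : orient (g (2 * A)) (g (2 * B)) v < 0) :
    orient (p (2 * A + 2)) (p (2 * B + 1)) v < 0 := by
  -- Counting turns the inclusion `hsub` into equality: the chord cuts off `2 * (B - A - 1)` points.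
  -- The line cuts off at most `B - A - 1` vertices of the inner polygon, and exactly `B - A - 1`
  -- points of `Z`.
  have hP := hg.pierced.ncard_right_of_chord (a := 2 * A + 2) (b := 2 * B + 1) (by omega) (by omega)
  have hQ := hZ.ncard_right_of_chord hAB hB
  have hsub : {v ∈ Y | orient (p (2 * A + 2)) (p (2 * B + 1)) v < 0} ⊆
      {v ∈ Y | orient (g (2 * A)) (g (2 * B)) v < 0} := fun w hw =>
    ⟨hw.1, hg.right_of_line_of_right_of_chord ha hAB hB hw.1 hw.2⟩
  have hcov : {v ∈ Y | orient (g (2 * A)) (g (2 * B)) v < 0} ⊆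
      (fun i => g (2 * i)) '' Set.Ioo A B ∪ {v ∈ Z | orient (g (2 * A)) (g (2 * B)) v < 0} := by
    rintro w ⟨hw, hwr⟩
    rcases hYZ hw with ⟨j, rfl⟩ | hz
    · left
      obtain ⟨k, hk, e⟩ := (hg.convexCycle ha).exists_shift (by omega) A j
      simp only at e hwr ⊢
      rw [← e] at hwr ⊢
      refine ⟨A + k, ⟨?_, ?_⟩, rfl⟩
      · by_contra h0
        obtain rfl : k = 0 := by omega
        simp at hwr
      · by_contra hlt
        rcases (not_lt.mp hlt).eq_or_lt with he | hlt
        · rw [← he] at hwr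
          simp at hwr
        · have := (hg.convexCycle ha).pos A B (A + k) hAB hlt (by omega)
          linarith
    · exact Or.inr ⟨hz, hwr⟩
  have hle := Set.ncard_le_ncard hcov (((Set.finite_Ioo A B).image _).union
    (hZ.finite.subset (Set.sep_subset _ _)))
  have hle2 := Set.ncard_union_le ((fun i => g (2 * i)) '' Set.Ioo A B)
    {v ∈ Z | orient (g (2 * A)) (g (2 * B)) v < 0}
  have hle3 : ((fun i => g (2 * i)) '' Set.Ioo A B).ncard ≤ B - A - 1 := by
    refine (Set.ncard_image_le (Set.finite_Ioo A B)).trans ?_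
    rw [← Finset.coe_Ioo, Set.ncard_coe_finset, Nat.card_Ioo]
  have heq := Set.eq_of_subset_of_ncard_le hsub (by omega)
    (hg.pierced.finite.subset (Set.sep_subset _ _))
  have : v ∈ {v ∈ Y | orient (g (2 * A)) (g (2 * B)) v < 0} := ⟨hv, hr⟩
  rw [← heq] at this
  exact this.2

end Aligned

end Ears

/-! ### Nested almost convex sets pass the tests -/

/-- The renumbered polygon is read from `h` instead of `0`, so that the predecessor of its first
vertex has an index. -/
theorem ConvexCycle.passesTests_shift_iff {h s lo mid hi : ℕ} {p : ℕ → ℝ × ℝ} {v : ℝ × ℝ}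
    (hp : ConvexCycle h p) (hh : 1 ≤ h) (hs : 1 ≤ s) (hm : 1 ≤ mid) (hhi : 1 ≤ hi) :
    PassesTests (fun i => p (s + i)) h lo mid hi v ↔ PassesTests p s lo mid hi v := by
  unfold PassesTests
  beta_reduce
  rw [show s + (h + lo - 1) = s + lo - 1 + h by omega, show s + (h + mid) = s + mid + h by omega,
    show s + (h + mid - 1) = s + mid - 1 + h by omega, show s + (h + hi) = s + hi + h by omega,
    show s + (h + lo) = s + lo + h by omega, show s + (h + hi - 1) = s + hi - 1 + h by omega]
  simp only [hp.periodic]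

theorem Pierced.passesTests_three {p : ℕ → ℝ × ℝ} {Y : Set (ℝ × ℝ)} (hp : Pierced 3 p Y)
    {v : ℝ × ℝ} (hv : v ∈ Y) {s : ℕ} (hs : 1 ≤ s) : PassesTests p s 0 1 2 v := by
  obtain ⟨r, rfl⟩ : ∃ r, s = r + 1 := ⟨s - 1, by omega⟩
  have h0 := hp.edge v hv r
  have h1 := hp.edge v hv (r + 1)
  have h2 := hp.edge v hv (r + 2)
  rw [show r + 2 + 1 = r + 3 by omega, hp.cycle.periodic, orient_swap_left] at h2
  have e : p (r + 1 + 2) = p r := hp.cycle.periodic r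
  refine ⟨?_, ?_, h1⟩
  · exact neg_pos.mp h2
  · rw [orient_swap_left] at h0
    rw [e]
    exact neg_pos.mp h0

namespace Pierced

variable {m s : ℕ} {p q : ℕ → ℝ × ℝ} {Y : Set (ℝ × ℝ)}

/-- If one vertex of the inner layer lies in the right two ears, then all of them do. -/
theorem exists_aligned_ears (hp : Pierced (2 * m) p Y) (hq : ConvexCycle m q)
    (hinj : Set.InjOn q (Set.Iio m)) (hY : hullVertices Y = Set.range q) (hs : 1 ≤ s)
    (h1 : orient (p (s - 1)) (p (s + 1)) (q 0) < 0) (h2 : orient (p s) (p (s + 2)) (q 0) < 0) :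
    ∃ g, Ears m (fun i => p (s - 1 + i)) Y g ∧ (∀ i, g (2 * i + 1) = g (2 * i)) ∧
      (fun i => g (2 * i)) = q := by
  obtain ⟨g, hg⟩ := (hp.shift (s - 1)).exists_ears
  have hm := hg.two_le
  have hq0 : q 0 ∈ Y := hullVertices_subset Y (hY ▸ ⟨0, rfl⟩)
  have hY' := hY
  rw [hq.range_eq (by omega)] at hY'
  have e0 : g 0 = q 0 := hg.eq_of_right hq0 (by
    rw [show s + 1 = s - 1 + (0 + 2) by omega] at h1
    exact h1)
  have e1 : g 1 = q 0 := hg.eq_of_right hq0 (by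
    rw [show s + 2 = s - 1 + (1 + 2) by omega] at h2
    nth_rewrite 1 [show s = s - 1 + 1 by omega] at h2
    exact h2)
  have ha := hg.odd_eq_even hinj hY' (e1.trans e0.symm)
  refine ⟨g, hg, ha, ?_⟩
  refine (hg.convexCycle ha).ext hq hg.injOn_even hinj ?_ e0 (by omega)
  rw [← hY, ← hg.image_even hinj hY', (hg.convexCycle ha).range_eq (by omega)]

/-- For these arcs the tests ask for the two ears of the inner vertex and for the edge between their
tips. -/
theorem passesTests_hullVertex (hp : Pierced (2 * m) p Y) (hq : ConvexCycle m q)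
    (hinj : Set.InjOn q (Set.Iio m)) (hY : hullVertices Y = Set.range q) (hs : 1 ≤ s)
    (h1 : orient (p (s - 1)) (p (s + 1)) (q 0) < 0) (h2 : orient (p s) (p (s + 2)) (q 0) < 0)
    (i : ℕ) : PassesTests p s (2 * i) (2 * i + 1) (2 * i + 2) (q i) := by
  obtain ⟨g, hg, ha, rfl⟩ := hp.exists_aligned_ears hq hinj hY hs h1 h2
  have r1 := hg.right (2 * i)
  have r2 := hg.right (2 * i + 1)
  rw [ha] at r2
  refine ⟨?_, ?_, ?_⟩
  · rwa [show s + 2 * i - 1 = s - 1 + 2 * i by omega,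
      show s + (2 * i + 1) = s - 1 + (2 * i + 2) by omega]
  · rwa [show s + (2 * i + 1) - 1 = s - 1 + (2 * i + 1) by omega,
      show s + (2 * i + 2) = s - 1 + (2 * i + 1 + 2) by omega]
  · exact hp.edge _ (hg.mem _) (s + 2 * i)

/-- The inner chord from `A` to `B` cuts off the same points as the outer chord from `2 * A + 2` to
`2 * B + 1`, counted from `s - 1`. For `A = lo - 1` and `B = mid` this is the chord of the first
test of the doubled arcs; the other two tests correspond likewise. -/
theorem passesTests_double (hp : Pierced (2 * m) p Y) (hq : Pierced m q (peel Y))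
    (hinj : Set.InjOn q (Set.Iio m)) (hY : hullVertices Y = Set.range q) (hs : 1 ≤ s)
    (h1 : orient (p (s - 1)) (p (s + 1)) (q 0) < 0) (h2 : orient (p s) (p (s + 2)) (q 0) < 0)
    {v : ℝ × ℝ} (hv : v ∈ peel Y) {lo mid hi : ℕ}
    (hb : lo < mid ∧ mid < hi ∧ hi ≤ m ∧ hi < lo + m) (ht : PassesTests q m lo mid hi v) :
    PassesTests p s (2 * lo) (2 * mid) (2 * hi) v := by
  obtain ⟨g, hg, ha, rfl⟩ := hp.exists_aligned_ears hq.cycle hinj hY hs h1 h2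
  have hYZ : Y ⊆ Set.range (fun i => g (2 * i)) ∪ peel Y := by
    rw [← hY, Set.union_comm, peel_union]
  have main := fun {A B} (h1 : A < B) (h2 : B < A + m) =>
    hg.right_of_chord_of_right_of_line ha hYZ hq h1 h2 hv.1
  have hper := hp.cycle.periodic
  have hgper := hg.periodic
  obtain ⟨t1, t2, t3⟩ := ht
  refine ⟨?_, ?_, ?_⟩
  · have := main (A := m + lo - 1) (B := m + mid) (by omega) (by omega) t1
    rw [show s - 1 + (2 * (m + lo - 1) + 2) = s + 2 * lo - 1 + 2 * m by omega,
      show s - 1 + (2 * (m + mid) + 1) = s + 2 * mid + 2 * m by omega, hper, hper] at this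
    exact this
  · have := main (A := m + mid - 1) (B := m + hi) (by omega) (by omega) t2
    rw [show s - 1 + (2 * (m + mid - 1) + 2) = s + 2 * mid - 1 + 2 * m by omega,
      show s - 1 + (2 * (m + hi) + 1) = s + 2 * hi + 2 * m by omega, hper, hper] at this
    exact this
  · have := main (A := m + hi - 1) (B := m + lo + m) (by omega) (by omega) (by
      rw [show 2 * (m + lo + m) = 2 * (m + lo) + 2 * m by ring, hgper, orient_swap_left]
      exact neg_lt_zero.mpr t3)
    rw [show s - 1 + (2 * (m + hi - 1) + 2) = s + 2 * hi - 1 + 2 * m by omega,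
      show s - 1 + (2 * (m + lo + m) + 1) = s + 2 * lo + 2 * m + 2 * m by omega, hper, hper, hper,
      orient_swap_left] at this
    exact neg_lt_zero.mp this

/-- Some shift puts a given vertex of the inner layer into the right two ears. -/
theorem exists_double_ear (hp : Pierced (2 * m) p Y) (hq : ConvexCycle m q)
    (hinj : Set.InjOn q (Set.Iio m)) (hY : hullVertices Y = Set.range q) :
    ∃ s, 1 ≤ s ∧ s ≤ 2 * m ∧ orient (p (s - 1)) (p (s + 1)) (q 0) < 0 ∧
      orient (p s) (p (s + 2)) (q 0) < 0 := by
  obtain ⟨g, hg⟩ := hp.exists_ears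
  have hm := hg.two_le
  have hY' := hY
  rw [hq.range_eq (by omega)] at hY'
  obtain ⟨r, hr, e1, e2⟩ := hg.exists_double_ear hinj hY' (y := q 0) (hY ▸ ⟨0, rfl⟩)
  refine ⟨r + 1, by omega, by omega, ?_, ?_⟩
  · rw [← e1]; exact hg.right r
  · rw [← e2]; exact hg.right (r + 1)

end Pierced

namespace RealRAM

/-! ## Reasoning about programs -/

/-- Started in `s`, the program `P` halts within `T` steps in a state that satisfies `Q`. -/
def Computes (P : Program) (s : State) (T : ℕ) (Q : State → Prop) : Prop :=
  ∃ t s', Runs P s t s' ∧ t ≤ T ∧ Q s'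

theorem Computes.mono {P : Program} {s : State} {T T' : ℕ} {Q Q' : State → Prop}
    (h : Computes P s T Q) (hT : T ≤ T') (hQ : ∀ s', Q s' → Q' s') : Computes P s T' Q' := by
  obtain ⟨t, s', hr, ht, hq⟩ := h
  exact ⟨t, s', hr, ht.trans hT, hQ _ hq⟩

theorem Computes.seq {P P' : Program} {s : State} {T T' : ℕ} {Q Q' : State → Prop}
    (h : Computes P s T Q) (h' : ∀ s', Q s' → Computes P' s' T' Q') :
    Computes (.seq P P') s (T + T') Q' := by
  obtain ⟨t, s', hr, ht, hq⟩ := h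
  obtain ⟨t', s'', hr', ht', hq'⟩ := h' s' hq
  exact ⟨t + t', s'', .seq hr hr', by omega, hq'⟩

theorem Computes.branch {b : Test} {P P' : Program} {s : State} {T T' : ℕ} {Q : State → Prop}
    (h : b.Holds s → Computes P s T Q) (h' : ¬ b.Holds s → Computes P' s T' Q) :
    Computes (.branch b P P') s (1 + b.cost + (T + T')) Q := by
  by_cases hb : b.Holds s
  · obtain ⟨t, s', hr, ht, hq⟩ := h hb
    exact ⟨_, s', .branch_true hb hr, by omega, hq⟩
  · obtain ⟨t, s', hr, ht, hq⟩ := h' hb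
    exact ⟨_, s', .branch_false hb hr, by omega, hq⟩

/-- Programs without loops. -/
def Program.IsStraight : Program → Prop
  | .skip => True
  | .setNat _ _ _ => True
  | .setReal _ _ _ => True
  | .seq P Q => P.IsStraight ∧ Q.IsStraight
  | .branch _ P Q => P.IsStraight ∧ Q.IsStraight
  | .loop _ _ => False

open Classical in
/-- The final state of a program without loops. -/
noncomputable def Program.exec : Program → State → State
  | .skip, s => s
  | .setNat a i e, s => s.writeNat a (i.eval s) (e.eval s)
  | .setReal a i e, s => s.writeReal a (i.eval s) (e.eval s)
  | .seq P Q, s => Q.exec (P.exec s)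
  | .branch b P Q, s => if b.Holds s then P.exec s else Q.exec s
  | .loop _ _, s => s

/-- An upper bound for the running time of a program without loops. -/
def Program.maxCost : Program → ℕ
  | .skip => 1
  | .setNat _ i e => 1 + i.cost + e.cost
  | .setReal _ i e => 1 + i.cost + e.cost
  | .seq P Q => P.maxCost + Q.maxCost
  | .branch b P Q => 1 + b.cost + (P.maxCost + Q.maxCost)
  | .loop _ _ => 0

theorem Computes.straight {P : Program} {s : State} {Q : State → Prop} (hP : P.IsStraight)
    (hQ : Q (P.exec s)) : Computes P s P.maxCost Q := by
  induction P generalizing s Q with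
  | skip => exact ⟨_, _, .skip s, le_rfl, hQ⟩
  | setNat a i e => exact ⟨_, _, .setNat s a i e, le_rfl, hQ⟩
  | setReal a i e => exact ⟨_, _, .setReal s a i e, le_rfl, hQ⟩
  | seq P P' ih ih' =>
    exact (ih (Q := fun s' => s' = P.exec s) hP.1 rfl).seq fun s' hs' => ih' hP.2 (hs' ▸ hQ)
  | branch b P P' ih ih' =>
    refine Computes.branch (fun hb => ih hP.1 ?_) (fun hb => ih' hP.2 ?_)
    · rwa [Program.exec, if_pos hb] at hQ
    · rwa [Program.exec, if_neg hb] at hQ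
  | loop b P => exact hP.elim

theorem Computes.skip {s : State} {Q : State → Prop} (h : Q s) : Computes .skip s 1 Q :=
  ⟨_, _, .skip s, le_rfl, h⟩

theorem Computes.setNat {a : ℕ} {i e : NatExp} {s : State} {Q : State → Prop}
    (h : Q (s.writeNat a (i.eval s) (e.eval s))) :
    Computes (.setNat a i e) s (1 + i.cost + e.cost) Q :=
  ⟨_, _, .setNat s a i e, le_rfl, h⟩

theorem Computes.setNat_seq {a : ℕ} {i e : NatExp} {P : Program} {s : State} {T : ℕ}
    {Q : State → Prop} (h : Computes P (s.writeNat a (i.eval s) (e.eval s)) T Q) :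
    Computes (.seq (.setNat a i e) P) s (1 + i.cost + e.cost + T) Q :=
  (Computes.setNat (Q := fun s' => s' = s.writeNat a (i.eval s) (e.eval s)) rfl).seq
    fun _ hs => hs ▸ h

/-- Loops with a potential function that pays for every round. -/
theorem Computes.loop {b : Test} {P : Program} {I : State → Prop} {φ : State → ℕ} {s : State}
    (hs : I s) (hstep : ∀ s, I s → b.Holds s → ∃ T, Computes P s T
      fun s' => I s' ∧ φ s' + (T + 1 + b.cost) ≤ φ s) :
    Computes (.loop b P) s (φ s + 1 + b.cost) fun s' => I s' ∧ ¬ b.Holds s' := by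
  induction hn : φ s using Nat.strong_induction_on generalizing s with
  | _ n ih =>
    by_cases hb : b.Holds s
    · obtain ⟨T, t, s', hr, ht, hI, hφ⟩ := hstep s hs hb
      obtain ⟨t', s'', hr', ht', hq⟩ := ih (φ s') (by omega) hI rfl
      exact ⟨_, s'', .loop_true hb hr hr', by omega, hq⟩
    · exact ⟨_, s, .loop_false hb, by omega, hs, hb⟩

/-- Loops with a counter. -/
theorem Computes.count {b : Test} {P : Program} {I : ℕ → State → Prop} {N j₀ c : ℕ} {s : State}
    (hj : j₀ ≤ N) (hs : I j₀ s) (hb : ∀ j s, I j s → (b.Holds s ↔ j < N))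
    (hstep : ∀ j s, j < N → I j s → Computes P s c (I (j + 1))) :
    Computes (.loop b P) s ((N - j₀ + 1) * (c + 1 + b.cost)) (I N) := by
  induction hd : N - j₀ generalizing j₀ s with
  | zero =>
    obtain rfl : j₀ = N := by omega
    refine ⟨_, s, .loop_false (by simp [hb _ _ hs]), ?_, hs⟩
    rw [Nat.zero_add, Nat.one_mul]
    omega
  | succ d ih =>
    obtain ⟨t, s', hr, ht, hI⟩ := hstep j₀ s (by omega) hs
    obtain ⟨t', s'', hr', ht', hq⟩ := ih (by omega) hI (by omega)
    refine ⟨_, s'', .loop_true ((hb _ _ hs).mpr (by omega)) hr hr', ?_, hq⟩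
    have : (d + 1 + 1) * (c + 1 + b.cost) = (d + 1) * (c + 1 + b.cost) + (c + 1 + b.cost) := by
      ring
    omega

@[simp] theorem State.nats_writeNat_self (s : State) (a i v : ℕ) :
    (s.writeNat a i v).nats a = Function.update (s.nats a) i v := by
  simp [State.writeNat]

@[simp] theorem State.nats_writeNat_of_ne (s : State) {a b : ℕ} (i v : ℕ) (h : b ≠ a) :
    (s.writeNat a i v).nats b = s.nats b := by
  simp [State.writeNat, h]

/-- Only the arrays of natural numbers in `S` differ. -/
def Frame (S : List ℕ) (s s' : State) : Prop :=
  s'.reals = s.reals ∧ ∀ a, a ∉ S → s'.nats a = s.nats a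

theorem Frame.refl (S : List ℕ) (s : State) : Frame S s s := ⟨rfl, fun _ _ => rfl⟩

theorem Frame.trans {S : List ℕ} {s s' s'' : State} (h : Frame S s s') (h' : Frame S s' s'') :
    Frame S s s'' :=
  ⟨h'.1.trans h.1, fun a ha => (h'.2 a ha).trans (h.2 a ha)⟩

theorem Frame.mono {S S' : List ℕ} {s s' : State} (h : Frame S s s') (hS : S ⊆ S') :
    Frame S' s s' :=
  ⟨h.1, fun a ha => h.2 a fun hm => ha (hS hm)⟩

theorem Frame.writeNat {S : List ℕ} {s s' : State} (h : Frame S s s') {a : ℕ} (ha : a ∈ S)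
    (i v : ℕ) : Frame S s (s'.writeNat a i v) :=
  ⟨h.1, fun b hb => by
    rw [State.nats_writeNat_of_ne _ _ _ (fun e : b = a => hb (e ▸ ha))]; exact h.2 b hb⟩

section PermOn

/-! ## Rearranging an array -/

variable {α β : Type*}

/-- The array `A'` arises from `A` by a permutation of the cells in `S`. -/
def PermOn (S : Set ℕ) (A A' : ℕ → α) : Prop :=
  ∃ σ : Equiv.Perm ℕ, (∀ i, i ∉ S → σ i = i) ∧ A' = A ∘ σ

theorem PermOn.refl (S : Set ℕ) (A : ℕ → α) : PermOn S A A := ⟨1, fun _ _ => rfl, rfl⟩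

theorem PermOn.comp {S : Set ℕ} {A A' : ℕ → α} (h : PermOn S A A') (g : α → β) :
    PermOn S (g ∘ A) (g ∘ A') := by
  obtain ⟨σ, h1, rfl⟩ := h
  exact ⟨σ, h1, rfl⟩

theorem PermOn.trans {S : Set ℕ} {A A' A'' : ℕ → α} (h : PermOn S A A') (h' : PermOn S A' A'') :
    PermOn S A A'' := by
  obtain ⟨σ, h1, rfl⟩ := h
  obtain ⟨τ, h2, rfl⟩ := h'
  exact ⟨σ * τ, fun i hi => by simp [h2 i hi, h1 i hi], rfl⟩

theorem PermOn.mono {S S' : Set ℕ} {A A' : ℕ → α} (h : PermOn S A A') (hS : S ⊆ S') :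
    PermOn S' A A' := by
  obtain ⟨σ, h1, h2⟩ := h
  exact ⟨σ, fun i hi => h1 i fun hm => hi (hS hm), h2⟩

theorem PermOn.swap {S : Set ℕ} {A : ℕ → α} {i j : ℕ} (hi : i ∈ S) (hj : j ∈ S) :
    PermOn S A (A ∘ Equiv.swap i j) :=
  ⟨Equiv.swap i j, fun _ hk => Equiv.swap_apply_of_ne_of_ne (fun e => hk (e ▸ hi))
    (fun e => hk (e ▸ hj)), rfl⟩

theorem PermOn.apply_of_notMem {S : Set ℕ} {A A' : ℕ → α} (h : PermOn S A A') {i : ℕ}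
    (hi : i ∉ S) : A' i = A i := by
  obtain ⟨σ, h1, rfl⟩ := h
  simp [h1 i hi]

theorem PermOn.exists_apply_eq {S : Set ℕ} {A A' : ℕ → α} (h : PermOn S A A') {i : ℕ}
    (hi : i ∈ S) : ∃ j ∈ S, A' i = A j := by
  obtain ⟨σ, h1, rfl⟩ := h
  refine ⟨σ i, ?_, rfl⟩
  by_contra hm
  have := h1 _ hm
  rw [σ.injective this] at hm
  exact hm hi

theorem PermOn.symm {S : Set ℕ} {A A' : ℕ → α} (h : PermOn S A A') : PermOn S A' A := by
  obtain ⟨σ, h1, rfl⟩ := h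
  refine ⟨σ⁻¹, fun i hi => ?_, ?_⟩
  · rw [Equiv.Perm.inv_eq_iff_eq, h1 i hi]
  · funext i; simp

theorem PermOn.image_eq {S T : Set ℕ} {A A' : ℕ → α} (h : PermOn S A A') (hST : S ⊆ T) :
    A' '' T = A '' T := by
  have sub : ∀ {A A' : ℕ → α}, PermOn S A A' → A' '' T ⊆ A '' T := by
    rintro A A' h _ ⟨i, hi, rfl⟩
    obtain ⟨j, hj, e⟩ := (h.mono hST).exists_apply_eq hi
    exact ⟨j, hj, e.symm⟩
  exact (sub h).antisymm (sub h.symm)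

theorem PermOn.injOn {S T : Set ℕ} {A A' : ℕ → α} (h : PermOn S A A') (hST : S ⊆ T)
    (hA : Set.InjOn A T) : Set.InjOn A' T := by
  obtain ⟨σ, h1, rfl⟩ := h.mono hST
  have maps : ∀ i ∈ T, σ i ∈ T := by
    intro i hi
    by_contra hm
    have := h1 _ hm
    rw [σ.injective this] at hm
    exact hm hi
  exact fun i hi j hj e => σ.injective (hA (maps i hi) (maps j hj) e)

end PermOn

theorem update_update_eq_comp_swap (A : ℕ → ℕ) (i j : ℕ) :
    Function.update (Function.update A i (A j)) j (A i) = A ∘ Equiv.swap i j := by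
  funext k
  simp only [Function.update_apply, Function.comp_apply, Equiv.swap_apply_def]
  split_ifs <;> simp_all

/-! ## Elementary expressions, tests and statements -/

/-- Cell `0` of an array. -/
abbrev NatExp.var (a : ℕ) : NatExp := .read a (.const 0)

/-- Assignment to cell `0` of an array. -/
abbrev Program.setVar (a : ℕ) (e : NatExp) : Program := .setNat a (.const 0) e

/-- Twice the signed area of the triangle of three input points. -/
def RealExp.orient (e f g : NatExp) : RealExp :=
  .sub (.mul (.sub (.read 0 f) (.read 0 e)) (.sub (.read 1 g) (.read 1 e)))
    (.mul (.sub (.read 1 f) (.read 1 e)) (.sub (.read 0 g) (.read 0 e)))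

/-- The input point with a given number. -/
def State.point (s : State) (i : ℕ) : ℝ × ℝ := (s.reals 0 i, s.reals 1 i)

theorem State.point_eq_of_reals_eq {s s' : State} (h : s'.reals = s.reals) :
    s'.point = s.point := by
  funext i
  simp [State.point, h]

@[simp] theorem State.point_writeNat (s : State) (a i v : ℕ) :
    (s.writeNat a i v).point = s.point := rfl

/-- Three points turn left. -/
def Test.left (e f g : NatExp) : Test := .realLt (.const 0) (RealExp.orient e f g)

/-- Three points turn right. -/
def Test.right (e f g : NatExp) : Test := .realLt (RealExp.orient e f g) (.const 0)

@[simp] theorem Test.holds_left {s : State} {e f g : NatExp} : (Test.left e f g).Holds s ↔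
    0 < _root_.orient (s.point (e.eval s)) (s.point (f.eval s)) (s.point (g.eval s)) := by
  simp [Test.left, Test.Holds, RealExp.eval, RealExp.orient, _root_.orient, State.point]

@[simp] theorem Test.holds_right {s : State} {e f g : NatExp} : (Test.right e f g).Holds s ↔
    _root_.orient (s.point (e.eval s)) (s.point (f.eval s)) (s.point (g.eval s)) < 0 := by
  simp [Test.right, Test.Holds, RealExp.eval, RealExp.orient, _root_.orient, State.point]

/-- One of the points precedes the other one lexicographically. -/
def Test.lex (e f : NatExp) : Test :=
  .not (.and (.not (.realLt (.read 0 e) (.read 0 f)))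
    (.not (.and (.not (.realLt (.read 0 f) (.read 0 e))) (.realLt (.read 1 e) (.read 1 f)))))

/-- The lexicographic order of the plane. -/
def LexLt (p q : ℝ × ℝ) : Prop := p.1 < q.1 ∨ (p.1 = q.1 ∧ p.2 < q.2)

@[simp] theorem Test.holds_lex {s : State} {e f : NatExp} : (Test.lex e f).Holds s ↔
    LexLt (s.point (e.eval s)) (s.point (f.eval s)) := by
  simp only [Test.lex, Test.Holds, RealExp.eval, State.point, LexLt]
  constructor
  · intro h
    by_contra hcon
    push Not at hcon
    refine h ⟨not_lt.mpr hcon.1, fun h' => ?_⟩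
    exact absurd h'.2 (not_lt.mpr (hcon.2 (le_antisymm (not_lt.mp h'.1) hcon.1)))
  · rintro (h | ⟨h1, h2⟩) ⟨h3, h4⟩
    · exact h3 h
    · exact h4 ⟨by rw [h1]; exact lt_irrefl _, h2⟩

/-- Exchange two cells of the array `2`. -/
def Program.swap (e f : NatExp) : Program :=
  .seq (.setVar 8 (.read 2 e)) (.seq (.setNat 2 e (.read 2 f)) (.setNat 2 f (.var 8)))

/-- The expression does not read the arrays `2` and `8`. -/
def NatExp.Pure : NatExp → Prop
  | .const _ => True
  | .read a i => a ≠ 2 ∧ a ≠ 8 ∧ i.Pure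
  | .add e f => e.Pure ∧ f.Pure
  | .sub e f => e.Pure ∧ f.Pure

theorem NatExp.Pure.eval_writeNat {e : NatExp} (h : e.Pure) (s : State) {a : ℕ}
    (ha : a = 2 ∨ a = 8) (i v : ℕ) : e.eval (s.writeNat a i v) = e.eval s := by
  induction e with
  | const c => rfl
  | read b j ih =>
    have hb : b ≠ a := by rcases ha with rfl | rfl; exacts [h.1, h.2.1]
    simp only [NatExp.eval, ih h.2.2, State.nats_writeNat_of_ne _ _ _ hb]
  | add e f ihe ihf => simp only [NatExp.eval, ihe h.1, ihf h.2]
  | sub e f ihe ihf => simp only [NatExp.eval, ihe h.1, ihf h.2]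

/-- The addresses are evaluated again after cells have been overwritten, so they must not depend on
the arrays that are being changed. -/
theorem exec_swap {e f : NatExp} (he : e.Pure) (hf : f.Pure) (s : State) :
    ((Program.swap e f).exec s).nats 2 = s.nats 2 ∘ Equiv.swap (e.eval s) (f.eval s) ∧
      Frame [2, 8] s ((Program.swap e f).exec s) := by
  constructor
  · simp only [Program.swap, Program.exec, NatExp.eval, he.eval_writeNat _ (Or.inr rfl),
      hf.eval_writeNat _ (Or.inl rfl), hf.eval_writeNat _ (Or.inr rfl), ← update_update_eq_comp_swap]
    simp
  · exact (((Frame.refl _ s).writeNat (by simp) _ _).writeNat (by simp) _ _).writeNat (by simp) _ _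

theorem isStraight_swap (e f : NatExp) : (Program.swap e f).IsStraight := ⟨trivial, trivial, trivial⟩

end RealRAM

/-! ## Heaps -/

/-- `r` is the strict part of a total preorder on `V`. -/
structure WeakOrderOn (r : ℕ → ℕ → Prop) (V : Set ℕ) : Prop where
  asymm : ∀ x ∈ V, ∀ y ∈ V, r x y → ¬ r y x
  negTrans : ∀ x ∈ V, ∀ y ∈ V, ∀ z ∈ V, r x y → r x z ∨ r z y

/-- The heap condition for the nodes from `lo` on, among the nodes `1, …, z`. -/
def IsHeap (r : ℕ → ℕ → Prop) (lo z : ℕ) (W : ℕ → ℕ) : Prop :=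
  ∀ p c, lo ≤ p → (c = 2 * p ∨ c = 2 * p + 1) → c ≤ z → ¬ r (W p) (W c)

/-- The heap condition may fail at the node `k`. -/
def IsHeapExcept (r : ℕ → ℕ → Prop) (lo k z : ℕ) (W : ℕ → ℕ) : Prop :=
  (∀ p c, lo ≤ p → p ≠ k → (c = 2 * p ∨ c = 2 * p + 1) → c ≤ z → ¬ r (W p) (W c)) ∧
    ∀ p c, lo ≤ p → (k = 2 * p ∨ k = 2 * p + 1) → (c = 2 * k ∨ c = 2 * k + 1) → c ≤ z →
      ¬ r (W p) (W c)

theorem IsHeapExcept.isHeap {r : ℕ → ℕ → Prop} {lo k z : ℕ} {W : ℕ → ℕ}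
    (h : IsHeapExcept r lo k z W) (hk : z < 2 * k) : IsHeap r lo z W := by
  intro p c h1 h2 h3
  exact h.1 p c h1 (by rintro rfl; omega) h2 h3

/-- The larger child moves up and the defect moves down. That the new entry of `k` fits below the
parent of `k` is the second clause of `IsHeapExcept`. -/
theorem IsHeapExcept.swap {r : ℕ → ℕ → Prop} {V : Set ℕ} (hr : WeakOrderOn r V) {lo k z c : ℕ}
    {W W' : ℕ → ℕ} (hW : ∀ j, 1 ≤ j → j ≤ z → W j ∈ V) (h : IsHeapExcept r lo k z W)
    (hlo : 1 ≤ lo) (hk : lo ≤ k) (hc : c = 2 * k ∨ c = 2 * k + 1) (hcz : c ≤ z)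
    (hsib : ∀ c', (c' = 2 * k ∨ c' = 2 * k + 1) → c' ≤ z → ¬ r (W c) (W c'))
    (hlt : r (W k) (W c)) (hWk : W' k = W c) (hWc : W' c = W k)
    (hWo : ∀ j, j ≠ k → j ≠ c → W' j = W j) : IsHeapExcept r lo c z W' := by
  constructor
  · intro p d h1 h2 h3 h4
    by_cases hp : p = k
    · subst hp
      rw [hWk]
      by_cases hd : d = c
      · subst hd
        rw [hWc]
        exact hr.asymm _ (hW _ (by omega) (by omega)) _ (hW _ (by omega) (by omega)) hlt
      · rw [hWo d (by omega) hd]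
        exact hsib d h3 h4
    · rw [hWo p hp h2]
      by_cases hd : d = k
      · subst hd
        rw [hWk]
        exact h.2 p c h1 h3 hc hcz
      · rw [hWo d hd (by omega)]
        exact h.1 p d h1 hp h3 h4
  · intro p d h1 h2 h3 h4
    obtain rfl : p = k := by omega
    rw [hWk, hWo d (by omega) (by omega)]
    exact h.1 c d (by omega) (by omega) h3 h4

theorem IsHeapExcept.isHeap_of_not_lt {r : ℕ → ℕ → Prop} {V : Set ℕ} (hr : WeakOrderOn r V)
    {lo k z c : ℕ} {W : ℕ → ℕ} (hW : ∀ j, 1 ≤ j → j ≤ z → W j ∈ V)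
    (h : IsHeapExcept r lo k z W) (hlo : 1 ≤ lo) (hk : lo ≤ k) (hc : c = 2 * k ∨ c = 2 * k + 1)
    (hcz : c ≤ z) (hsib : ∀ c', (c' = 2 * k ∨ c' = 2 * k + 1) → c' ≤ z → ¬ r (W c) (W c'))
    (hlt : ¬ r (W k) (W c)) : IsHeap r lo z W := by
  intro p d h1 h2 h3
  by_cases hp : p = k
  · subst hp
    intro hrd
    rcases hr.negTrans _ (hW p (by omega) (by omega)) _ (hW d (by omega) h3) _
      (hW c (by omega) hcz) hrd with h4 | h4
    · exact hlt h4
    · exact hsib d h2 h3 h4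
  · exact h.1 p d h1 hp h2 h3

theorem IsHeap.not_lt_root {r : ℕ → ℕ → Prop} {V : Set ℕ} (hr : WeakOrderOn r V) {z : ℕ}
    {W : ℕ → ℕ} (hW : ∀ j, 1 ≤ j → j ≤ z → W j ∈ V) (h : IsHeap r 1 z W) :
    ∀ j, 1 ≤ j → j ≤ z → ¬ r (W 1) (W j) := by
  intro j
  induction j using Nat.strong_induction_on with
  | _ j ih =>
    intro h1 h2 hrj
    by_cases hj : j = 1
    · subst hj
      exact hr.asymm _ (hW 1 le_rfl h2) _ (hW 1 le_rfl h2) hrj hrj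
    · rcases hr.negTrans _ (hW 1 le_rfl (by omega)) _ (hW j h1 h2) _
        (hW (j / 2) (by omega) (by omega)) hrj with h3 | h3
      · exact ih (j / 2) (by omega) (by omega) (by omega) h3
      · exact h (j / 2) j (by omega) (by omega) h2 h3

namespace RealRAM

/-! ## Heap sort by angle

The cells `o + 1, …, o + z` of the array `2` form a heap, where `o` is in the array `3` and `z` in
the array `6`. They are compared by the angle at the point whose number is in cell `o`. -/

/-- Cell `o + e` of the array `2`. -/
def NatExp.cell (e : NatExp) : NatExp := .read 2 (.add (.var 3) e)

/-- Comparison by angle at the point in cell `o`. -/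
def Test.angle (e f : NatExp) : Test := .left (.cell (.const 0)) (.cell e) (.cell f)

/-- Choose the larger child `c` (array `7`) of the node `k` (array `5`). -/
def chooseChild : Program :=
  .seq (.setVar 7 (.add (.var 5) (.var 5)))
    (.branch (.and (.natLt (.var 7) (.var 6)) (.angle (.var 7) (.add (.var 7) (.const 1))))
      (.setVar 7 (.add (.var 7) (.const 1))) .skip)

/-- Move down to the child, or leave the heap. -/
def siftStep : Program :=
  .branch (.angle (.var 5) (.var 7))
    (.seq (.swap (.add (.var 3) (.var 5)) (.add (.var 3) (.var 7))) (.setVar 5 (.var 7)))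
    (.setVar 5 (.add (.var 6) (.const 1)))

/-- Sift down from the node `k`. -/
def sift : Program :=
  .loop (.natLt (.add (.var 5) (.var 5)) (.add (.var 6) (.const 1))) (.seq chooseChild siftStep)

/-- The angular comparison of two numbers of points in a state. -/
def State.angleLt (s : State) (x y : ℕ) : Prop :=
  0 < orient (s.point (s.nats 2 (s.nats 3 0))) (s.point x) (s.point y)

/-- The part of the array `2` behind cell `o`. -/
def State.tail (s : State) (j : ℕ) : ℕ := s.nats 2 (s.nats 3 0 + j)

theorem Test.holds_angle {s : State} {e f : NatExp} :
    (Test.angle e f).Holds s ↔ s.angleLt (s.tail (e.eval s)) (s.tail (f.eval s)) := by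
  simp [Test.angle, NatExp.cell, NatExp.eval, State.angleLt, State.tail]

theorem chooseChild_spec (s : State) : Computes chooseChild s chooseChild.maxCost fun s' =>
    Frame [7] s s' ∧
      ((s'.nats 7 0 = 2 * s.nats 5 0 ∧ (2 * s.nats 5 0 < s.nats 6 0 →
        ¬ s.angleLt (s.tail (2 * s.nats 5 0)) (s.tail (2 * s.nats 5 0 + 1)))) ∨
      (s'.nats 7 0 = 2 * s.nats 5 0 + 1 ∧ 2 * s.nats 5 0 < s.nats 6 0 ∧
        s.angleLt (s.tail (2 * s.nats 5 0)) (s.tail (2 * s.nats 5 0 + 1)))) := by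
  have hF : ∀ v w, Frame [7] s ((s.writeNat 7 0 v).writeNat 7 0 w) := fun v w =>
    ((Frame.refl _ s).writeNat (by simp) _ _).writeNat (by simp) _ _
  refine Computes.setNat_seq ?_
  simp only [NatExp.eval]
  set s1 := s.writeNat 7 0 (s.nats 5 0 + s.nats 5 0) with hs1
  have e7 : s1.nats 7 0 = 2 * s.nats 5 0 := by simp [s1, two_mul]
  have e6 : s1.nats 6 0 = s.nats 6 0 := by simp [s1]
  have ea : s1.angleLt = s.angleLt := by
    funext x y; simp [s1, State.angleLt]
  have et : s1.tail = s.tail := by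
    funext x; simp [s1, State.tail]
  refine Computes.branch (fun hc => Computes.setNat ?_) fun hc => Computes.skip ?_ <;>
    simp only [Test.Holds, Test.holds_angle, NatExp.eval, e7, e6, ea, et] at hc
  · exact ⟨hF _ _, Or.inr ⟨by simp [NatExp.eval, e7], hc⟩⟩
  · exact ⟨(Frame.refl _ s).writeNat (by simp) _ _, Or.inl ⟨e7, fun h1 h2 => hc ⟨h1, h2⟩⟩⟩

theorem siftStep_spec (s : State) :
    Computes siftStep s siftStep.maxCost fun s' => Frame [2, 5, 8] s s' ∧
      ((s.angleLt (s.tail (s.nats 5 0)) (s.tail (s.nats 7 0)) ∧ s'.nats 5 0 = s.nats 7 0 ∧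
        s'.nats 2 = s.nats 2 ∘ Equiv.swap (s.nats 3 0 + s.nats 5 0) (s.nats 3 0 + s.nats 7 0)) ∨
      (¬ s.angleLt (s.tail (s.nats 5 0)) (s.tail (s.nats 7 0)) ∧ s'.nats 5 0 = s.nats 6 0 + 1 ∧
        s'.nats 2 = s.nats 2)) := by
  apply Computes.straight (by simp [siftStep, Program.IsStraight, isStraight_swap])
  have hiff : (Test.angle (.var 5) (.var 7)).Holds s ↔
      s.angleLt (s.tail (s.nats 5 0)) (s.tail (s.nats 7 0)) := by
    simp only [Test.holds_angle, NatExp.eval]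
  simp only [siftStep, Program.exec, NatExp.eval]
  split_ifs with hc <;> rw [hiff] at hc
  · obtain ⟨h1, h2⟩ := exec_swap (e := .add (.var 3) (.var 5)) (f := .add (.var 3) (.var 7))
      (by simp [NatExp.Pure]) (by simp [NatExp.Pure]) s
    refine ⟨((h2.mono (by simp)).writeNat (by simp) _ _), Or.inl ⟨hc, ?_, ?_⟩⟩
    · rw [State.nats_writeNat_self, Function.update_self, h2.2 7 (by simp)]
    · rw [State.nats_writeNat_of_ne _ _ _ (by simp), h1]
      rfl
  · exact ⟨(Frame.refl _ s).writeNat (by simp) _ _, Or.inr ⟨hc, by simp, by simp⟩⟩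

/-- The costs of one round of `sift`. -/
def siftCost : ℕ := chooseChild.maxCost + siftStep.maxCost + 1 +
  (Test.natLt (.add (.var 5) (.var 5)) (.add (.var 6) (.const 1))).cost

/-- The time bound and the permutation are unconditional. Only the heap property needs a weak order,
because comparison by angle need not be one in arbitrary position. -/
theorem sift_spec (s : State) (hk : 1 ≤ s.nats 5 0) {L : ℕ} (hL : Nat.log 2 (s.nats 6 0) ≤ L) :
    Computes sift s (siftCost * (L + 2)) fun s' => Frame [2, 5, 7, 8] s s' ∧
      PermOn (Set.Icc (s.nats 3 0 + 1) (s.nats 3 0 + s.nats 6 0)) (s.nats 2) (s'.nats 2) ∧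
      ∀ V : Set ℕ, WeakOrderOn s.angleLt V → (∀ j, 1 ≤ j → j ≤ s.nats 6 0 → s.tail j ∈ V) →
        ∀ lo, 1 ≤ lo → lo ≤ s.nats 5 0 →
          IsHeapExcept s.angleLt lo (s.nats 5 0) (s.nats 6 0) s.tail →
            IsHeap s.angleLt lo (s.nats 6 0) s'.tail := by
  set o := s.nats 3 0 with ho
  set z := s.nats 6 0 with hz
  set k0 := s.nats 5 0 with hk0
  let I : State → Prop := fun s' => Frame [2, 5, 7, 8] s s' ∧
    PermOn (Set.Icc (o + 1) (o + z)) (s.nats 2) (s'.nats 2) ∧ 1 ≤ s'.nats 5 0 ∧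
      ∀ V : Set ℕ, WeakOrderOn s.angleLt V → (∀ j, 1 ≤ j → j ≤ z → s.tail j ∈ V) →
        ∀ lo, 1 ≤ lo → lo ≤ k0 → IsHeapExcept s.angleLt lo k0 z s.tail →
          IsHeapExcept s.angleLt lo (s'.nats 5 0) z s'.tail ∧ lo ≤ s'.nats 5 0
  refine (Computes.loop (I := I)
    -- Each round at least doubles `k`, or sets it to `z + 1`, so the logarithm of `k` grows by at
    -- least one.
    (φ := fun s' => siftCost * (Nat.log 2 z + 1 - Nat.log 2 (s'.nats 5 0)))
    ⟨Frame.refl _ s, PermOn.refl _ _, hk, fun V _ _ lo _ h2 h3 => ⟨h3, h2⟩⟩ ?_).mono ?_ ?_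
  · rintro s' ⟨hF, hP, hk', hH⟩ hb
    simp only [Test.Holds, NatExp.eval] at hb
    have h3 := hF.2 3 (by simp)
    have h6 := hF.2 6 (by simp)
    rw [h6, ← hz] at hb
    refine ⟨chooseChild.maxCost + siftStep.maxCost, ?_⟩
    have hlog : Nat.log 2 (s'.nats 5 0) + 1 ≤ Nat.log 2 z := by
      rw [← Nat.log_mul_base (by norm_num) (by omega)]
      exact Nat.log_mono_right (by omega)
    have hpot : ∀ k, 2 * s'.nats 5 0 ≤ k → siftCost * (Nat.log 2 z + 1 - Nat.log 2 k) +
        (chooseChild.maxCost + siftStep.maxCost + 1 +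
          (Test.natLt (.add (.var 5) (.var 5)) (.add (.var 6) (.const 1))).cost) ≤
        siftCost * (Nat.log 2 z + 1 - Nat.log 2 (s'.nats 5 0)) := by
      intro k hk
      have h1 : Nat.log 2 (s'.nats 5 0) + 1 ≤ Nat.log 2 k := by
        rw [← Nat.log_mul_base (by norm_num) (by omega)]
        exact Nat.log_mono_right (by omega)
      have h2 : Nat.log 2 z + 1 - Nat.log 2 k + 1 ≤ Nat.log 2 z + 1 - Nat.log 2 (s'.nats 5 0) := by
        omega
      calc _ = siftCost * (Nat.log 2 z + 1 - Nat.log 2 k + 1) := by rw [siftCost]; ring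
        _ ≤ _ := Nat.mul_le_mul_left _ h2
    -- the comparison does not change
    have hA0 : s'.nats 2 o = s.nats 2 o := hP.apply_of_notMem (by simp)
    have hlt : s'.angleLt = s.angleLt := by
      funext x y
      simp only [State.angleLt, State.point_eq_of_reals_eq hF.1, h3, ← ho, hA0]
    refine (chooseChild_spec s').seq fun s1 ⟨hF1, hc⟩ => ?_
    have e5 := hF1.2 5 (by simp)
    have e3 := hF1.2 3 (by simp)
    have e6 := hF1.2 6 (by simp)
    have e2 := hF1.2 2 (by simp)
    have hlt1 : s1.angleLt = s.angleLt := by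
      rw [← hlt]
      funext x y
      simp only [State.angleLt, State.point_eq_of_reals_eq hF1.1, e3, e2]
    have ht1 : s1.tail = s'.tail := by
      funext j
      simp only [State.tail, e3, e2]
    rw [h6, ← hz, hlt] at hc
    refine (siftStep_spec s1).mono le_rfl fun s2 ⟨hF2, hs2⟩ => ?_
    rw [hlt1, ht1, e5, e6, h6, e2, e3, h3, ← ho, ← hz] at hs2
    set k := s'.nats 5 0 with hkdef
    set c := s1.nats 7 0 with hcdef
    have hcz : c ≤ z := by omega
    have hsib : ∀ V : Set ℕ, WeakOrderOn s.angleLt V → (∀ j, 1 ≤ j → j ≤ z → s'.tail j ∈ V) →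
        ∀ c', (c' = 2 * k ∨ c' = 2 * k + 1) → c' ≤ z → ¬ s.angleLt (s'.tail c) (s'.tail c') := by
      intro V hV hmem c' hc' hcz'
      have irr : ∀ j, 1 ≤ j → j ≤ z → ¬ s.angleLt (s'.tail j) (s'.tail j) := fun j h1 h2 h3 =>
        hV.asymm _ (hmem j h1 h2) _ (hmem j h1 h2) h3 h3
      rcases hc with ⟨hc, hn⟩ | ⟨hc, hlt2, hn⟩
      · rcases hc' with rfl | rfl
        · rw [hc]; exact irr _ (by omega) (by omega)
        · rw [hc]; exact hn (by omega)
      · rcases hc' with rfl | rfl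
        · rw [hc]
          exact hV.asymm _ (hmem _ (by omega) (by omega)) _ (hmem _ (by omega) (by omega)) hn
        · rw [hc]; exact irr _ (by omega) (by omega)
    have hmem' : ∀ V : Set ℕ, (∀ j, 1 ≤ j → j ≤ z → s.tail j ∈ V) →
        ∀ j, 1 ≤ j → j ≤ z → s'.tail j ∈ V := by
      intro V hmem j h1 h2
      obtain ⟨i, ⟨hi1, hi2⟩, e⟩ := hP.exists_apply_eq (i := o + j) ⟨by omega, by omega⟩
      have := hmem (i - o) (by omega) (by omega)
      rw [State.tail, ← ho, show o + (i - o) = i by omega] at this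
      rw [State.tail, h3, ← ho, e]
      exact this
    have f3 : s2.nats 3 0 = o := by rw [hF2.2 3 (by simp), e3, h3]
    rcases hs2 with ⟨hr, hk2, hA2⟩ | ⟨hr, hk2, hA2⟩
    · refine ⟨⟨hF.trans ((hF1.mono (by simp)).trans (hF2.mono (by simp))), ?_, by omega, ?_⟩, ?_⟩
      · rw [hA2]
        exact hP.trans (PermOn.swap (S := Set.Icc (o + 1) (o + z)) (Set.mem_Icc.mpr ⟨by omega, by omega⟩)
          (Set.mem_Icc.mpr ⟨by omega, by omega⟩))
      · intro V hV hmem lo h1 h2 h4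
        obtain ⟨g1, g2⟩ := hH V hV hmem lo h1 h2 h4
        rw [hk2]
        refine ⟨g1.swap hV (hmem' V hmem) h1 g2 (by omega) hcz (hsib V hV (hmem' V hmem)) hr
          ?_ ?_ ?_, by omega⟩
        · simp only [State.tail, f3, hA2, Function.comp_apply, Equiv.swap_apply_left, h3, ← ho]
        · simp only [State.tail, f3, hA2, Function.comp_apply, Equiv.swap_apply_right, h3, ← ho]
        · intro j hj1 hj2
          simp only [State.tail, f3, hA2, Function.comp_apply, h3, ← ho]
          rw [Equiv.swap_apply_of_ne_of_ne (by omega) (by omega)]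
      · simp only [hk2]
        exact hpot c (by omega)
    · refine ⟨⟨hF.trans ((hF1.mono (by simp)).trans (hF2.mono (by simp))), ?_, by omega, ?_⟩, ?_⟩
      · rw [hA2]
        exact hP
      · intro V hV hmem lo h1 h2 h4
        obtain ⟨g1, g2⟩ := hH V hV hmem lo h1 h2 h4
        have ht2 : s2.tail = s'.tail := by
          funext j
          simp only [State.tail, f3, hA2, h3, ← ho]
        have := g1.isHeap_of_not_lt hV (hmem' V hmem) h1 g2 (by omega) hcz
          (hsib V hV (hmem' V hmem)) hr
        rw [hk2, ht2]
        -- The value `z + 1` ends the loop and lies outside the heap, so an exception at this node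
        -- is none.
        exact ⟨⟨fun p d q1 _ q3 q4 => this p d q1 q3 q4, fun p d _ _ q3 q4 => by omega⟩, by omega⟩
      · simp only [hk2]
        exact hpot (z + 1) (by omega)
  · have h1 : siftCost * (Nat.log 2 z + 1 - Nat.log 2 (s.nats 5 0)) ≤ siftCost * (L + 1) :=
      Nat.mul_le_mul_left _ (by omega)
    have h2 : siftCost * (L + 2) = siftCost * (L + 1) + siftCost := by ring
    have h3 : 1 + (Test.natLt (.add (.var 5) (.var 5)) (.add (.var 6) (.const 1))).cost ≤
        siftCost := by unfold siftCost; omega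
    omega
  · rintro s' ⟨⟨hF, hP, hk', hH⟩, hb⟩
    refine ⟨hF, hP, fun V hV hmem lo h1 h2 h3 => ?_⟩
    refine (hH V hV hmem lo h1 h2 h3).1.isHeap ?_
    simp only [Test.Holds, NatExp.eval, hF.2 6 (by simp), ← hz] at hb
    omega

end RealRAM

/-! ### Building a heap and emptying it -/

namespace RealRAM

/-- The centre of the angles is in cell `o`, which is never moved, so sorting does not change its
own comparison. -/
theorem State.angleLt_eq {s s' : State} {S : List ℕ} {b : ℕ} (hF : Frame S s s') (h3 : 3 ∉ S)
    (hP : PermOn (Set.Icc (s.nats 3 0 + 1) b) (s.nats 2) (s'.nats 2)) :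
    s'.angleLt = s.angleLt := by
  funext x y
  rw [State.angleLt, State.angleLt, State.point_eq_of_reals_eq hF.1, hF.2 3 h3,
    hP.apply_of_notMem (by simp)]

theorem State.tail_mem {s s' : State} {S : List ℕ} {z : ℕ} (hF : Frame S s s') (h3 : 3 ∉ S)
    (hP : PermOn (Set.Icc (s.nats 3 0 + 1) (s.nats 3 0 + z)) (s.nats 2) (s'.nats 2)) {V : Set ℕ}
    (hV : ∀ j, 1 ≤ j → j ≤ z → s.tail j ∈ V) : ∀ j, 1 ≤ j → j ≤ z → s'.tail j ∈ V := by
  intro j h1 h2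
  obtain ⟨i, hi, e⟩ := hP.exists_apply_eq (i := s.nats 3 0 + j) ⟨by omega, by omega⟩
  rw [Set.mem_Icc] at hi
  have := hV (i - s.nats 3 0) (by omega) (by omega)
  rw [State.tail, show s.nats 3 0 + (i - s.nats 3 0) = i by omega] at this
  rwa [State.tail, hF.2 3 h3, e]

theorem State.tail_eq {s s' : State} (h2 : s'.nats 2 = s.nats 2) (h3 : s'.nats 3 = s.nats 3) :
    s'.tail = s.tail := by
  funext j
  rw [State.tail, State.tail, h2, h3]

/-- Build a heap. -/
def heapify : Program :=
  .loop (.natLt (.const 0) (.var 4))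
    (.seq (.setVar 5 (.var 4)) (.seq sift (.setVar 4 (.sub (.var 4) (.const 1)))))

/-- Take the elements out of a heap. -/
def extractAll : Program :=
  .loop (.natLt (.const 1) (.var 6))
    (.seq (.swap (.add (.var 3) (.const 1)) (.add (.var 3) (.var 6)))
      (.seq (.setVar 6 (.sub (.var 6) (.const 1))) (.seq (.setVar 5 (.const 1)) sift)))

/-- Sort the cells from `o + 1` on by angle. -/
def heapSort : Program :=
  .seq (.setVar 6 (.sub (.sub (.var 0) (.var 3)) (.const 1)))
    (.seq (.setVar 4 (.var 6)) (.seq heapify extractAll))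

theorem heapify_spec (s : State) {L : ℕ} (hL : Nat.log 2 (s.nats 6 0) ≤ L)
    (h4 : s.nats 4 0 = s.nats 6 0) :
    Computes heapify s ((siftCost * (L + 2) + 20) * (s.nats 6 0 + 1)) fun s' =>
      Frame [2, 4, 5, 7, 8] s s' ∧
      PermOn (Set.Icc (s.nats 3 0 + 1) (s.nats 3 0 + s.nats 6 0)) (s.nats 2) (s'.nats 2) ∧
      ∀ V : Set ℕ, WeakOrderOn s.angleLt V → (∀ j, 1 ≤ j → j ≤ s.nats 6 0 → s.tail j ∈ V) →
        IsHeap s.angleLt 1 (s.nats 6 0) s'.tail := by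
  set o := s.nats 3 0 with ho
  set z := s.nats 6 0 with hz
  let I : State → Prop := fun s' => Frame [2, 4, 5, 7, 8] s s' ∧
    PermOn (Set.Icc (o + 1) (o + z)) (s.nats 2) (s'.nats 2) ∧
      ∀ V : Set ℕ, WeakOrderOn s.angleLt V → (∀ j, 1 ≤ j → j ≤ z → s.tail j ∈ V) →
        IsHeap s.angleLt (s'.nats 4 0 + 1) z s'.tail
  refine (Computes.loop (I := I) (φ := fun s' => (siftCost * (L + 2) + 20) * s'.nats 4 0)
    ⟨Frame.refl _ s, PermOn.refl _ _, fun V _ _ p c _ _ _ => by omega⟩ ?_).mono ?_ ?_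
  · rintro s' ⟨hF, hP, hH⟩ hb
    simp only [Test.Holds, NatExp.eval] at hb
    refine ⟨4 + (siftCost * (L + 2) + 6), Computes.setNat_seq ?_⟩
    simp only [NatExp.eval]
    set s1 := s'.writeNat 5 0 (s'.nats 4 0) with hs1
    have hF1 : Frame [2, 4, 5, 7, 8] s s1 := hF.writeNat (by simp) _ _
    have h3 : s1.nats 3 0 = o := by rw [hF1.2 3 (by simp)]
    have h6 : s1.nats 6 0 = z := by rw [hF1.2 6 (by simp)]
    have h5 : s1.nats 5 0 = s'.nats 4 0 := by simp [hs1]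
    have h4 : s1.nats 4 0 = s'.nats 4 0 := by simp [hs1]
    have hP1 : PermOn (Set.Icc (o + 1) (o + z)) (s.nats 2) (s1.nats 2) := by simpa [hs1] using hP
    have hr1 : s1.angleLt = s.angleLt := State.angleLt_eq hF1 (by simp) hP1
    have ht1 : s1.tail = s'.tail := State.tail_eq (by simp [hs1]) (by simp [hs1])
    refine (sift_spec s1 (by omega) (by rwa [h6])).seq fun s2 ⟨hF2, hP2, hH2⟩ => Computes.setNat ?_
    rw [h3, h6] at hP2
    have h24 : s2.nats 4 0 = s'.nats 4 0 := by rw [hF2.2 4 (by simp), h4]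
    refine ⟨⟨(hF1.trans (hF2.mono (by simp))).writeNat (by simp) _ _, ?_, ?_⟩, ?_⟩
    · simpa using hP1.trans hP2
    · intro V hV hmem
      have := hH2 V (hr1 ▸ hV) (h6 ▸ State.tail_mem hF1 (by simp) hP1 hmem) (s'.nats 4 0)
        (by omega) (by omega)
      rw [hr1, h6, h5, ht1] at this
      have hh := this ⟨fun p c q1 q2 q3 q4 => hH V hV hmem p c (by omega) q3 q4,
        fun p c q1 q2 => by omega⟩
      rw [State.tail_eq (s := s2) (by simp) (by simp)]
      simp only [NatExp.eval, State.nats_writeNat_self, Function.update_self, h24]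
      rwa [Nat.sub_add_cancel (by omega)]
    · simp only [NatExp.eval, State.nats_writeNat_self, Function.update_self, h24, Test.cost,
        NatExp.cost]
      obtain ⟨d, hd⟩ : ∃ d, s'.nats 4 0 = d + 1 := ⟨s'.nats 4 0 - 1, by omega⟩
      rw [hd, Nat.add_sub_cancel]
      generalize siftCost * (L + 2) = K
      rw [Nat.mul_add_one]
      omega
  · simp only [h4, Nat.mul_succ, Test.cost, NatExp.cost]
    omega
  · rintro s' ⟨⟨hF, hP, hH⟩, hb⟩
    refine ⟨hF, hP, fun V hV hmem => ?_⟩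
    have := hH V hV hmem
    simp only [Test.Holds, NatExp.eval] at hb
    rwa [show s'.nats 4 0 = 0 by omega] at this

/-- The cells up to the current size form a heap, and the cells behind it are sorted and not below
anything before them. The root, a maximum by `IsHeap.not_lt_root`, goes to the last cell of the
heap. -/
theorem extractAll_spec (s : State) {L : ℕ} (hL : Nat.log 2 (s.nats 6 0) ≤ L) :
    Computes extractAll s ((siftCost * (L + 2) + 50) * (s.nats 6 0 + 1)) fun s' =>
      Frame [2, 5, 6, 7, 8] s s' ∧
      PermOn (Set.Icc (s.nats 3 0 + 1) (s.nats 3 0 + s.nats 6 0)) (s.nats 2) (s'.nats 2) ∧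
      ∀ V : Set ℕ, WeakOrderOn s.angleLt V → (∀ j, 1 ≤ j → j ≤ s.nats 6 0 → s.tail j ∈ V) →
        IsHeap s.angleLt 1 (s.nats 6 0) s.tail →
        ∀ i j, 1 ≤ i → i < j → j ≤ s.nats 6 0 → ¬ s.angleLt (s'.tail j) (s'.tail i) := by
  set o := s.nats 3 0 with ho
  set m := s.nats 6 0 with hm
  let I : State → Prop := fun s' => Frame [2, 5, 6, 7, 8] s s' ∧
    PermOn (Set.Icc (o + 1) (o + m)) (s.nats 2) (s'.nats 2) ∧ s'.nats 6 0 ≤ m ∧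
      ∀ V : Set ℕ, WeakOrderOn s.angleLt V → (∀ j, 1 ≤ j → j ≤ m → s.tail j ∈ V) →
        IsHeap s.angleLt 1 m s.tail → IsHeap s.angleLt 1 (s'.nats 6 0) s'.tail ∧
          ∀ i j, 1 ≤ i → i < j → s'.nats 6 0 < j → j ≤ m → ¬ s.angleLt (s'.tail j) (s'.tail i)
  refine (Computes.loop (I := I) (φ := fun s' => (siftCost * (L + 2) + 50) * s'.nats 6 0)
    ⟨Frame.refl _ s, PermOn.refl _ _, le_rfl, fun V _ _ h => ⟨h, fun i j _ _ _ _ => by omega⟩⟩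
      ?_).mono ?_ ?_
  · rintro s' ⟨hF, hP, hzm, hH⟩ hb
    simp only [Test.Holds, NatExp.eval] at hb
    set z := s'.nats 6 0 with hz
    have h3' : s'.nats 3 0 = o := by rw [hF.2 3 (by simp)]
    obtain ⟨g1, g2⟩ := exec_swap (e := .add (.var 3) (.const 1)) (f := .add (.var 3) (.var 6))
      (by simp [NatExp.Pure]) (by simp [NatExp.Pure]) s'
    refine ⟨_, (Computes.straight (Q := fun s1 => s1 = Program.exec _ s') (isStraight_swap _ _)
      rfl).seq fun s1 hs1 => Computes.setNat_seq (Computes.setNat_seq (T := siftCost * (L + 2)) ?_)⟩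
    rw [← hs1] at g1 g2
    simp only [NatExp.eval, h3', ← hz] at g1
    have e6 : s1.nats 6 0 = z := by rw [g2.2 6 (by simp)]
    simp only [NatExp.eval, e6]
    set s3 := (s1.writeNat 6 0 (z - 1)).writeNat 5 0 1 with hs3
    have hF3 : Frame [2, 5, 6, 7, 8] s s3 := ((hF.trans (g2.mono (by simp))).writeNat
      (by simp) _ _).writeNat (by simp) _ _
    have e23 : s3.nats 2 = s'.nats 2 ∘ Equiv.swap (o + 1) (o + z) := by rw [← g1]; simp [hs3]
    have hP3 : PermOn (Set.Icc (o + 1) (o + m)) (s.nats 2) (s3.nats 2) := by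
      rw [e23]
      exact hP.trans (PermOn.swap (Set.mem_Icc.mpr ⟨by omega, by omega⟩)
        (Set.mem_Icc.mpr ⟨by omega, by omega⟩))
    have h33 : s3.nats 3 0 = o := by rw [hF3.2 3 (by simp)]
    have h36 : s3.nats 6 0 = z - 1 := by simp [hs3]
    have h35 : s3.nats 5 0 = 1 := by simp [hs3]
    have hr3 : s3.angleLt = s.angleLt := State.angleLt_eq hF3 (by simp) hP3
    refine (sift_spec s3 (by omega) (L := L) ?_).mono le_rfl fun s4 ⟨hF4, hP4, hH4⟩ => ?_
    · rw [h36]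
      exact (Nat.log_mono_right (by omega)).trans hL
    rw [h33, h36] at hP4
    have h46 : s4.nats 6 0 = z - 1 := by rw [hF4.2 6 (by simp), h36]
    have h43 : s4.nats 3 0 = o := by rw [hF4.2 3 (by simp), h33]
    refine ⟨⟨hF3.trans (hF4.mono (by simp)), hP3.trans (hP4.mono (Set.Icc_subset_Icc le_rfl
      (by omega))), by omega, fun V hV hmem h0 => ?_⟩, ?_⟩
    · obtain ⟨q1, q2⟩ := hH V hV hmem h0
      have hmem' := State.tail_mem hF (by simp) hP hmem
      have t3 : ∀ j, s3.tail j = s'.tail (Equiv.swap 1 z j) := by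
        intro j
        simp only [State.tail, h33, h3', e23, Function.comp_apply, Equiv.swap_apply_def]
        congr 1
        split_ifs <;> omega
      have hh := hH4 V (hr3 ▸ hV) (fun j j1 j2 => State.tail_mem hF3 (by simp) hP3 hmem j j1
        (by omega)) 1 le_rfl (by omega)
      rw [hr3, h36, h35] at hh
      rw [h46]
      refine ⟨hh ⟨fun p c p1 p2 p3 p4 => ?_, fun p c p1 p2 => by omega⟩, ?_⟩
      · rw [t3, t3, Equiv.swap_apply_of_ne_of_ne (by omega) (by omega),
          Equiv.swap_apply_of_ne_of_ne (by omega) (by omega)]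
        exact q1 p c p1 p3 (by omega)
      · have root := q1.not_lt_root hV (fun j j1 j2 => hmem' j j1 (by omega))
        have t4 : ∀ j, z ≤ j → s4.tail j = s3.tail j := by
          intro j hj
          rw [State.tail, State.tail, h43, h33, hP4.apply_of_notMem (by simp; omega)]
        -- every cell of the rest of the heap comes from the old heap
        have from_old : ∀ i, 1 ≤ i → i < z → ∃ i', 1 ≤ i' ∧ i' ≤ z ∧ s4.tail i = s'.tail i' := by
          intro i i1 i2
          obtain ⟨k, hk, e⟩ := hP4.exists_apply_eq (i := o + i) (Set.mem_Icc.mpr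
            ⟨by omega, by omega⟩)
          rw [Set.mem_Icc] at hk
          have e' : s4.tail i = s3.tail (k - o) := by
            rw [State.tail, State.tail, h43, h33, e]
            congr 1
            omega
          rw [t3, Equiv.swap_apply_def] at e'
          split_ifs at e' with c1 c2
          · exact ⟨z, by omega, le_rfl, e'⟩
          · omega
          · exact ⟨k - o, by omega, by omega, e'⟩
        intro i j i1 i2 i3 i4
        by_cases hjz : j = z
        · subst hjz
          rw [t4 z le_rfl, t3, Equiv.swap_apply_right]
          obtain ⟨i', k1, k2, e⟩ := from_old i i1 i2
          rw [e]
          exact root i' k1 k2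
        · rw [t4 j (by omega), t3, Equiv.swap_apply_of_ne_of_ne (by omega) hjz]
          rcases lt_trichotomy i z with hi | rfl | hi
          · obtain ⟨i', k1, k2, e⟩ := from_old i i1 hi
            rw [e]
            exact q2 i' j k1 (by omega) (by omega) i4
          · rw [t4 z le_rfl, t3, Equiv.swap_apply_right]
            exact q2 1 j le_rfl (by omega) (by omega) i4
          · rw [t4 i hi.le, t3, Equiv.swap_apply_of_ne_of_ne (by omega) (by omega)]
            exact q2 i j i1 i2 (by omega) i4
    · simp only [h46, Program.swap, Program.maxCost, Test.cost, NatExp.cost]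
      obtain ⟨d, hd⟩ : ∃ d, z = d + 1 := ⟨z - 1, by omega⟩
      rw [hd, Nat.add_sub_cancel]
      generalize siftCost * (L + 2) = K
      rw [Nat.mul_add_one]
      omega
  · simp only [← hm, Test.cost, NatExp.cost]
    generalize siftCost * (L + 2) = K
    rw [Nat.mul_add_one]
    omega
  · rintro s' ⟨⟨hF, hP, hzm, hH⟩, hb⟩
    refine ⟨hF, hP, fun V hV hmem h0 i j h1 h2 h3 => ?_⟩
    simp only [Test.Holds, NatExp.eval] at hb
    exact (hH V hV hmem h0).2 i j h1 h2 (by omega) h3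

theorem heapSort_spec (s : State) {m L : ℕ} (hm : s.nats 0 0 = s.nats 3 0 + m + 1)
    (hL : Nat.log 2 m ≤ L) :
    Computes heapSort s ((siftCost * (L + 2) + 50) * (2 * m + 3)) fun s' =>
      Frame [2, 4, 5, 6, 7, 8] s s' ∧
      PermOn (Set.Icc (s.nats 3 0 + 1) (s.nats 3 0 + m)) (s.nats 2) (s'.nats 2) ∧
      ∀ V : Set ℕ, WeakOrderOn s.angleLt V → (∀ j, 1 ≤ j → j ≤ m → s.tail j ∈ V) →
        ∀ i j, 1 ≤ i → i < j → j ≤ m → ¬ s.angleLt (s'.tail j) (s'.tail i) := by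
  have hc : ((siftCost * (L + 2) + 50) * (2 * m + 3)) = (siftCost * (L + 2) + 50) * (m + 1) +
      (siftCost * (L + 2) + 50) * (m + 1) + (siftCost * (L + 2) + 50) := by ring
  refine (Computes.setNat_seq (Computes.setNat_seq
    (T := (siftCost * (L + 2) + 50) * (m + 1) + (siftCost * (L + 2) + 50) * (m + 1)) ?_)).mono
    (by simp only [NatExp.cost]; omega) fun _ h => h
  simp only [NatExp.eval]
  rw [show s.nats 0 0 - s.nats 3 0 - 1 = m by omega]
  set s1 := (s.writeNat 6 0 m).writeNat 4 0 ((s.writeNat 6 0 m).nats 6 0) with hs1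
  have hF1 : Frame [2, 4, 5, 6, 7, 8] s s1 :=
    ((Frame.refl _ s).writeNat (by simp) _ _).writeNat (by simp) _ _
  have h2 : s1.nats 2 = s.nats 2 := by simp [hs1]
  have h3 : s1.nats 3 = s.nats 3 := by simp [hs1]
  have h6 : s1.nats 6 0 = m := by simp [hs1]
  have h4 : s1.nats 4 0 = m := by simp [hs1]
  have ht : s1.tail = s.tail := State.tail_eq h2 h3
  have hr : s1.angleLt = s.angleLt :=
    State.angleLt_eq (b := 0) hF1 (by simp) (by rw [h2]; exact PermOn.refl _ _)
  refine Computes.seq ((heapify_spec s1 (L := L) (by rwa [h6]) (by rw [h4, h6])).mono (by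
    rw [h6]; exact Nat.mul_le_mul_right _ (by omega)) fun _ h => h) fun s2 ⟨hF2, hP2, hH2⟩ => ?_
  rw [hr, h6, ht] at hH2
  rw [h3, h6, h2] at hP2
  have h26 : s2.nats 6 0 = m := by rw [hF2.2 6 (by simp), h6]
  have h23 : s2.nats 3 = s.nats 3 := by rw [hF2.2 3 (by simp), h3]
  have hF2' := hF1.trans (hF2.mono (S' := [2, 4, 5, 6, 7, 8]) (by simp))
  have hr2 : s2.angleLt = s.angleLt := State.angleLt_eq hF2' (by simp) hP2
  refine (extractAll_spec s2 (L := L) (by rwa [h26])).mono (by rw [h26])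
    fun s3 ⟨hF3, hP3, hH3⟩ => ?_
  rw [h23, h26] at hP3
  rw [h26, hr2] at hH3
  exact ⟨hF2'.trans (hF3.mono (by simp)), hP2.trans hP3, fun V hV hmem => hH3 V hV
    (State.tail_mem hF2' (by simp) hP2 hmem) (hH2 V hV hmem)⟩

end RealRAM

/-! ## The scan of a sorted sequence -/

open RealRAM in
-- By Cramer's rule `z - p` is a combination of `x - p` and `y - p`. If both alternatives failed,
-- its coefficients would be nonpositive, and `z` could not follow `p` lexicographically. Hence
-- angles at the lexicographically smallest point form a weak order.
theorem orient_negTrans_of_lexLt {p x y z : ℝ × ℝ} (hx : LexLt p x) (hy : LexLt p y)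
    (hz : LexLt p z) (h : 0 < orient p x y) : 0 < orient p x z ∨ 0 < orient p z y := by
  by_contra hcon
  push Not at hcon
  obtain ⟨h1, h2⟩ := hcon
  have e1 : orient p x y * (z.1 - p.1) = orient p z y * (x.1 - p.1) +
      orient p x z * (y.1 - p.1) := by
    unfold orient; ring
  have e2 : orient p x y * (z.2 - p.2) = orient p z y * (x.2 - p.2) +
      orient p x z * (y.2 - p.2) := by
    unfold orient; ring
  have fst : ∀ {q : ℝ × ℝ}, LexLt p q → 0 ≤ q.1 - p.1 := by
    rintro q (h | h) <;> linarith [h]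
  have snd : ∀ {q : ℝ × ℝ}, LexLt p q → q.1 - p.1 = 0 → 0 < q.2 - p.2 := by
    rintro q (h | h) h0
    · linarith
    · linarith [h.2]
  have a1 := mul_nonpos_of_nonpos_of_nonneg h2 (fst hx)
  have a2 := mul_nonpos_of_nonpos_of_nonneg h1 (fst hy)
  have a3 := mul_nonneg h.le (fst hz)
  have z0 : z.1 - p.1 = 0 := (mul_eq_zero.mp (by linarith)).resolve_left h.ne'
  have b3 := mul_pos h (snd hz z0)
  have second : ∀ {t : ℝ} {q : ℝ × ℝ}, LexLt p q → t ≤ 0 → t * (q.1 - p.1) = 0 →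
      t * (q.2 - p.2) ≤ 0 := by
    intro t q hq ht h0
    rcases mul_eq_zero.mp h0 with rfl | h0
    · simp
    · exact mul_nonpos_of_nonpos_of_nonneg ht (snd hq h0).le
  have b1 := second hx h2 (by linarith)
  have b2 := second hy h1 (by linarith)
  linarith

/-- The scan of the points `W 0, …, W (m - 1)`, sorted by their angles at `W 0`, has treated the
points before `i`, and `W 0, …, W (k - 1)` are on the stack. -/
structure ScanInvariant (W : ℕ → ℝ × ℝ) (m k i : ℕ) : Prop where
  star : ∀ a b, 1 ≤ a → a < b → b < m → (a < k ∨ i ≤ a) → (b < k ∨ i ≤ b) →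
    0 < orient (W 0) (W a) (W b)
  turn : ∀ a, a + 2 < k → 0 < orient (W a) (W (a + 1)) (W (a + 2))
  hull : ∀ a, a < m → W a ∈ convexHull ℝ (W '' {b | b < m ∧ (b < k ∨ i ≤ b)})

namespace ScanInvariant

variable {W W' : ℕ → ℝ × ℝ} {m k i : ℕ}

theorem init (h : ∀ a b, 1 ≤ a → a < b → b < m → 0 < orient (W 0) (W a) (W b)) :
    ScanInvariant W m 2 2 where
  star a b h1 h2 h3 _ _ := h a b h1 h2 h3
  turn a ha := by omega
  hull a ha := subset_convexHull ℝ _ ⟨a, ⟨ha, by omega⟩, rfl⟩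

/-- The discarded point is in the triangle of the first point, the one below it on the stack, and
the current one, and these stay. -/
theorem pop (h : ScanInvariant W m k i) (hk : 2 < k) (hki : k ≤ i) (hi : i < m)
    (hlt : ¬ 0 < orient (W (k - 2)) (W (k - 1)) (W i)) : ScanInvariant W m (k - 1) i where
  star a b h1 h2 h3 h4 h5 := h.star a b h1 h2 h3 (by omega) (by omega)
  turn a ha := h.turn a (by omega)
  hull a ha := by
    refine convexHull_min ?_ (convex_convexHull ℝ _) (h.hull a ha)
    rintro _ ⟨b, ⟨hb, hb'⟩, rfl⟩
    by_cases hbk : b = k - 1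
    · subst hbk
      have h1 := h.star (k - 2) i (by omega) (by omega) hi (by omega) (by omega)
      have h2 := h.star (k - 2) (k - 1) (by omega) (by omega) hb (by omega) (by omega)
      have h3 := h.star (k - 1) i (by omega) (by omega) hi (by omega) (by omega)
      refine convexHull_mono ?_ (mem_convexHull_triangle h1 h2.le ?_ ?_)
      · rintro _ (rfl | rfl | rfl)
        · exact ⟨0, ⟨by omega, by omega⟩, rfl⟩
        · exact ⟨k - 2, ⟨by omega, by omega⟩, rfl⟩
        · exact ⟨i, ⟨by omega, by omega⟩, rfl⟩
      · rw [orient_swap_right]; linarith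
      · rw [← orient_rotate]; exact h3.le
    · exact subset_convexHull ℝ _ ⟨b, ⟨hb, by omega⟩, rfl⟩

/-- Exchanging the cells `k` and `i` keeps the array a permutation: discarded points gather between
the stack and the untreated points. -/
theorem push (h : ScanInvariant W m k i) (hk : 2 ≤ k) (hki : k ≤ i) (hi : i < m)
    (hlt : 2 < k → 0 < orient (W (k - 2)) (W (k - 1)) (W i)) (hWk : W' k = W i) (hWi : W' i = W k)
    (hWo : ∀ j, j ≠ k → j ≠ i → W' j = W j) : ScanInvariant W' m (k + 1) (i + 1) where
  star a b h1 h2 h3 h4 h5 := by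
    rw [hWo 0 (by omega) (by omega)]
    by_cases hak : a = k
    · subst hak
      rw [hWk, hWo b (by omega) (by omega)]
      exact h.star i b (by omega) (by omega) h3 (by omega) (by omega)
    · rw [hWo a hak (by omega)]
      by_cases hbk : b = k
      · subst hbk
        rw [hWk]
        exact h.star a i h1 (by omega) hi (by omega) (by omega)
      · rw [hWo b hbk (by omega)]
        exact h.star a b h1 h2 h3 (by omega) (by omega)
  turn a ha := by
    rw [hWo a (by omega) (by omega), hWo (a + 1) (by omega) (by omega)]
    by_cases hak : a + 2 = k
    · subst hak
      rw [hWk]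
      rcases Nat.eq_zero_or_pos a with rfl | ha0
      · exact h.star 1 i le_rfl (by omega) hi (by omega) (by omega)
      · simpa using hlt (by omega)
    · rw [hWo (a + 2) (by omega) (by omega)]
      exact h.turn a (by omega)
  hull a ha := by
    have hset : W '' {b | b < m ∧ (b < k ∨ i ≤ b)} ⊆
        W' '' {b | b < m ∧ (b < k + 1 ∨ i + 1 ≤ b)} := by
      rintro _ ⟨b, ⟨hb, hb'⟩, rfl⟩
      by_cases hbi : b = i
      · subst hbi
        exact ⟨k, ⟨by omega, by omega⟩, hWk⟩
      · exact ⟨b, ⟨hb, by omega⟩, hWo b (by omega) hbi⟩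
    refine convexHull_mono hset ?_
    by_cases hak : a = k
    · rw [hak, hWk]; exact h.hull i hi
    · by_cases hai : a = i
      · rw [hai, hWi]; exact h.hull k (by omega)
      · rw [hWo a hak hai]; exact h.hull a ha

end ScanInvariant

/-- The points in the cells `o, …, o + h - 1` are in convex position, in counterclockwise order,
and their convex hull contains the points in the cells `o, …, n - 1`. -/
structure HullSlice (f : ℕ → ℝ × ℝ) (o h n : ℕ) : Prop where
  pos : ∀ i j k, i < j → j < k → k < h → 0 < orient (f (o + i)) (f (o + j)) (f (o + k))
  hull : f '' Set.Ico o n ⊆ convexHull ℝ (f '' Set.Ico o (o + h))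

theorem ScanInvariant.hullSlice {f : ℕ → ℝ × ℝ} {o m k : ℕ} (hk : k ≤ m)
    (h : ScanInvariant (fun j => f (o + j)) m k m) : HullSlice f o k (o + m) where
  pos := orient_pos_of_star (fun i j h1 h2 h3 => h.star i j h1 h2 (by omega) (by omega)
    (by omega)) h.turn
  hull := by
    rintro _ ⟨a, ha, rfl⟩
    rw [Set.mem_Ico] at ha
    have := h.hull (a - o) (by omega)
    rw [show o + (a - o) = a by omega] at this
    refine convexHull_mono ?_ this
    rintro _ ⟨b, ⟨hb, hb'⟩, rfl⟩
    exact ⟨o + b, ⟨by omega, by omega⟩, rfl⟩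

namespace RealRAM

/-! ## One convex layer

The points of the layers that have not been found yet are in the cells from `o` on. -/

/-- The point whose number is in a cell of the array `2`. -/
def State.pt (s : State) (j : ℕ) : ℝ × ℝ := s.point (s.nats 2 j)

@[simp] theorem State.pt_writeNat (s : State) {a : ℕ} (ha : 2 ≠ a) (i v : ℕ) :
    (s.writeNat a i v).pt = s.pt := by
  funext j
  simp [State.pt, ha]

/-- Move the lexicographically smallest point to cell `o`. -/
def minToFront : Program :=
  .seq (.setVar 4 (.add (.var 3) (.const 1)))
    (.loop (.natLt (.var 4) (.var 0))
      (.seq (.branch (.lex (.read 2 (.var 4)) (.read 2 (.var 3))) (.swap (.var 3) (.var 4)) .skip)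
        (.setVar 4 (.add (.var 4) (.const 1)))))

/-- Convex hull of the points sorted by angle. The stack of height `k` (array `5`) is in the cells
from `o` on. -/
def scan : Program :=
  .seq (.setVar 5 (.const 2)) (.seq (.setVar 4 (.const 2))
    (.loop (.natLt (.add (.var 3) (.var 4)) (.var 0))
      (.branch
        (.and (.natLt (.const 2) (.var 5))
          (.not (.left (.cell (.sub (.var 5) (.const 2))) (.cell (.sub (.var 5) (.const 1)))
            (.cell (.var 4)))))
        (.setVar 5 (.sub (.var 5) (.const 1)))
        (.seq (.swap (.add (.var 3) (.var 5)) (.add (.var 3) (.var 4)))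
          (.seq (.setVar 5 (.add (.var 5) (.const 1)))
            (.setVar 4 (.add (.var 4) (.const 1))))))))

theorem LexLt.trans {p q r : ℝ × ℝ} (h : LexLt p q) (h' : LexLt q r) : LexLt p r := by
  rcases h with h | ⟨h1, h2⟩ <;> rcases h' with h' | ⟨h3, h4⟩
  · exact Or.inl (h.trans h')
  · exact Or.inl (h3 ▸ h)
  · exact Or.inl (h1 ▸ h')
  · exact Or.inr ⟨h1.trans h3, h2.trans h4⟩

theorem LexLt.irrefl (p : ℝ × ℝ) : ¬ LexLt p p := by
  simp [LexLt]

theorem lexLt_of_not {p q : ℝ × ℝ} (h : ¬ LexLt p q) (hne : p ≠ q) : LexLt q p := by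
  unfold LexLt at *
  push Not at h
  rcases h.1.lt_or_eq with h1 | h1
  · exact Or.inl h1
  · refine Or.inr ⟨h1, lt_of_le_of_ne (h.2 h1.symm) fun h2 => hne (Prod.ext h1.symm h2.symm)⟩

theorem minToFront_spec (s : State) {m : ℕ} (hm : s.nats 0 0 = s.nats 3 0 + m) (hm1 : 1 ≤ m) :
    Computes minToFront s (100 * (m + 1)) fun s' => Frame [2, 4, 8] s s' ∧
      PermOn (Set.Ico (s.nats 3 0) (s.nats 0 0)) (s.nats 2) (s'.nats 2) ∧
      ∀ j, 1 ≤ j → j < m → ¬ LexLt (s'.pt (s.nats 3 0 + j)) (s'.pt (s.nats 3 0)) := by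
  set o := s.nats 3 0 with ho
  let I : ℕ → State → Prop := fun i s' => Frame [2, 4, 8] s s' ∧
    PermOn (Set.Ico o (o + m)) (s.nats 2) (s'.nats 2) ∧ 1 ≤ i ∧ s'.nats 4 0 = o + i ∧
      ∀ j, 1 ≤ j → j < i → ¬ LexLt (s'.pt (o + j)) (s'.pt o)
  rw [hm]
  refine (Computes.setNat_seq (Computes.count (I := I) (N := m) (j₀ := 1) (c := 60) hm1 ?_ ?_
    ?_)).mono ?_ ?_
  · exact ⟨(Frame.refl _ s).writeNat (by simp) _ _, by simpa using PermOn.refl _ _, le_rfl,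
      by simp [NatExp.eval, ← ho], fun j _ _ => by omega⟩
  · rintro i s' ⟨hF, -, -, h4, -⟩
    simp only [Test.Holds, NatExp.eval, h4, hF.2 0 (by simp), hm]
    omega
  · rintro i s' hi ⟨hF, hP, h1, h4, hI⟩
    have h3 : s'.nats 3 0 = o := by rw [hF.2 3 (by simp)]
    refine (Computes.seq (T := 54) (T' := 6) (Q := fun s1 => Frame [2, 4, 8] s s1 ∧
      PermOn (Set.Ico o (o + m)) (s.nats 2) (s1.nats 2) ∧ s1.nats 4 0 = o + i ∧
      ∀ j, 1 ≤ j → j < i + 1 → ¬ LexLt (s1.pt (o + j)) (s1.pt o)) ?_ ?_).mono le_rfl fun _ h => h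
    · refine (Computes.branch (fun hb => Computes.straight (isStraight_swap _ _) ?_) fun hb =>
        Computes.skip ?_).mono (by
          simp [Test.cost, Test.lex, NatExp.cost, Program.swap, Program.maxCost, RealExp.cost])
        fun _ h => h
      all_goals simp only [Test.holds_lex, NatExp.eval, h4, h3] at hb
      · obtain ⟨g1, g2⟩ := exec_swap (e := .var 3) (f := .var 4) (by simp [NatExp.Pure])
          (by simp [NatExp.Pure]) s'
        set s1 := (Program.swap (.var 3) (.var 4)).exec s'
        simp only [NatExp.eval, h3, h4] at g1
        have hpt : ∀ j, s1.pt j = s'.pt (Equiv.swap o (o + i) j) := by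
          intro j
          simp only [State.pt, g1, Function.comp_apply, State.point_eq_of_reals_eq g2.1]
        refine ⟨hF.trans (g2.mono (by simp)), ?_, ?_, ?_⟩
        · rw [g1]
          exact hP.trans (PermOn.swap (Set.mem_Ico.mpr ⟨by omega, by omega⟩)
            (Set.mem_Ico.mpr ⟨by omega, by omega⟩))
        · rw [g2.2 4 (by simp), h4]
        · intro j j1 j2 hlt
          rw [hpt, hpt, Equiv.swap_apply_left] at hlt
          by_cases hji : j = i
          · subst hji
            rw [Equiv.swap_apply_right] at hlt
            exact LexLt.irrefl _ (hlt.trans hb)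
          · rw [Equiv.swap_apply_of_ne_of_ne (by omega) (by omega)] at hlt
            exact hI j j1 (by omega) (hlt.trans hb)
      · refine ⟨hF, hP, h4, fun j j1 j2 => ?_⟩
        by_cases hji : j = i
        · subst hji; exact hb
        · exact hI j j1 (by omega)
    · rintro s1 ⟨q1, q2, q3, q4⟩
      refine (Computes.setNat ?_).mono (by simp [NatExp.cost]) fun _ h => h
      refine ⟨q1.writeNat (by simp) _ _, by simpa using q2, by omega,
        by simp [NatExp.eval, q3, add_assoc], ?_⟩
      simpa using q4
  · simp only [NatExp.cost, Test.cost]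
    obtain ⟨d, rfl⟩ : ∃ d, m = d + 1 := ⟨m - 1, by omega⟩
    omega
  · rintro s' ⟨hF, hP, -, -, hI⟩
    exact ⟨hF, hP, hI⟩

/-- At least three points remain, whatever the input, since points are popped only above height two
and the last action is a push. -/
theorem scan_spec (s : State) {m : ℕ} (hm : s.nats 0 0 = s.nats 3 0 + m) (hm3 : 3 ≤ m) :
    Computes scan s (200 * (2 * m + 2)) fun s' => Frame [2, 4, 5, 8] s s' ∧
      PermOn (Set.Ico (s.nats 3 0) (s.nats 0 0)) (s.nats 2) (s'.nats 2) ∧ 3 ≤ s'.nats 5 0 ∧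
      s'.nats 5 0 ≤ m ∧
      ((∀ a b, 1 ≤ a → a < b → b < m → 0 < orient (s.pt (s.nats 3 0)) (s.pt (s.nats 3 0 + a))
        (s.pt (s.nats 3 0 + b))) → HullSlice s'.pt (s.nats 3 0) (s'.nats 5 0) (s.nats 0 0)) := by
  set o := s.nats 3 0 with ho
  rw [hm]
  let I : State → Prop := fun s' => Frame [2, 4, 5, 8] s s' ∧
    PermOn (Set.Ico o (o + m)) (s.nats 2) (s'.nats 2) ∧ 2 ≤ s'.nats 5 0 ∧
    s'.nats 5 0 ≤ s'.nats 4 0 ∧ s'.nats 4 0 ≤ m ∧ (s'.nats 4 0 < m ∨ 3 ≤ s'.nats 5 0) ∧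
      ((∀ a b, 1 ≤ a → a < b → b < m → 0 < orient (s.pt o) (s.pt (o + a)) (s.pt (o + b))) →
        ScanInvariant (fun j => s'.pt (o + j)) m (s'.nats 5 0) (s'.nats 4 0))
  refine (Computes.setNat_seq (Computes.setNat_seq (Computes.loop (I := I)
    -- A pop lowers the stack by one; a push raises it by one but consumes a point, which counts
    -- twice.
    (φ := fun s' => 170 * (2 * (m - s'.nats 4 0) + s'.nats 5 0)) ?_ ?_))).mono ?_ ?_
  · refine ⟨((Frame.refl _ s).writeNat (by simp) _ _).writeNat (by simp) _ _,
      by simpa using PermOn.refl _ _, ?_⟩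
    simp (disch := decide) only [NatExp.eval, State.nats_writeNat_self, Function.update_self,
          State.nats_writeNat_of_ne]
    refine ⟨le_rfl, le_rfl, by omega, by omega, fun hs => ScanInvariant.init ?_⟩
    simpa using hs
  · rintro s' ⟨hF, hP, h1, h2, h2', h2'', hI⟩ hb
    have h3 : s'.nats 3 0 = o := by rw [hF.2 3 (by simp)]
    simp only [Test.Holds, NatExp.eval, h3, hF.2 0 (by simp), hm] at hb
    refine ⟨160, (Computes.branch (fun hc => Computes.setNat ?_) fun hc => Computes.straight
      (by simp [Program.IsStraight, isStraight_swap]) ?_).mono (by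
        simp [Test.cost, Test.left, NatExp.cost, NatExp.cell, Program.swap, Program.maxCost,
          RealExp.cost, RealExp.orient]) fun _ h => h⟩
    all_goals simp only [Test.Holds, Test.holds_left, NatExp.eval, h3, NatExp.cell] at hc
    · refine ⟨⟨hF.writeNat (by simp) _ _, by simpa using hP, ?_⟩, ?_⟩
      · simp (disch := decide) only [NatExp.eval, State.nats_writeNat_self, Function.update_self,
          State.nats_writeNat_of_ne]
        refine ⟨by omega, by omega, h2', by omega, fun hs => ?_⟩
        simpa using (hI hs).pop hc.1 h2 (by omega) hc.2
      · simp [NatExp.eval, Test.cost, NatExp.cost]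
        omega
    · obtain ⟨g1, g2⟩ := exec_swap (e := .add (.var 3) (.var 5)) (f := .add (.var 3) (.var 4))
        (by simp [NatExp.Pure]) (by simp [NatExp.Pure]) s'
      simp only [Program.exec]
      set s1 := (Program.swap (.add (.var 3) (.var 5)) (.add (.var 3) (.var 4))).exec s'
      simp only [NatExp.eval, h3] at g1
      have e5 := g2.2 5 (by simp)
      have e4 := g2.2 4 (by simp)
      have hpt : ∀ j, s1.pt (o + j) = s'.pt (o + Equiv.swap (s'.nats 5 0) (s'.nats 4 0) j) := by
        intro j
        simp only [State.pt, g1, Function.comp_apply, State.point_eq_of_reals_eq g2.1]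
        congr 2
        simp only [Equiv.swap_apply_def]
        split_ifs <;> omega
      refine ⟨⟨((hF.trans (g2.mono (by simp))).writeNat (by simp) _ _).writeNat (by simp) _ _,
        ?_, ?_⟩, ?_⟩
      · simp (disch := decide) only [State.nats_writeNat_of_ne, g1]
        exact hP.trans (PermOn.swap (Set.mem_Ico.mpr ⟨by omega, by omega⟩)
          (Set.mem_Ico.mpr ⟨by omega, by omega⟩))
      · simp (disch := decide) only [NatExp.eval, State.nats_writeNat_self, Function.update_self,
          State.nats_writeNat_of_ne,
          e4, e5]
        refine ⟨by omega, by omega, by omega, by omega, fun hs => ?_⟩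
        refine (hI hs).push h1 h2 (by omega) (fun h => ?_) ?_ ?_ ?_
        · by_contra hcon
          exact hc ⟨h, hcon⟩
        · simpa using (hpt (s'.nats 5 0)).trans (by rw [Equiv.swap_apply_left])
        · simpa using (hpt (s'.nats 4 0)).trans (by rw [Equiv.swap_apply_right])
        · intro j j1 j2
          simpa using (hpt j).trans (by rw [Equiv.swap_apply_of_ne_of_ne j1 j2])
      · simp [NatExp.eval, Test.cost, NatExp.cost, e4, e5]
        omega
  · simp [NatExp.eval, Test.cost, NatExp.cost]
    omega
  · rintro s' ⟨⟨hF, hP, h1, h2, h2', h2'', hI⟩, hb⟩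
    have h3 : s'.nats 3 0 = o := by rw [hF.2 3 (by simp)]
    simp only [Test.Holds, NatExp.eval, h3, hF.2 0 (by simp), hm] at hb
    have h4 : s'.nats 4 0 = m := by omega
    rw [h4] at hI
    exact ⟨hF, hP, by omega, by omega, fun hs => (hI hs).hullSlice (by omega)⟩

end RealRAM

/-! ### Slices of the array as convex layers -/

/-- The points in the cells `o, …, n - 1` are distinct and in general position. -/
structure GenericSlice (f : ℕ → ℝ × ℝ) (o n : ℕ) : Prop where
  injOn : Set.InjOn f (Set.Ico o n)
  generalPosition : InGeneralPosition (f '' Set.Ico o n)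

namespace HullSlice

variable {f : ℕ → ℝ × ℝ} {o h n : ℕ}

theorem cycle (hs : HullSlice f o h n) : ConvexCycle h (fun i => f (o + i % h)) :=
  convexCycle_of_slice (f := fun i => f (o + i)) hs.pos

theorem range_eq (f : ℕ → ℝ × ℝ) (o : ℕ) (hh : 0 < h) :
    Set.range (fun i => f (o + i % h)) = f '' Set.Ico o (o + h) := by
  ext x
  constructor
  · rintro ⟨i, rfl⟩
    exact ⟨o + i % h, ⟨by omega, by have := Nat.mod_lt i hh; omega⟩, rfl⟩
  · rintro ⟨i, hi, rfl⟩
    rw [Set.mem_Ico] at hi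
    exact ⟨i - o, by simp only [Nat.mod_eq_of_lt (show i - o < h by omega)]; congr 1; omega⟩

theorem hullVertices_eq (hs : HullSlice f o h n) (hh : 3 ≤ h) (hn : o + h ≤ n) :
    hullVertices (f '' Set.Ico o n) = f '' Set.Ico o (o + h) := by
  rw [← range_eq f o (by omega)]
  refine hs.cycle.hullVertices_eq hh ?_ ?_
  · rw [range_eq f o (by omega)]
    exact Set.image_mono (Set.Ico_subset_Ico le_rfl hn)
  · rw [range_eq f o (by omega)]
    exact hs.hull

theorem peel_eq (hs : HullSlice f o h n) (hh : 3 ≤ h) (hn : o + h ≤ n)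
    (hf : Set.InjOn f (Set.Ico o n)) : peel (f '' Set.Ico o n) = f '' Set.Ico (o + h) n := by
  rw [peel, hs.hullVertices_eq hh hn, ← hf.image_sdiff_subset (Set.Ico_subset_Ico le_rfl hn)]
  congr 1
  ext i
  simp only [Set.mem_sdiff, Set.mem_Ico]
  omega

theorem pierced (hs : HullSlice f o h n) (hh : 3 ≤ h) (hn : o + h ≤ n)
    (hf : Set.InjOn f (Set.Ico o n)) (hnac : IsNestedAlmostConvex (f '' Set.Ico o n)) :
    Pierced h (fun i => f (o + i % h)) (f '' Set.Ico (o + h) n) := by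
  rw [← hs.peel_eq hh hn hf]
  refine (hnac.pierced hs.cycle hh ?_ ?_).2
  · rw [range_eq f o (by omega)]
    exact Set.image_mono (Set.Ico_subset_Ico le_rfl hn)
  · rw [range_eq f o (by omega)]
    exact hs.hull

/-- A layer with `h` vertices encloses `h - 2` points. This necessary condition is the size test of
the program. -/
theorem two_mul_eq (hs : HullSlice f o h n) (hh : 3 ≤ h) (hn : o + h ≤ n)
    (hf : Set.InjOn f (Set.Ico o n)) (hnac : IsNestedAlmostConvex (f '' Set.Ico o n)) :
    o + 2 * h = n + 2 := by
  have := (hs.pierced hh hn hf hnac).ncard_eq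
  rw [(hf.mono (Set.Ico_subset_Ico (by omega) le_rfl)).ncard_image,
    ← Finset.coe_Ico, Set.ncard_coe_finset, Nat.card_Ico] at this
  omega

end HullSlice

/-- The cells before `o` consist of slices that are the convex layers if the points are generic,
and whose lengths are those of the layers of a nested almost convex set. -/
inductive Layered (f : ℕ → ℝ × ℝ) (n : ℕ) : ℕ → Prop where
  | zero : Layered f n 0
  | step {o h : ℕ} : Layered f n o → o + 2 * h = n + 2 → 3 ≤ h →
      (GenericSlice f o n → HullSlice f o h n) → Layered f n (o + h)

theorem GenericSlice.of_isNestedAlmostConvex {f : ℕ → ℝ × ℝ} {o n : ℕ}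
    (hf : Set.InjOn f (Set.Ico 0 n)) (hon : o < n)
    (h : IsNestedAlmostConvex (f '' Set.Ico o n)) : GenericSlice f o n :=
  ⟨hf.mono (Set.Ico_subset_Ico (Nat.zero_le _) le_rfl), ((isNestedAlmostConvex_iff h.finite
    ⟨f o, o, ⟨le_rfl, hon⟩, rfl⟩).mp h).2.1⟩

theorem Layered.isNestedAlmostConvex {f : ℕ → ℝ × ℝ} {o n : ℕ} (h : Layered f n o)
    (hf : Set.InjOn f (Set.Ico 0 n)) (hnac : IsNestedAlmostConvex (f '' Set.Ico 0 n)) :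
    IsNestedAlmostConvex (f '' Set.Ico o n) := by
  induction h with
  | zero => exact hnac
  | @step o h hl h1 h2 h3 ih =>
    have hg := GenericSlice.of_isNestedAlmostConvex hf (by omega) ih
    rw [← (h3 hg).peel_eq h2 (by omega) hg.injOn]
    exact ((isNestedAlmostConvex_iff ih.finite ⟨f o, o, ⟨le_rfl, by omega⟩, rfl⟩).mp ih).1

open RealRAM in
-- Further peeling only rearranges the cells behind the layers already found.
theorem Layered.perm {f f' : ℕ → ℝ × ℝ} {o o' n : ℕ} (h : Layered f n o)
    (hp : PermOn (Set.Ico o' n) f f') (ho : o ≤ o') : Layered f' n o := by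
  induction h with
  | zero => exact .zero
  | @step o h hl h1 h2 h3 ih =>
    refine .step (ih (by omega)) h1 h2 fun hg => ?_
    have himg : f' '' Set.Ico o n = f '' Set.Ico o n :=
      hp.image_eq (Set.Ico_subset_Ico (by omega) le_rfl)
    have hs := h3 ⟨hp.symm.injOn (Set.Ico_subset_Ico (by omega) le_rfl) hg.injOn,
      himg ▸ hg.generalPosition⟩
    have heq : ∀ i, i < h → f' (o + i) = f (o + i) := fun i hi =>
      hp.apply_of_notMem (by simp; omega)
    refine ⟨fun i j k q1 q2 q3 => ?_, ?_⟩
    · rw [heq i (by omega), heq j (by omega), heq k q3]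
      exact hs.pos i j k q1 q2 q3
    · rw [himg]
      refine hs.hull.trans (convexHull_mono ?_)
      rintro _ ⟨i, hi, rfl⟩
      rw [Set.mem_Ico] at hi
      refine ⟨i, hi, ?_⟩
      have := heq (i - o) (by omega)
      rwa [show o + (i - o) = i by omega] at this

/-! ### Finding all layers in time `O(n log n)` -/

namespace RealRAM

theorem State.pt_perm {s s' : State} {S : List ℕ} (hF : Frame S s s') {T : Set ℕ}
    (hP : PermOn T (s.nats 2) (s'.nats 2)) : PermOn T s.pt s'.pt := by
  have h := hP.comp s.point
  have e : s'.pt = s.point ∘ s'.nats 2 := by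
    rw [← State.point_eq_of_reals_eq hF.1]
    rfl
  rw [e]
  exact h

/-- Compare the height of the stack with the height in a nested almost convex set. -/
def acceptLayer : Program :=
  .branch (.and (.not (.natLt (.add (.var 3) (.add (.var 5) (.var 5))) (.add (.var 0) (.const 2))))
      (.not (.natLt (.add (.var 0) (.const 2)) (.add (.var 3) (.add (.var 5) (.var 5))))))
    (.setVar 3 (.add (.var 3) (.var 5)))
    (.seq (.setVar 9 (.const 1)) (.setVar 3 (.var 0)))

/-- Find one layer. -/
def peelLayer : Program := .seq minToFront (.seq heapSort (.seq scan acceptLayer))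

theorem acceptLayer_spec (s : State) : Computes acceptLayer s acceptLayer.maxCost fun s' =>
    Frame [3, 9] s s' ∧
      ((s.nats 3 0 + 2 * s.nats 5 0 = s.nats 0 0 + 2 ∧ s'.nats 3 0 = s.nats 3 0 + s.nats 5 0 ∧
        s'.nats 9 = s.nats 9) ∨
      (s.nats 3 0 + 2 * s.nats 5 0 ≠ s.nats 0 0 + 2 ∧ s'.nats 3 0 = s.nats 0 0 ∧
        s'.nats 9 0 = 1)) := by
  refine Computes.branch (fun hb => Computes.setNat ?_) fun hb => Computes.setNat_seq
    (Computes.setNat ?_) <;> simp only [Test.Holds, NatExp.eval] at hb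
  · exact ⟨(Frame.refl _ s).writeNat (by simp) _ _, Or.inl ⟨by omega, by simp [NatExp.eval],
      by simp⟩⟩
  · exact ⟨((Frame.refl _ s).writeNat (by simp) _ _).writeNat (by simp) _ _, Or.inr ⟨by omega,
      by simp [NatExp.eval], by simp [NatExp.eval]⟩⟩

/-- A bound for the costs of `peelLayer`, for each point. -/
@[irreducible] def peelCost : ℕ := 3 * siftCost + (acceptLayer.maxCost + 2000)

theorem peelCost_bound (a c L : ℕ) {m : ℕ} (hm : 3 ≤ m) :
    100 * (m + 1) + ((a * (L + 2) + 50) * (2 * m + 1) + (200 * (2 * m + 2) + c)) ≤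
      (3 * a + (c + 2000)) * (L + 2) * m := by
  have h1 : a * (L + 2) * (2 * m + 1) ≤ a * (L + 2) * (3 * m) :=
    Nat.mul_le_mul_left _ (by omega)
  have h2 : (c + 2000) * m ≤ (c + 2000) * (L + 2) * m :=
    Nat.mul_le_mul_right _ (Nat.le_mul_of_pos_right _ (by omega))
  have h3 : c ≤ c * m := Nat.le_mul_of_pos_right _ (by omega)
  have h4 : (a * (L + 2) + 50) * (2 * m + 1) = a * (L + 2) * (2 * m + 1) + 50 * (2 * m + 1) := by
    ring
  have h5 : (3 * a + (c + 2000)) * (L + 2) * m = a * (L + 2) * (3 * m) +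
      (c + 2000) * (L + 2) * m := by ring
  rw [add_mul] at h2
  omega

/-- General position is never tested here; it is only assumed in the claim that the stack is the
outer layer. The running time and the bounds on the height of the stack do not need it. -/
theorem peelLayer_spec (s : State) {m L : ℕ} (hm : s.nats 0 0 = s.nats 3 0 + m) (hm3 : 3 ≤ m)
    (hL : Nat.log 2 m ≤ L) :
    Computes peelLayer s (peelCost * (L + 2) * m) fun s' =>
      Frame [2, 3, 4, 5, 6, 7, 8, 9] s s' ∧
      PermOn (Set.Ico (s.nats 3 0) (s.nats 0 0)) (s.nats 2) (s'.nats 2) ∧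
      ∃ h, 3 ≤ h ∧ h ≤ m ∧
        (GenericSlice s'.pt (s.nats 3 0) (s.nats 0 0) →
          HullSlice s'.pt (s.nats 3 0) h (s.nats 0 0)) ∧
        ((s.nats 3 0 + 2 * h = s.nats 0 0 + 2 ∧ s'.nats 3 0 = s.nats 3 0 + h ∧
          s'.nats 9 = s.nats 9) ∨
        (s.nats 3 0 + 2 * h ≠ s.nats 0 0 + 2 ∧ s'.nats 3 0 = s.nats 0 0 ∧ s'.nats 9 0 = 1)) := by
  set o := s.nats 3 0 with ho
  set n := s.nats 0 0 with hn
  refine ((minToFront_spec s hm (by omega)).seq fun s1 ⟨hF1, hP1, hmin⟩ => ?_).mono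
    (T := 100 * (m + 1) + ((siftCost * (L + 2) + 50) * (2 * m + 1) + (200 * (2 * m + 2) +
      acceptLayer.maxCost))) ?_ fun _ h => h
  swap
  · rw [peelCost]
    exact peelCost_bound _ _ L hm3
  have e13 : s1.nats 3 0 = o := by rw [hF1.2 3 (by simp)]
  have e10 : s1.nats 0 0 = n := by rw [hF1.2 0 (by simp)]
  refine (heapSort_spec s1 (m := m - 1) (L := L) (by omega)
    ((Nat.log_mono_right (by omega)).trans hL)).mono (by
      rw [show 2 * (m - 1) + 3 = 2 * m + 1 by omega]) (fun _ h => h) |>.seq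
      fun s2 ⟨hF2, hP2, hsort⟩ => ?_
  rw [e13] at hP2
  have e23 : s2.nats 3 0 = o := by rw [hF2.2 3 (by simp), e13]
  have e20 : s2.nats 0 0 = n := by rw [hF2.2 0 (by simp), e10]
  refine (scan_spec s2 (m := m) (by omega) hm3).seq fun s3 ⟨hF3, hP3, h3, h3', hscan⟩ => ?_
  rw [e23, e20] at hscan hP3
  have e33 : s3.nats 3 0 = o := by rw [hF3.2 3 (by simp), e23]
  have e30 : s3.nats 0 0 = n := by rw [hF3.2 0 (by simp), e20]
  refine (acceptLayer_spec s3).mono le_rfl fun s4 ⟨hF4, hacc⟩ => ?_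
  rw [e33, e30, hF3.2 9 (by simp), hF2.2 9 (by simp), hF1.2 9 (by simp)] at hacc
  have hpt4 : s4.pt = s3.pt := by
    funext j
    rw [State.pt, State.pt, State.point_eq_of_reals_eq hF4.1, hF4.2 2 (by simp)]
  have hP2' : PermOn (Set.Ico o n) (s1.nats 2) (s2.nats 2) := hP2.mono fun i hi => by
    rw [Set.mem_Icc] at hi; exact ⟨by omega, by omega⟩
  refine ⟨(hF1.mono (by simp)).trans ((hF2.mono (by simp)).trans ((hF3.mono (by simp)).trans
    (hF4.mono (by simp)))), ?_, s3.nats 5 0, h3, h3', ?_, hacc⟩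
  · rw [hF4.2 2 (by simp)]
    exact hP1.trans (hP2'.trans hP3)
  rw [hpt4]
  intro hg
  refine hscan ?_
  have p3 := State.pt_perm hF3 hP3
  have p2 := State.pt_perm hF2 hP2
  have p2' := State.pt_perm hF2 hP2'
  have inj2 := p3.symm.injOn le_rfl hg.injOn
  have gp2 : InGeneralPosition (s2.pt '' Set.Ico o n) := p3.image_eq le_rfl ▸ hg.generalPosition
  have inj1 := p2'.symm.injOn le_rfl inj2
  have hpo : s2.pt o = s1.pt o := p2.apply_of_notMem (by simp)
  have hlex : ∀ j, 1 ≤ j → j ≤ m - 1 → LexLt (s1.pt o) (s1.pt (o + j)) := by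
    intro j j1 j2
    refine lexLt_of_not (hmin j j1 (by omega)) fun e => ?_
    have := inj1 ⟨by omega, by omega⟩ ⟨by omega, by omega⟩ e
    omega
  have hVo : WeakOrderOn s1.angleLt {x | LexLt (s1.pt o) (s1.point x)} := by
    constructor
    · intro x hx y hy h1 h2
      rw [State.angleLt] at h1 h2
      rw [orient_swap_right] at h2
      linarith
    · intro x hx y hy z hz h1
      simp only [State.angleLt, e13] at h1 ⊢
      exact orient_negTrans_of_lexLt hx hy hz h1
  have hs := hsort _ hVo (fun j j1 j2 => by simpa [State.tail, e13, State.pt] using hlex j j1 j2)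
  intro a b ha hab hb
  have hne := (inGeneralPosition_iff.mp gp2) (s2.pt o) ⟨o, ⟨by omega, by omega⟩, rfl⟩
    (s2.pt (o + a)) ⟨o + a, ⟨by omega, by omega⟩, rfl⟩
    (s2.pt (o + b)) ⟨o + b, ⟨by omega, by omega⟩, rfl⟩
    (fun e => by have := inj2 ⟨by omega, by omega⟩ ⟨by omega, by omega⟩ e; omega)
    (fun e => by have := inj2 ⟨by omega, by omega⟩ ⟨by omega, by omega⟩ e; omega)
    (fun e => by have := inj2 ⟨by omega, by omega⟩ ⟨by omega, by omega⟩ e; omega)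
  have := hs a b ha hab (by omega)
  simp only [State.angleLt, State.tail, e13, e23] at this
  change ¬ 0 < orient (s1.pt o) _ _ at this
  rw [← State.point_eq_of_reals_eq hF2.1, ← hpo] at this
  change ¬ 0 < orient (s2.pt o) (s2.pt (o + b)) (s2.pt (o + a)) at this
  rw [orient_swap_right] at this
  -- The sort only excludes the wrong order; general position excludes ties.
  exact lt_of_le_of_ne (by linarith) hne.symm

/-- Find all layers. -/
def peelAll : Program := .loop (.natLt (.add (.var 3) (.const 2)) (.var 0)) peelLayer

theorem peelAll_spec (s : State) {n L : ℕ} (hn : s.nats 0 0 = n) (h3 : s.nats 3 0 = 0)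
    (h9 : s.nats 9 0 = 0) (hinj : Set.InjOn s.pt (Set.Ico 0 n)) (hL : Nat.log 2 n ≤ L) :
    Computes peelAll s (2 * (peelCost * (L + 2) + 20) * n + 20) fun s' =>
      Frame [2, 3, 4, 5, 6, 7, 8, 9] s s' ∧ PermOn (Set.Ico 0 n) (s.nats 2) (s'.nats 2) ∧
      s'.nats 3 0 ≤ n ∧ n ≤ s'.nats 3 0 + 2 ∧
      ((s'.nats 9 0 = 0 ∧ Layered s'.pt n (s'.nats 3 0)) ∨
        (s'.nats 9 0 = 1 ∧ ¬ IsNestedAlmostConvex (s'.pt '' Set.Ico 0 n))) := by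
  let I : State → Prop := fun s' => Frame [2, 3, 4, 5, 6, 7, 8, 9] s s' ∧
    PermOn (Set.Ico 0 n) (s.nats 2) (s'.nats 2) ∧ s'.nats 3 0 ≤ n ∧
      ((s'.nats 9 0 = 0 ∧ Layered s'.pt n (s'.nats 3 0)) ∨
        (s'.nats 9 0 = 1 ∧ s'.nats 3 0 = n ∧ ¬ IsNestedAlmostConvex (s'.pt '' Set.Ico 0 n)))
  refine (Computes.loop (I := I)
    (φ := fun s' => 2 * (peelCost * (L + 2) + 20) * (n - s'.nats 3 0))
    ⟨Frame.refl _ _, PermOn.refl _ _, by omega, Or.inl ⟨h9, by rw [h3]; exact .zero⟩⟩ ?_).mono ?_ ?_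
  · rintro s' ⟨hF, hP, ho, hI⟩ hb
    have h0 : s'.nats 0 0 = n := by rw [hF.2 0 (by simp), hn]
    simp only [Test.Holds, NatExp.eval, h0] at hb
    set o := s'.nats 3 0 with hodef
    obtain ⟨hrej, hlay⟩ : s'.nats 9 0 = 0 ∧ Layered s'.pt n o := by
      rcases hI with h | h
      · exact h
      · omega
    obtain ⟨m, hm⟩ : ∃ m, n = o + m := ⟨n - o, by omega⟩
    refine ⟨_, (peelLayer_spec s' (m := m) (L := L) (by omega) (by omega)
      ((Nat.log_mono_right (by omega)).trans hL)).mono le_rfl ?_⟩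
    rintro s1 ⟨hF1, hP1, h, hh3, hhm, hslice, hacc⟩
    rw [← hodef, h0] at hP1 hslice hacc
    have hP1' : PermOn (Set.Ico 0 n) (s'.nats 2) (s1.nats 2) :=
      hP1.mono (Set.Ico_subset_Ico (Nat.zero_le _) le_rfl)
    have hlay1 : Layered s1.pt n o := hlay.perm (State.pt_perm hF1 hP1) le_rfl
    -- An accepted layer has `m = 2 * h - 2` and leaves `h - 2` points, less than half; after a
    -- rejection nothing is left. So one half of the potential pays for the round.
    have hpay : ∀ o', o' ≤ n → 2 * (n - o') ≤ m →
        2 * (peelCost * (L + 2) + 20) * (n - o') + (peelCost * (L + 2) * m + 1 +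
          (Test.natLt (.add (.var 3) (.const 2)) (.var 0)).cost) ≤
        2 * (peelCost * (L + 2) + 20) * (n - o) := by
      intro o' _ h2
      rw [show n - o = m by omega]
      generalize peelCost * (L + 2) = K
      have e1 : 2 * (K + 20) * (n - o') = (K + 20) * (2 * (n - o')) := by ring
      have e2 : (K + 20) * (2 * (n - o')) ≤ (K + 20) * m := Nat.mul_le_mul_left _ h2
      have e3 : 2 * (K + 20) * m = (K + 20) * m + (K * m + 20 * m) := by ring
      simp only [Test.cost, NatExp.cost]
      omega
    refine ⟨⟨hF.trans hF1, hP.trans hP1', ?_, ?_⟩, ?_⟩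
    · rcases hacc with ⟨q1, q2, -⟩ | ⟨-, q2, -⟩ <;> omega
    · rcases hacc with ⟨q1, q2, q3⟩ | ⟨q1, q2, q3⟩
      · left
        rw [q2, q3]
        exact ⟨hrej, hlay1.step q1 hh3 hslice⟩
      · right
        -- A wrong size is a proof of the negative answer: in a nested almost convex set the slice
        -- is generic, so the scan has found its outer layer, whose size is forced.
        refine ⟨q3, q2, fun hnac => q1 ?_⟩
        have inj1 : Set.InjOn s1.pt (Set.Ico 0 n) :=
          (State.pt_perm (hF.trans hF1) (hP.trans hP1')).injOn le_rfl hinj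
        have hnac' := hlay1.isNestedAlmostConvex inj1 hnac
        have hg := GenericSlice.of_isNestedAlmostConvex inj1 (by omega) hnac'
        exact (hslice hg).two_mul_eq hh3 (by omega) hg.injOn hnac'
    · rcases hacc with ⟨q1, q2, -⟩ | ⟨-, q2, -⟩
      · exact hpay _ (by omega) (by omega)
      · exact hpay _ (by omega) (by omega)
  · simp only [h3, Nat.sub_zero, Test.cost, NatExp.cost]
    omega
  · rintro s' ⟨⟨hF, hP, ho, hI⟩, hb⟩
    simp only [Test.Holds, NatExp.eval, hF.2 0 (by simp), hn] at hb
    refine ⟨hF, hP, ho, by omega, ?_⟩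
    rcases hI with h | ⟨h, -, h'⟩
    · exact Or.inl h
    · exact Or.inr ⟨h, h'⟩

end RealRAM

/-! ## From a layer to the next one -/

theorem isNestedAlmostConvex_of_ncard_le_two {X : Set (ℝ × ℝ)} (hX : X.Finite)
    (h : X.ncard ≤ 2) : IsNestedAlmostConvex X := by
  induction hn : X.ncard using Nat.strong_induction_on generalizing X with
  | _ n ih =>
    rcases X.eq_empty_or_nonempty with rfl | hne
    · exact isNestedAlmostConvex_empty
    have few : ∀ p ∈ X, ∀ q ∈ X, ∀ r ∈ X, p ≠ q → p ≠ r → q ≠ r → False := by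
      intro p hp q hq r hr h1 h2 h3
      have : ({p, q, r} : Set (ℝ × ℝ)).ncard ≤ X.ncard :=
        Set.ncard_le_ncard (by rintro _ (rfl | rfl | rfl) <;> assumption) hX
      rw [Set.ncard_eq_three.mpr ⟨p, q, r, h1, h2, h3, rfl⟩] at this
      omega
    refine (isNestedAlmostConvex_iff hX hne).mpr ⟨?_, ?_, ?_⟩
    · obtain ⟨v, hv⟩ := hullVertices_nonempty hX hne
      have hlt : (peel X).ncard < X.ncard := Set.ncard_lt_ncard
        ⟨peel_subset X, fun hs => (hs (hullVertices_subset X hv)).2 hv⟩ hX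
      exact ih _ (hn ▸ hlt) (hX.subset (peel_subset X)) (by omega) rfl
    · exact fun p hp q hq r hr h1 h2 h3 => (few p hp q hq r hr h1 h2 h3).elim
    · exact fun p hp q hq r hr h1 h2 h3 => (few p (hullVertices_subset X hp) q
        (hullVertices_subset X hq) r (hullVertices_subset X hr) h1 h2 h3).elim

/-- The arcs of `t` are those of a point next to the `i`-th pair of vertices. -/
def EarArcs (lo mid hi : ℕ → ℕ) (t i : ℕ) : Prop :=
  lo t = 2 * i ∧ mid t = 2 * i + 1 ∧ hi t = 2 * i + 2

/-- The points in the cells from `o` on are a nested almost convex set, spanned by points in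
ears. -/
structure Verified (f : ℕ → ℝ × ℝ) (o n : ℕ) (lo mid hi : ℕ → ℕ) : Prop where
  nested : IsNestedAlmostConvex (f '' Set.Ico o n)
  hull : ∃ J ⊆ Set.Ico o n, f '' Set.Ico o n ⊆ convexHull ℝ (f '' J) ∧
    ∀ t ∈ J, ∃ i, EarArcs lo mid hi t i

/-- The outer layer of the points in the cells from `o` on is the polygon `q` with `m` vertices;
the arcs of the points refer to the polygon with `2 * m` vertices around it, counted from a
vertex next to `q 0`. -/
structure Aligned (f : ℕ → ℝ × ℝ) (o n : ℕ) (lo mid hi : ℕ → ℕ) (m : ℕ) (q : ℕ → ℝ × ℝ) :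
    Prop where
  card : 2 * m = n - o + 2
  cycle : ConvexCycle m q
  injOn : Set.InjOn q (Set.Iio m)
  hullVertices_eq : hullVertices (f '' Set.Ico o n) = Set.range q
  arcs : ∀ t ∈ Set.Ico o n, (∃ i, EarArcs lo mid hi t i ∧ f t = q i) ∨
    (f t ∈ peel (f '' Set.Ico o n) ∧ Pierced m q (peel (f '' Set.Ico o n)) ∧ ∃ a b c,
      (lo t = 2 * a ∧ mid t = 2 * b ∧ hi t = 2 * c) ∧ (a < b ∧ b < c ∧ c ≤ m ∧ c < a + m) ∧
      PassesTests q m a b c (f t))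

/-- What holds in front of the test of a layer if the points are a nested almost convex set. -/
def Expected (f : ℕ → ℝ × ℝ) (o n : ℕ) (lo mid hi : ℕ → ℕ) (y : ℝ × ℝ) : Prop :=
  (n = o + 1 ∧ EarArcs lo mid hi o 0) ∨ ∃ m q, q 0 = y ∧ Aligned f o n lo mid hi m q

section Base

variable {f : ℕ → ℝ × ℝ} {o n : ℕ} {lo mid hi : ℕ → ℕ}

/-- The vertices are those of the polygon expected around the innermost points: two (degenerate),
three or four. -/
theorem arcSystem_base (hon : o ≤ n) (hn : n ≤ o + 2)
    (h : ∀ i, o + i < n → EarArcs lo mid hi (o + i) i) :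
    ArcSystem (Set.Ico o n) (n - o + 2) lo mid hi := by
  obtain rfl | rfl | rfl : n = o ∨ n = o + 1 ∨ n = o + 2 := by omega
  · have e : Set.Ico n n = ∅ := by simp
    rw [e, Nat.sub_self]
    exact ⟨fun t ht => absurd ht (Set.notMem_empty t), fun a b c h1 h2 h3 => by omega⟩
  · have e : Set.Ico o (o + 1) = {o} := by ext; simp; omega
    rw [e, show o + 1 - o + 2 = 3 by omega]
    obtain ⟨h1, h2, h3⟩ := h 0 (by omega)
    exact arcSystem_singleton h1 h2 h3
  · have e : Set.Ico o (o + 2) = (fun i => o + i) '' Set.Iio 2 ∪ ∅ := by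
      ext t
      simp only [Set.mem_Ico, Set.union_empty, Set.mem_image, Set.mem_Iio]
      exact ⟨fun ht => ⟨t - o, by omega, by omega⟩, by rintro ⟨i, hi, rfl⟩; omega⟩
    rw [e, show o + 2 - o + 2 = 2 * 2 by omega]
    exact arcSystem_empty.double le_rfl (fun t ht => absurd ht (Set.notMem_empty t))
      fun i hi => h i (by omega)

theorem verified_base (hn : n ≤ o + 2) (h : ∀ i, o + i < n → EarArcs lo mid hi (o + i) i) :
    Verified f o n lo mid hi where
  nested := by
    refine isNestedAlmostConvex_of_ncard_le_two ((Set.finite_Ico o n).image f)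
      ((Set.ncard_image_le (Set.finite_Ico o n)).trans ?_)
    rw [← Finset.coe_Ico, Set.ncard_coe_finset, Nat.card_Ico]
    omega
  hull := ⟨Set.Ico o n, le_rfl, subset_convexHull ℝ _, fun t ht => ⟨t - o, by
    rw [Set.mem_Ico] at ht
    have := h (t - o) (by omega)
    rwa [show o + (t - o) = t by omega] at this⟩⟩

/-- If `x` were not extreme, all extreme points would be `y`, and the segment, as the closed hull of
its extreme points, would be `{y}`. -/
theorem hullVertices_pair {x y : ℝ × ℝ} (hxy : x ≠ y) : hullVertices {x, y} = {x, y} := by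
  refine (hullVertices_subset _).antisymm ?_
  have key : ∀ x y : ℝ × ℝ, x ≠ y → x ∈ hullVertices {x, y} := by
    intro x y hxy
    by_contra hx
    have hfin : ({x, y} : Set (ℝ × ℝ)).Finite := by simp
    have hsub : hullVertices {x, y} ⊆ {y} := by
      intro z hz
      rcases hullVertices_subset _ hz with rfl | rfl
      · exact (hx hz).elim
      · rfl
    have hx' : x ∈ convexHull ℝ (hullVertices {x, y}) := by
      have h1 : x ∈ convexHull ℝ {x, y} := subset_convexHull ℝ _ (by simp)
      have hc : IsCompact (convexHull ℝ ({x, y} : Set (ℝ × ℝ))) := hfin.isCompact_convexHull (𝕜 := ℝ)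
      have h2 := closure_convexHull_extremePoints hc (convex_convexHull ℝ _)
      rw [← h2] at h1
      have hcl : IsClosed (convexHull ℝ (hullVertices {x, y})) :=
        ((hfin.subset (hullVertices_subset _)).isCompact_convexHull (𝕜 := ℝ)).isClosed
      rwa [← hullVertices, hcl.closure_eq] at h1
    have := convexHull_mono hsub hx'
    rw [convexHull_singleton] at this
    exact hxy this
  rintro z (rfl | rfl)
  · exact key z y hxy
  · rw [Set.pair_comm]
    exact key z x hxy.symm

/-- Two innermost points count as a polygon with two vertices, for which convexity is vacuous. A
single point is treated apart: its triangle does not arise by doubling. -/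
theorem expected_base (hn : n ≤ o + 2) (hon : o < n) (hf : Set.InjOn f (Set.Ico o n))
    (h : ∀ i, o + i < n → EarArcs lo mid hi (o + i) i) : Expected f o n lo mid hi (f o) := by
  obtain rfl | rfl : n = o + 1 ∨ n = o + 2 := by omega
  · exact Or.inl ⟨rfl, h 0 (by omega)⟩
  · right
    have hne : f o ≠ f (o + 1) := fun e => by
      have := hf ⟨le_rfl, by omega⟩ ⟨by omega, by omega⟩ e
      omega
    have himg : f '' Set.Ico o (o + 2) = {f o, f (o + 1)} := by
      have : Set.Ico o (o + 2) = {o, o + 1} := by ext; simp; omega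
      rw [this, Set.image_pair]
    have hmod : ∀ i, i < 2 → i % 2 = i := fun i hi => Nat.mod_eq_of_lt hi
    refine ⟨2, fun i => f (o + i % 2), rfl, by omega, ⟨by simp, fun i j k h1 h2 h3 => by omega⟩,
      ?_, ?_, ?_⟩
    · intro i hi j hj e
      simp only [Set.mem_Iio] at hi hj
      simp only [hmod i hi, hmod j hj] at e
      have := hf ⟨by omega, by omega⟩ ⟨by omega, by omega⟩ e
      omega
    · rw [HullSlice.range_eq f o (by omega : 0 < 2), himg, hullVertices_pair hne]
    · intro t ht
      rw [Set.mem_Ico] at ht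
      have := h (t - o) (by omega)
      rw [show o + (t - o) = t by omega] at this
      refine Or.inl ⟨t - o, this, ?_⟩
      simp only [hmod _ (show t - o < 2 by omega)]
      congr 1
      omega

end Base

section Step

variable {f : ℕ → ℝ × ℝ} {b h n s : ℕ} {lo mid hi lo' mid' hi' : ℕ → ℕ}

/-- The new arcs when a layer with `h` vertices, counted from the `s`-th one, is added. -/
structure ArcUpdate (b h n s : ℕ) (lo mid hi lo' mid' hi' : ℕ → ℕ) : Prop where
  old : ∀ t ∈ Set.Ico (b + h) n, lo' t = 2 * lo t ∧ mid' t = 2 * mid t ∧ hi' t = 2 * hi t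
  new : ∀ i < h, EarArcs lo' mid' hi' (b + (s + i) % h) i

theorem image_add_mod (hh : 0 < h) (b s : ℕ) :
    (fun i => b + (s + i) % h) '' Set.Iio h = Set.Ico b (b + h) := by
  ext t
  simp only [Set.mem_image, Set.mem_Iio, Set.mem_Ico]
  constructor
  · rintro ⟨i, _, rfl⟩
    have := Nat.mod_lt (s + i) hh
    omega
  · intro ht
    refine ⟨(t - b + (h - s % h)) % h, Nat.mod_lt _ hh, ?_⟩
    have h1 : s % h < h := Nat.mod_lt _ hh
    rw [Nat.add_mod_mod, ← Nat.mod_add_mod,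
      show s % h + (t - b + (h - s % h)) = t - b + h by omega, Nat.add_mod_right,
      Nat.mod_eq_of_lt (by omega)]
    omega

theorem ArcUpdate.arcSystem (hu : ArcUpdate b h n s lo mid hi lo' mid' hi') (hh : 3 ≤ h)
    (hn : b + 2 * h = n + 2) (ha : ArcSystem (Set.Ico (b + h) n) h lo mid hi) :
    ArcSystem (Set.Ico b n) (n - b + 2) lo' mid' hi' := by
  have := ha.double (by omega) (g := fun i => b + (s + i) % h) hu.old hu.new
  rw [image_add_mod (by omega)] at this
  rw [show n - b + 2 = 2 * h by omega]
  convert this using 1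
  ext t
  simp only [Set.mem_union, Set.mem_Ico]
  omega

/-- The new layer spans everything and its points have ear arcs, so it serves as the set `J` of the
next round. -/
theorem Verified.step (hv : Verified f (b + h) n lo mid hi)
    (hu : ArcUpdate b h n s lo mid hi lo' mid' hi') (hh : 3 ≤ h) (hn : b + 2 * h = n + 2)
    (hs : 1 ≤ s) (ha : ArcSystem (Set.Ico (b + h) n) h lo mid hi)
    (hf : Set.InjOn f (Set.Ico b n))
    (hpos : ∀ i j k, i < j → j < k → k < h → 0 < orient (f (b + i)) (f (b + j)) (f (b + k)))
    (htest : ∀ t ∈ Set.Ico (b + h) n,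
      PassesTests (fun i => f (b + i % h)) s (lo t) (mid t) (hi t) (f t)) :
    Verified f b n lo' mid' hi' := by
  obtain ⟨J, hJ, hJ', hear⟩ := hv.hull
  have hr := HullSlice.range_eq f b (show 0 < h by omega)
  have hunion : f '' Set.Ico b (b + h) ∪ f '' Set.Ico (b + h) n = f '' Set.Ico b n := by
    rw [← Set.image_union, Set.Ico_union_Ico_eq_Ico (by omega) (by omega)]
  have hdisj : Disjoint (f '' Set.Ico b (b + h)) (f '' Set.Ico (b + h) n) := by
    rw [Set.disjoint_left]
    rintro _ ⟨i, hi, rfl⟩ ⟨j, hj, e⟩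
    rw [Set.mem_Ico] at hi hj
    have := hf ⟨by omega, by omega⟩ ⟨by omega, by omega⟩ e
    omega
  obtain ⟨h1, h2⟩ := isNestedAlmostConvex_of_tests
    (convexCycle_of_slice (f := fun i => f (b + i)) hpos) hh hs (Set.finite_Ico (b + h) n) ha htest
    hv.nested (by rwa [hr]) hJ hJ' hear
  rw [hr, hunion] at h1 h2
  refine ⟨h1, Set.Ico b (b + h), Set.Ico_subset_Ico le_rfl (by omega), h2, ?_⟩
  rw [← image_add_mod (by omega) b s]
  rintro _ ⟨i, hi, rfl⟩
  exact ⟨i, hu.new i hi⟩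

/-- Comparing sizes gives `h = 2 * m`, so the results on ears apply. Around a single point no
particular shift is needed. -/
theorem Expected.exists_shift {y : ℝ × ℝ} (he : Expected f (b + h) n lo mid hi y)
    (hn : b + 2 * h = n + 2) (hh : 3 ≤ h) {p : ℕ → ℝ × ℝ}
    (hp : Pierced h p (f '' Set.Ico (b + h) n)) : n = b + h + 1 ∨
      ∃ s, 1 ≤ s ∧ s ≤ h ∧ orient (p (s - 1)) (p (s + 1)) y < 0 ∧
        orient (p s) (p (s + 2)) y < 0 := by
  rcases he with ⟨h1, -⟩ | ⟨m, q, rfl, hq⟩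
  · exact Or.inl h1
  · right
    obtain rfl : h = 2 * m := by have := hq.card; omega
    exact hp.exists_double_ear hq.cycle hq.injOn hq.hullVertices_eq

theorem Expected.passesTests {y : ℝ × ℝ} (he : Expected f (b + h) n lo mid hi y)
    (hn : b + 2 * h = n + 2) (hh : 3 ≤ h) {p : ℕ → ℝ × ℝ}
    (hp : Pierced h p (f '' Set.Ico (b + h) n)) (hs : 1 ≤ s)
    (hsy : n = b + h + 1 ∨ (orient (p (s - 1)) (p (s + 1)) y < 0 ∧
      orient (p s) (p (s + 2)) y < 0)) :
    ∀ t ∈ Set.Ico (b + h) n, PassesTests p s (lo t) (mid t) (hi t) (f t) := by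
  intro t ht
  rcases he with ⟨h1, e1, e2, e3⟩ | ⟨m, q, rfl, hq⟩
  · have ht' := ht
    rw [Set.mem_Ico] at ht
    obtain rfl : t = b + h := by omega
    obtain rfl : h = 3 := by omega
    rw [e1, e2, e3]
    exact hp.passesTests_three ⟨_, ht', rfl⟩ hs
  · have hc := hq.card
    obtain ⟨r1, r2⟩ := hsy.resolve_left (by omega)
    obtain rfl : h = 2 * m := by omega
    rcases hq.arcs t ht with ⟨i, ⟨e1, e2, e3⟩, e4⟩ | ⟨hv, hP, a, b', c, ⟨e1, e2, e3⟩, hb, hpass⟩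
    · rw [e1, e2, e3, e4]
      exact hp.passesTests_hullVertex hq.cycle hq.injOn hq.hullVertices_eq hs r1 r2 i
    · rw [e1, e2, e3]
      exact hp.passesTests_double hP hq.injOn hq.hullVertices_eq hs r1 r2 hv hb hpass

/-- The layer just tested, counted from its vertex `s`, becomes the inner polygon of the next round.
The passed tests are kept as facts about this polygon, ready for `Pierced.passesTests_double`. -/
theorem expected_step (hu : ArcUpdate b h n s lo mid hi lo' mid' hi') (hh : 3 ≤ h)
    (hn : b + 2 * h = n + 2) (hs : 1 ≤ s) (ha : ArcSystem (Set.Ico (b + h) n) h lo mid hi)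
    (hf : Set.InjOn f (Set.Ico b n)) (hslice : HullSlice f b h n)
    (hnac : IsNestedAlmostConvex (f '' Set.Ico b n))
    (htest : ∀ t ∈ Set.Ico (b + h) n,
      PassesTests (fun i => f (b + i % h)) s (lo t) (mid t) (hi t) (f t)) :
    Expected f b n lo' mid' hi' (f (b + s % h)) := by
  have hP := hslice.pierced hh (by omega) hf hnac
  have hq := hslice.cycle.shift s
  refine Or.inr ⟨h, fun i => f (b + (s + i) % h), rfl, by omega, hq, ?_, ?_, ?_⟩
  · intro i hi j hj e
    by_contra hne
    rw [Set.mem_Iio] at hi hj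
    rcases Nat.lt_or_gt_of_ne hne with h1 | h1
    · exact hq.ne hh h1 (by omega) e
    · exact hq.ne hh h1 (by omega) e.symm
  · rw [hslice.hullVertices_eq hh (by omega), hq.range_eq (by omega),
      ← image_add_mod (by omega) b s, Set.image_image]
  · rw [hslice.peel_eq hh (by omega) hf]
    intro t ht
    rw [Set.mem_Ico] at ht
    by_cases htb : t < b + h
    · left
      obtain ⟨i, hi, rfl⟩ : t ∈ (fun i => b + (s + i) % h) '' Set.Iio h := by
        rw [image_add_mod (by omega)]
        exact ⟨ht.1, htb⟩
      exact ⟨i, hu.new i hi, rfl⟩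
    · right
      have ht' : t ∈ Set.Ico (b + h) n := ⟨by omega, ht.2⟩
      have hb := ha.bounds t ht'
      exact ⟨⟨t, ht', rfl⟩, hP.shift s, lo t, mid t, hi t, hu.old t ht', hb,
        (hslice.cycle.passesTests_shift_iff (by omega) hs (by omega) (by omega)).mpr (htest t ht')⟩

end Step

namespace RealRAM

/-! ## The test of one layer

The next layer is in the cells `b, …, b + h - 1` of the array `2`, where `h` is in the array `15`
and `b` in the array `16`. The array `13` lists these cells three times. The arcs are in the
arrays `10`, `11` and `12`; the polygon is read from the vertex `s` on, where `s` is in the array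
`14`. -/

/-- Clear the answer unless a condition holds. -/
def demand (c : Test) : Program := .branch c .skip (.setVar 1 (.const 0))

/-- The number of the point at a vertex of the polygon. -/
def NatExp.vertex (e : NatExp) : NatExp := .read 2 (.read 13 e)

/-- List the cells of the layer. -/
def fillPolygon : Program :=
  .seq (.setVar 4 (.const 0))
    (.loop (.natLt (.var 4) (.add (.var 15) (.add (.var 15) (.var 15))))
      (.seq (.branch (.natLt (.var 4) (.var 15)) (.setNat 13 (.var 4) (.add (.var 16) (.var 4)))
          (.setNat 13 (.var 4) (.read 13 (.sub (.var 4) (.var 15)))))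
        (.setVar 4 (.add (.var 4) (.const 1)))))

/-- Three left turns. -/
def Test.convexAt (e : NatExp) : Test :=
  .and (.left (.vertex e) (.vertex (.add e (.const 1))) (.vertex (.add e (.const 2))))
    (.and (.left (.vertex (.const 0)) (.vertex (.add e (.const 1))) (.vertex (.add e (.const 2))))
      (.left (.vertex (.const 0)) (.vertex (.const 1)) (.vertex (.add e (.const 2)))))

/-- Test whether the polygon is convex. -/
def checkConvex : Program :=
  .seq (.setVar 4 (.const 0))
    (.loop (.natLt (.add (.var 4) (.const 2)) (.var 15))
      (.seq (demand (.convexAt (.var 4))) (.setVar 4 (.add (.var 4) (.const 1)))))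

/-- The point in cell `q₀` (array `17`) is in two consecutive ears. -/
def Test.doubleEar : Test :=
  .and (.right (.vertex (.sub (.var 14) (.const 1))) (.vertex (.add (.var 14) (.const 1)))
      (.read 2 (.var 17)))
    (.right (.vertex (.var 14)) (.vertex (.add (.var 14) (.const 2))) (.read 2 (.var 17)))

/-- Find the first vertex of the polygon. -/
def findShift : Program :=
  .seq (.setVar 14 (.const 1))
    (.loop (.and (.natLt (.var 14) (.var 15)) (.not .doubleEar))
      (.setVar 14 (.add (.var 14) (.const 1))))

/-- Three tests for the point in cell `i` (array `4`). -/
def Test.passes : Test :=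
  .and (.right (.vertex (.sub (.add (.var 14) (.read 10 (.var 4))) (.const 1)))
      (.vertex (.add (.var 14) (.read 11 (.var 4)))) (.read 2 (.var 4)))
    (.and (.right (.vertex (.sub (.add (.var 14) (.read 11 (.var 4))) (.const 1)))
      (.vertex (.add (.var 14) (.read 12 (.var 4)))) (.read 2 (.var 4)))
    (.left (.vertex (.add (.var 14) (.read 10 (.var 4))))
      (.vertex (.sub (.add (.var 14) (.read 12 (.var 4))) (.const 1))) (.read 2 (.var 4))))

/-- Multiply an entry by two. -/
def doubleCell (a : ℕ) : Program :=
  .setNat a (.var 4) (.add (.read a (.var 4)) (.read a (.var 4)))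

/-- Test the points inside the layer, and double their arcs. -/
def checkInner : Program :=
  .seq (.setVar 4 (.var 3))
    (.loop (.natLt (.var 4) (.var 0))
      (.seq (demand .passes) (.seq (doubleCell 10) (.seq (doubleCell 11) (.seq (doubleCell 12)
        (.setVar 4 (.add (.var 4) (.const 1))))))))

/-- Set the arcs of the points of the layer. -/
def newArcs : Program :=
  .seq (.setVar 4 (.const 0))
    (.loop (.natLt (.var 4) (.var 15))
      (.seq (.setNat 10 (.read 13 (.add (.var 14) (.var 4))) (.add (.var 4) (.var 4)))
      (.seq (.setNat 11 (.read 13 (.add (.var 14) (.var 4)))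
        (.add (.add (.var 4) (.var 4)) (.const 1)))
      (.seq (.setNat 12 (.read 13 (.add (.var 14) (.var 4)))
        (.add (.add (.var 4) (.var 4)) (.const 2)))
      (.setVar 4 (.add (.var 4) (.const 1)))))))

/-- Test one layer. -/
def checkLayer : Program :=
  .seq (.setVar 15 (.add (.sub (.var 0) (.var 3)) (.const 2)))
    (.seq (.setVar 16 (.sub (.var 3) (.var 15)))
    (.seq fillPolygon (.seq checkConvex (.seq findShift (.seq checkInner (.seq newArcs
      (.seq (.setVar 17 (.read 13 (.var 14))) (.setVar 3 (.var 16)))))))))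

theorem demand_spec (c : Test) (s : State) (hs : s.nats 1 0 ≤ 1) :
    Computes (demand c) s (5 + c.cost) fun s' => Frame [1] s s' ∧ s'.nats 1 0 ≤ 1 ∧
      (s'.nats 1 0 = 1 ↔ s.nats 1 0 = 1 ∧ c.Holds s) := by
  refine (Computes.branch (fun hc => Computes.skip ?_) fun hc => Computes.setNat ?_).mono
    (by simp [NatExp.cost]; omega) fun _ h => h
  · exact ⟨Frame.refl _ s, hs, by simp [hc]⟩
  · exact ⟨(Frame.refl _ s).writeNat (by simp) _ _, by simp [NatExp.eval],
      by simp [NatExp.eval, hc]⟩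

/-- Without division on the machine, periodic indices are stored instead. Three periods suffice: the
shift and the ends of arcs are at most `h`. -/
theorem fillPolygon_spec (s : State) {h b : ℕ} (hh : s.nats 15 0 = h) (hb : s.nats 16 0 = b)
    (h1 : 1 ≤ h) : Computes fillPolygon s (60 * (3 * h + 1)) fun s' => Frame [4, 13] s s' ∧
      ∀ j < 3 * h, s'.nats 13 j = b + j % h := by
  let I : ℕ → State → Prop := fun i s' => Frame [4, 13] s s' ∧ s'.nats 4 0 = i ∧
    ∀ j < i, s'.nats 13 j = b + j % h
  refine (Computes.setNat_seq (Computes.count (I := I) (N := 3 * h) (j₀ := 0) (c := 40)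
    (Nat.zero_le _) ?_ ?_ ?_)).mono ?_ ?_
  · exact ⟨(Frame.refl _ s).writeNat (by simp) _ _, by simp [NatExp.eval], fun j hj => by omega⟩
  · rintro i s' ⟨hF, h4, -⟩
    simp only [Test.Holds, NatExp.eval, h4, hF.2 15 (by simp), hh]
    omega
  · rintro i s' hi ⟨hF, h4, hP⟩
    have h15 : s'.nats 15 0 = h := by rw [hF.2 15 (by simp), hh]
    have h16 : s'.nats 16 0 = b := by rw [hF.2 16 (by simp), hb]
    refine (Computes.seq (T := 25) (T' := 8) (Q := fun s1 => s1 = s'.writeNat 13 i (b + i % h))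
      ((Computes.branch (T := 8) (T' := 10) (fun hc => ?_) fun hc => ?_).mono
        (by simp [Test.cost, NatExp.cost]) fun _ h => h) ?_).mono (by omega) fun _ h => h
    · refine (Computes.setNat ?_).mono (by simp [NatExp.cost]) fun _ h => h
      simp only [Test.Holds, NatExp.eval, h4, h15] at hc
      simp only [NatExp.eval, h4, h16, Nat.mod_eq_of_lt hc]
    · refine (Computes.setNat ?_).mono (by simp [NatExp.cost]) fun _ h => h
      simp only [Test.Holds, NatExp.eval, h4, h15] at hc
      simp only [NatExp.eval, h4, h15, hP (i - h) (by omega)]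
      rw [Nat.mod_eq_sub_mod (a := i) (by omega)]
    · rintro s1 rfl
      refine (Computes.setNat ?_).mono (by simp [NatExp.cost]) fun _ h => h
      refine ⟨(hF.writeNat (by simp) _ _).writeNat (by simp) _ _, by simp [NatExp.eval, h4], ?_⟩
      intro j hj
      simp only [State.nats_writeNat_of_ne _ _ _ (show 13 ≠ 4 by decide),
        State.nats_writeNat_self, Function.update_apply]
      split_ifs with hji
      · rw [hji]
      · exact hP j (by omega)
  · simp only [NatExp.cost, Test.cost]
    omega
  · rintro s' ⟨hF, -, hP⟩
    exact ⟨hF, hP⟩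

section

variable {s : State} {h b : ℕ}

theorem State.point_vertex (hP : ∀ j < 3 * h, s.nats 13 j = b + j % h) {e : NatExp} {j : ℕ}
    (he : e.eval s = j) (hj : j < 3 * h) :
    s.point ((NatExp.vertex e).eval s) = s.pt (b + j % h) := by
  rw [NatExp.vertex, NatExp.eval, NatExp.eval, he, hP j hj, State.pt]

theorem checkConvex_spec (hh : s.nats 15 0 = h) (h3 : 3 ≤ h)
    (hP : ∀ j < 3 * h, s.nats 13 j = b + j % h) (hs : s.nats 1 0 ≤ 1) :
    Computes checkConvex s (250 * h) fun s' => Frame [1, 4] s s' ∧ s'.nats 1 0 ≤ 1 ∧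
      (s'.nats 1 0 = 1 ↔ s.nats 1 0 = 1 ∧ ∀ i, i + 2 < h →
        0 < orient (s.pt (b + i)) (s.pt (b + (i + 1))) (s.pt (b + (i + 2))) ∧
        0 < orient (s.pt (b + 0)) (s.pt (b + (i + 1))) (s.pt (b + (i + 2))) ∧
        0 < orient (s.pt (b + 0)) (s.pt (b + 1)) (s.pt (b + (i + 2)))) := by
  let C : ℕ → Prop := fun i =>
    0 < orient (s.pt (b + i)) (s.pt (b + (i + 1))) (s.pt (b + (i + 2))) ∧
    0 < orient (s.pt (b + 0)) (s.pt (b + (i + 1))) (s.pt (b + (i + 2))) ∧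
    0 < orient (s.pt (b + 0)) (s.pt (b + 1)) (s.pt (b + (i + 2)))
  let I : ℕ → State → Prop := fun i s' => Frame [1, 4] s s' ∧ s'.nats 4 0 = i ∧
    s'.nats 1 0 ≤ 1 ∧ (s'.nats 1 0 = 1 ↔ s.nats 1 0 = 1 ∧ ∀ j < i, C j)
  refine (Computes.setNat_seq (Computes.count (I := I) (N := h - 2) (j₀ := 0) (c := 220)
    (Nat.zero_le _) ?_ ?_ ?_)).mono ?_ ?_
  · exact ⟨(Frame.refl _ s).writeNat (by simp) _ _, by simp [NatExp.eval], by simpa using hs,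
      by simp⟩
  · rintro i s' ⟨hF, h4, -⟩
    simp only [Test.Holds, NatExp.eval, h4, hF.2 15 (by simp), hh]
    omega
  · rintro i s' hi ⟨hF, h4, h1, hC⟩
    have hP' : ∀ j < 3 * h, s'.nats 13 j = b + j % h := by rwa [hF.2 13 (by simp)]
    have hpt : s'.pt = s.pt := by
      funext j
      rw [State.pt, State.pt, State.point_eq_of_reals_eq hF.1, hF.2 2 (by simp)]
    have hv : ∀ e : NatExp, ∀ j < h, e.eval s' = j →
        s'.point ((NatExp.vertex e).eval s') = s.pt (b + j) := by
      intro e j hj he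
      rw [State.point_vertex hP' he (by omega), Nat.mod_eq_of_lt hj, hpt]
    have hiff : (Test.convexAt (.var 4)).Holds s' ↔ C i := by
      simp only [Test.convexAt, Test.Holds, Test.holds_left]
      rw [hv (.var 4) i (by omega) (by simp [NatExp.eval, h4]),
        hv (.add (.var 4) (.const 1)) (i + 1) (by omega) (by simp [NatExp.eval, h4]),
        hv (.add (.var 4) (.const 2)) (i + 2) (by omega) (by simp [NatExp.eval, h4]),
        hv (.const 0) 0 (by omega) (by simp [NatExp.eval]),
        hv (.const 1) 1 (by omega) (by simp [NatExp.eval])]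
    refine ((demand_spec _ s' h1).seq fun s1 ⟨hF1, q1, q2⟩ => Computes.setNat ?_).mono
      (by simp [Test.cost, NatExp.cost, Test.convexAt, Test.left, RealExp.orient, RealExp.cost,
        NatExp.vertex]) fun _ h => h
    refine ⟨(hF.trans (hF1.mono (by simp))).writeNat (by simp) _ _,
      by simp [NatExp.eval, hF1.2 4 (by simp), h4], by simpa using q1, ?_⟩
    rw [State.nats_writeNat_of_ne _ _ _ (by decide), q2, hiff, hC, Nat.forall_lt_succ_right,
      and_assoc]
  · simp only [NatExp.cost, Test.cost]
    omega
  · rintro s' ⟨hF, -, h1, hC⟩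
    refine ⟨hF, h1, hC.trans (and_congr_right fun _ => forall_congr' fun i => ?_)⟩
    rw [show i < h - 2 ↔ i + 2 < h by omega]

/-- If no shift works, an arbitrary one is delivered; soundness holds for every shift. -/
theorem findShift_spec (hh : s.nats 15 0 = h) (h3 : 3 ≤ h)
    (hP : ∀ j < 3 * h, s.nats 13 j = b + j % h) {p : ℕ → ℝ × ℝ}
    (hp : p = fun i => s.pt (b + i % h)) {C : ℕ → Prop}
    (hC : C = fun r => orient (p (r - 1)) (p (r + 1)) (s.pt (s.nats 17 0)) < 0 ∧
      orient (p r) (p (r + 2)) (s.pt (s.nats 17 0)) < 0) :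
    Computes findShift s (150 * h + 100) fun s' => Frame [14] s s' ∧ 1 ≤ s'.nats 14 0 ∧
      s'.nats 14 0 ≤ h ∧ ((∃ r, 1 ≤ r ∧ r ≤ h ∧ C r) → C (s'.nats 14 0)) := by
  let I : State → Prop := fun s' => Frame [14] s s' ∧ 1 ≤ s'.nats 14 0 ∧ s'.nats 14 0 ≤ h ∧
    ∀ r, 1 ≤ r → r < s'.nats 14 0 → ¬ C r
  have hear : ∀ s', I s' → (Test.doubleEar.Holds s' ↔ C (s'.nats 14 0)) := by
    rintro s' ⟨hF, h1, h2, -⟩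
    have hP' : ∀ j < 3 * h, s'.nats 13 j = b + j % h := by rwa [hF.2 13 (by simp)]
    have hpt : s'.pt = s.pt := by
      funext j
      rw [State.pt, State.pt, State.point_eq_of_reals_eq hF.1, hF.2 2 (by simp)]
    have h17 : s'.point ((NatExp.read 2 (.var 17)).eval s') = s.pt (s.nats 17 0) := by
      rw [← hpt, ← hF.2 17 (by simp)]
      rfl
    have hv : ∀ e : NatExp, ∀ j < 3 * h, e.eval s' = j →
        s'.point ((NatExp.vertex e).eval s') = p j := by
      intro e j hj he
      rw [State.point_vertex hP' he hj, hpt, hp]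
    simp only [Test.doubleEar, Test.Holds, Test.holds_right]
    rw [h17, hv (.var 14) (s'.nats 14 0) (by omega) rfl,
      hv (.add (.var 14) (.const 1)) (s'.nats 14 0 + 1) (by omega) rfl,
      hv (.add (.var 14) (.const 2)) (s'.nats 14 0 + 2) (by omega) rfl,
      hv (.sub (.var 14) (.const 1)) (s'.nats 14 0 - 1) (by omega) rfl, hC]
  refine (Computes.setNat_seq (Computes.loop (I := I) (φ := fun s' => 150 * (h - s'.nats 14 0))
    ?_ ?_)).mono ?_ ?_
  · exact ⟨(Frame.refl _ s).writeNat (by simp) _ _, by simp [NatExp.eval],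
      by simp [NatExp.eval]; omega, by simp [NatExp.eval]; omega⟩
  · rintro s' hI hb
    obtain ⟨hlt, hno⟩ := hb
    rw [Test.Holds, hear s' hI] at hno
    obtain ⟨hF, h1, h2, hr⟩ := hI
    simp only [Test.Holds, NatExp.eval, hF.2 15 (by simp), hh] at hlt
    refine ⟨_, Computes.setNat ⟨⟨hF.writeNat (by simp) _ _, by simp [NatExp.eval], ?_, ?_⟩, ?_⟩⟩
    · simp [NatExp.eval]; omega
    · simp only [NatExp.eval, State.nats_writeNat_self, Function.update_self]
      intro r r1 r2
      by_cases hr' : r = s'.nats 14 0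
      · rw [hr']; exact hno
      · exact hr r r1 (by omega)
    · simp [NatExp.eval, Test.cost, NatExp.cost, Test.doubleEar, Test.right, RealExp.orient,
        RealExp.cost, NatExp.vertex]
      omega
  · simp [NatExp.eval, Test.cost, NatExp.cost, Test.doubleEar, Test.right, RealExp.orient,
        RealExp.cost, NatExp.vertex]
    omega
  · rintro s' ⟨hI, hb⟩
    have he := hear s' hI
    obtain ⟨hF, h1, h2, hr⟩ := hI
    refine ⟨hF, h1, h2, ?_⟩
    rintro ⟨r, r1, r2, hCr⟩
    by_cases hlt : s'.nats 14 0 < h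
    · by_contra hno
      refine hb ⟨?_, fun h => hno (he.mp h)⟩
      simpa [Test.Holds, NatExp.eval, hF.2 15 (by simp), hh] using hlt
    · obtain rfl : r = s'.nats 14 0 := by
        by_contra hne
        exact hr r r1 (by omega) hCr
      exact hCr

theorem doubleCell_exec (a i : ℕ) {s : State} (hi : s.nats 4 0 = i) :
    (doubleCell a).exec s = s.writeNat a i (2 * s.nats a i) := by
  simp only [doubleCell, Program.exec, NatExp.eval, hi, two_mul]

/-- Each point is tested with its old arcs, which refer to the polygon at hand; the doubled ones are
for the next polygon outwards. -/
theorem checkInner_spec {o n : ℕ} (h3 : 3 ≤ h)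
    (hP : ∀ j < 3 * h, s.nats 13 j = b + j % h) (hs : s.nats 1 0 ≤ 1) (ho : s.nats 3 0 = o)
    (hn : s.nats 0 0 = n) (hon : o ≤ n) {k : ℕ} (hk : s.nats 14 0 = k) (hk1 : 1 ≤ k) (hkh : k ≤ h)
    (hbd : ∀ t ∈ Set.Ico o n, s.nats 10 t < s.nats 11 t ∧ s.nats 11 t < s.nats 12 t ∧
      s.nats 12 t ≤ h) :
    Computes checkInner s (400 * (n - o + 1)) fun s' => Frame [1, 4, 10, 11, 12] s s' ∧
      s'.nats 1 0 ≤ 1 ∧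
      (s'.nats 1 0 = 1 ↔ s.nats 1 0 = 1 ∧ ∀ t ∈ Set.Ico o n,
        PassesTests (fun i => s.pt (b + i % h)) k (s.nats 10 t) (s.nats 11 t) (s.nats 12 t)
          (s.pt t)) ∧
      ∀ t ∈ Set.Ico o n, s'.nats 10 t = 2 * s.nats 10 t ∧ s'.nats 11 t = 2 * s.nats 11 t ∧
        s'.nats 12 t = 2 * s.nats 12 t := by
  let C : ℕ → Prop := fun t => PassesTests (fun i => s.pt (b + i % h)) k (s.nats 10 t)
    (s.nats 11 t) (s.nats 12 t) (s.pt t)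
  let I : ℕ → State → Prop := fun i s' => Frame [1, 4, 10, 11, 12] s s' ∧ o ≤ i ∧ s'.nats 4 0 = i ∧
    s'.nats 1 0 ≤ 1 ∧ (s'.nats 1 0 = 1 ↔ s.nats 1 0 = 1 ∧ ∀ j, o ≤ j → j < i → C j) ∧
    (∀ t, o ≤ t → t < i → s'.nats 10 t = 2 * s.nats 10 t ∧ s'.nats 11 t = 2 * s.nats 11 t ∧
        s'.nats 12 t = 2 * s.nats 12 t) ∧
    (∀ t, i ≤ t → s'.nats 10 t = s.nats 10 t ∧ s'.nats 11 t = s.nats 11 t ∧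
        s'.nats 12 t = s.nats 12 t)
  refine (Computes.setNat_seq (Computes.count (I := I) (N := n) (j₀ := o) (c := 350)
    hon ?_ ?_ ?_)).mono ?_ ?_
  · exact ⟨(Frame.refl _ s).writeNat (by simp) _ _, le_rfl, by simp [NatExp.eval, ho],
      by simpa using hs, by simp; omega, fun t _ _ => by omega, by simp⟩
  · rintro i s' ⟨hF, -, h4, -⟩
    simp only [Test.Holds, NatExp.eval, h4, hF.2 0 (by simp), hn]
  · rintro i s' hi ⟨hF, hoi, h4, h1, hC, hdone, htodo⟩
    have hP' : ∀ j < 3 * h, s'.nats 13 j = b + j % h := by rwa [hF.2 13 (by simp)]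
    have hpt : s'.pt = s.pt := by
      funext j
      rw [State.pt, State.pt, State.point_eq_of_reals_eq hF.1, hF.2 2 (by simp)]
    have hv : ∀ e : NatExp, ∀ j < 3 * h, e.eval s' = j →
        s'.point ((NatExp.vertex e).eval s') = s.pt (b + j % h) := by
      intro e j hj he
      rw [State.point_vertex hP' he hj, hpt]
    have hi' : s'.point ((NatExp.read 2 (.var 4)).eval s') = s.pt i := by
      rw [← hpt]
      simp only [NatExp.eval, h4, State.pt]
    obtain ⟨e10, e11, e12⟩ := htodo i le_rfl
    obtain ⟨b1, b2, b3⟩ := hbd i ⟨hoi, hi⟩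
    have h14 : s'.nats 14 0 = k := by rw [hF.2 14 (by simp), hk]
    have hiff : Test.passes.Holds s' ↔ C i := by
      simp only [Test.passes, Test.Holds, Test.holds_right, Test.holds_left]
      rw [hi', hv (.sub (.add (.var 14) (.read 10 (.var 4))) (.const 1)) (k + s.nats 10 i - 1)
          (by omega) (by simp only [NatExp.eval, h4, e10, h14]),
        hv (.add (.var 14) (.read 11 (.var 4))) (k + s.nats 11 i)
          (by omega) (by simp only [NatExp.eval, h4, e11, h14]),
        hv (.sub (.add (.var 14) (.read 11 (.var 4))) (.const 1)) (k + s.nats 11 i - 1)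
          (by omega) (by simp only [NatExp.eval, h4, e11, h14]),
        hv (.add (.var 14) (.read 12 (.var 4))) (k + s.nats 12 i)
          (by omega) (by simp only [NatExp.eval, h4, e12, h14]),
        hv (.add (.var 14) (.read 10 (.var 4))) (k + s.nats 10 i)
          (by omega) (by simp only [NatExp.eval, h4, e10, h14]),
        hv (.sub (.add (.var 14) (.read 12 (.var 4))) (.const 1)) (k + s.nats 12 i - 1)
          (by omega) (by simp only [NatExp.eval, h4, e12, h14])]
      exact Iff.rfl
    refine ((demand_spec _ s' h1).seq fun s1 ⟨hF1, q1, q2⟩ => Computes.straight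
      (by simp [Program.IsStraight, doubleCell]) ?_).mono
      (by simp [Test.cost, NatExp.cost, Test.passes, Test.left, Test.right, RealExp.orient,
        RealExp.cost, NatExp.vertex, doubleCell, Program.maxCost]) fun _ h => h
    have g4 : s1.nats 4 0 = i := by rw [hF1.2 4 (by simp), h4]
    simp only [Program.exec]
    rw [doubleCell_exec 10 i g4, doubleCell_exec 11 i (by simpa using g4),
      doubleCell_exec 12 i (by simpa using g4)]
    have g10 := hF1.2 10 (by simp)
    have g11 := hF1.2 11 (by simp)
    have g12 := hF1.2 12 (by simp)
    refine ⟨((((hF.trans (hF1.mono (by simp))).writeNat (by simp) _ _).writeNat (by simp) _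
      _).writeNat (by simp) _ _).writeNat (by simp) _ _, by omega, by simp [NatExp.eval, g4],
      by simpa using q1, ?_, ?_, ?_⟩
    · simp (disch := decide) only [State.nats_writeNat_of_ne]
      rw [q2, hiff, hC, and_assoc]
      refine and_congr_right fun _ => ⟨fun ⟨c1, c2⟩ j j1 j2 => ?_, fun c =>
        ⟨fun j j1 j2 => c j j1 (by omega), c i hoi (by omega)⟩⟩
      by_cases hji : j = i
      · rw [hji]; exact c2
      · exact c1 j j1 (by omega)
    · intro t t1 t2
      simp (disch := decide) only [State.nats_writeNat_of_ne, State.nats_writeNat_self,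
        Function.update_apply, g10, g11, g12, e10, e11, e12]
      split_ifs with hti
      · rw [hti]; exact ⟨rfl, rfl, rfl⟩
      · exact hdone t t1 (by omega)
    · intro t t1
      simp (disch := decide) only [State.nats_writeNat_of_ne, State.nats_writeNat_self,
        Function.update_apply, g10, g11, g12]
      rw [if_neg (by omega), if_neg (by omega), if_neg (by omega)]
      exact htodo t (by omega)
  · simp only [NatExp.cost, Test.cost]
    omega
  · rintro s' ⟨hF, -, -, h1, hC, hdone, -⟩
    refine ⟨hF, h1, hC.trans (and_congr_right fun _ => ?_), fun t ht => hdone t ht.1 ht.2⟩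
    exact forall_congr' fun t => ⟨fun c ht => c ht.1 ht.2, fun c t1 t2 => c ⟨t1, t2⟩⟩

theorem add_mod_inj {k i j : ℕ} (hi : i < h) (hj : j < h) (e : (k + i) % h = (k + j) % h) :
    i = j :=
  Nat.ModEq.eq_of_lt_of_lt (Nat.ModEq.add_left_cancel' k e) hi hj

theorem newArcs_spec (hh : s.nats 15 0 = h) (h1 : 1 ≤ h)
    (hP : ∀ j < 3 * h, s.nats 13 j = b + j % h) {k : ℕ} (hk : s.nats 14 0 = k) (hkh : k ≤ h) :
    Computes newArcs s (100 * (h + 1)) fun s' => Frame [4, 10, 11, 12] s s' ∧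
      (∀ i < h, EarArcs (s'.nats 10) (s'.nats 11) (s'.nats 12) (b + (k + i) % h) i) ∧
      ∀ t, b + h ≤ t → s'.nats 10 t = s.nats 10 t ∧ s'.nats 11 t = s.nats 11 t ∧
        s'.nats 12 t = s.nats 12 t := by
  let I : ℕ → State → Prop := fun i s' => Frame [4, 10, 11, 12] s s' ∧ s'.nats 4 0 = i ∧
    (∀ j < i, EarArcs (s'.nats 10) (s'.nats 11) (s'.nats 12) (b + (k + j) % h) j) ∧
      ∀ t, b + h ≤ t → s'.nats 10 t = s.nats 10 t ∧ s'.nats 11 t = s.nats 11 t ∧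
        s'.nats 12 t = s.nats 12 t
  refine (Computes.setNat_seq (Computes.count (I := I) (N := h) (j₀ := 0) (c := 80)
    (Nat.zero_le _) ?_ ?_ ?_)).mono ?_ ?_
  · exact ⟨(Frame.refl _ s).writeNat (by simp) _ _, by simp [NatExp.eval], fun j hj => by omega,
      by simp⟩
  · rintro i s' ⟨hF, h4, -⟩
    simp only [Test.Holds, NatExp.eval, h4, hF.2 15 (by simp), hh]
  · rintro i s' hi ⟨hF, h4, hnew, hold⟩
    have hcell : s'.nats 13 (k + i) = b + (k + i) % h := by
      rw [hF.2 13 (by simp), hP _ (by omega)]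
    have h14 : s'.nats 14 0 = k := by rw [hF.2 14 (by simp), hk]
    refine (Computes.straight (by simp [Program.IsStraight]) ?_).mono
      (by simp [NatExp.cost, Program.maxCost]) fun _ h => h
    have hmod : (k + i) % h < h := Nat.mod_lt _ (by omega)
    simp (disch := decide) only [Program.exec, NatExp.eval, State.nats_writeNat_of_ne, h4, h14,
      hcell]
    refine ⟨((((hF.writeNat (by simp) _ _).writeNat (by simp) _ _).writeNat (by simp) _
      _).writeNat (by simp) _ _), by simp, ?_, ?_⟩
    · intro j hj
      simp (disch := decide) only [EarArcs, State.nats_writeNat_of_ne, State.nats_writeNat_self,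
        Function.update_apply]
      by_cases hji : j = i
      · subst hji
        simp only [if_true]
        omega
      · have hne : b + (k + j) % h ≠ b + (k + i) % h := fun e =>
          hji (add_mod_inj (k := k) (h := h) (by omega) hi (by omega))
        rw [if_neg hne, if_neg hne, if_neg hne]
        exact hnew j (by omega)
    · intro t ht
      simp (disch := decide) only [State.nats_writeNat_of_ne, State.nats_writeNat_self,
        Function.update_apply]
      rw [if_neg (by omega), if_neg (by omega), if_neg (by omega)]
      exact hold t ht
  · simp only [NatExp.cost, Test.cost]
    omega
  · rintro s' ⟨hF, -, h5, h6⟩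
    exact ⟨hF, h5, h6⟩

end

end RealRAM

theorem Layered.exists_step {f : ℕ → ℝ × ℝ} {n o : ℕ} (hl : Layered f n o) (ho : 0 < o) :
    ∃ b h, o = b + h ∧ Layered f n b ∧ b + 2 * h = n + 2 ∧ 3 ≤ h ∧
      (GenericSlice f b n → HullSlice f b h n) := by
  cases hl with
  | zero => omega
  | @step b h h1 h2 h3 h4 => exact ⟨b, h, rfl, h1, h2, h3, h4⟩

/-! ### Testing the layers from the inside to the outside -/

namespace RealRAM

/-- The invariant of the loop that tests the layers from the inside to the outside. -/
structure CheckInvariant (f : ℕ → ℝ × ℝ) (n : ℕ) (s : State) : Prop where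
  pt : s.pt = f
  num : s.nats 0 0 = n
  le : s.nats 3 0 ≤ n
  layered : Layered f n (s.nats 3 0)
  answer : s.nats 1 0 ≤ 1
  arcSystem : ArcSystem (Set.Ico (s.nats 3 0) n) (n - s.nats 3 0 + 2) (s.nats 10) (s.nats 11)
    (s.nats 12)
  sound : s.nats 1 0 = 1 → Verified f (s.nats 3 0) n (s.nats 10) (s.nats 11) (s.nats 12)
  complete : IsNestedAlmostConvex (f '' Set.Ico 0 n) → s.nats 1 0 = 1 ∧
    (0 < s.nats 3 0 → Expected f (s.nats 3 0) n (s.nats 10) (s.nats 11) (s.nats 12)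
      (f (s.nats 17 0)))

/-- The arcs are updated in the same way whether or not a test has failed, so `arcSystem` holds on
every run. A positive answer rests on `Verified.step`; for a nested almost convex set `Expected`
says that no test can fail. -/
theorem checkLayer_spec {f : ℕ → ℝ × ℝ} {n : ℕ} (hf : Set.InjOn f (Set.Ico 0 n)) {s : State}
    (hs : CheckInvariant f n s) (ho : 0 < s.nats 3 0) :
    ∃ h, 3 ≤ h ∧ h ≤ s.nats 3 0 ∧ Computes checkLayer s (2000 * h) fun s' =>
      CheckInvariant f n s' ∧ s'.nats 3 0 = s.nats 3 0 - h := by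
  obtain ⟨b, h, hbh, hlay, hcount, h3, hslice⟩ := hs.layered.exists_step ho
  refine ⟨h, h3, by omega, ?_⟩
  have hle := hs.le
  refine (Computes.setNat_seq (Computes.setNat_seq (T := 60 * (3 * h + 1) + (250 * h +
    (150 * h + 100 + (400 * h + (100 * (h + 1) + 30))))) ?_)).mono ?_ fun _ h => h
  swap
  · simp only [NatExp.cost]
    omega
  simp (disch := decide) only [NatExp.eval, State.nats_writeNat_of_ne, State.nats_writeNat_self,
    Function.update_self]
  -- The sizes of layers need not be stored: the number of points inside determines that of the
  -- vertices around them.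
  rw [hs.num, show n - s.nats 3 0 + 2 = h by omega, show s.nats 3 0 - h = b by omega]
  set s0 := (s.writeNat 15 0 h).writeNat 16 0 b with hs0
  have hF0 : Frame [15, 16] s s0 :=
    ((Frame.refl _ s).writeNat (by simp) _ _).writeNat (by simp) _ _
  have e15 : s0.nats 15 0 = h := by simp [hs0]
  have e16 : s0.nats 16 0 = b := by simp [hs0]
  have pt_eq : ∀ {S : List ℕ} {u v : State}, Frame S u v → 2 ∉ S → v.pt = u.pt := by
    intro S u v hF h2
    funext j
    rw [State.pt, State.pt, State.point_eq_of_reals_eq hF.1, hF.2 2 h2]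
  refine (fillPolygon_spec s0 e15 e16 (by omega)).seq fun s1 ⟨hF1, hP1⟩ => ?_
  have f15 : s1.nats 15 0 = h := by rw [hF1.2 15 (by simp), e15]
  have f1 : s1.nats 1 0 = s.nats 1 0 := by rw [hF1.2 1 (by simp), hF0.2 1 (by simp)]
  have hpt1 : s1.pt = f := by rw [pt_eq hF1 (by simp), pt_eq hF0 (by simp), hs.pt]
  refine (checkConvex_spec f15 h3 hP1 (by rw [f1]; exact hs.answer)).seq
    fun s2 ⟨hF2, hans2, hconv⟩ => ?_
  rw [f1, hpt1] at hconv
  have hP2 : ∀ j < 3 * h, s2.nats 13 j = b + j % h := by rwa [hF2.2 13 (by simp)]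
  have g15 : s2.nats 15 0 = h := by rw [hF2.2 15 (by simp), f15]
  have hpt2 : s2.pt = f := by rw [pt_eq hF2 (by simp), hpt1]
  refine (findShift_spec g15 h3 hP2 rfl rfl).seq fun s3 ⟨hF3, hk1, hkh, hear⟩ => ?_
  have hF03 : Frame [1, 4, 13, 14, 15, 16] s s3 := (hF0.mono (by simp)).trans
    ((hF1.mono (by simp)).trans ((hF2.mono (by simp)).trans (hF3.mono (by simp))))
  rw [hpt2, hF2.2 17 (by simp), hF1.2 17 (by simp), hF0.2 17 (by simp)] at hear
  set k := s3.nats 14 0 with hk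
  have hP3 : ∀ j < 3 * h, s3.nats 13 j = b + j % h := by rwa [hF3.2 13 (by simp)]
  have k15 : s3.nats 15 0 = h := by rw [hF3.2 15 (by simp), g15]
  have k1 : s3.nats 1 0 = s2.nats 1 0 := by rw [hF3.2 1 (by simp)]
  have hpt3 : s3.pt = f := by rw [pt_eq hF3 (by simp), hpt2]
  have e10 := hF03.2 10 (by simp)
  have e11 := hF03.2 11 (by simp)
  have e12 := hF03.2 12 (by simp)
  have k3 : s3.nats 3 0 = b + h := by rw [hF03.2 3 (by simp), hbh]
  have k0 : s3.nats 0 0 = n := by rw [hF03.2 0 (by simp), hs.num]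
  have harc : ArcSystem (Set.Ico (b + h) n) h (s.nats 10) (s.nats 11) (s.nats 12) := by
    have := hs.arcSystem
    rwa [hbh, show n - (b + h) + 2 = h by omega] at this
  refine ((checkInner_spec h3 hP3 (by rw [k1]; exact hans2) k3 k0 (by omega) hk.symm hk1 hkh
    (by
      rw [e10, e11, e12]
      intro t ht
      obtain ⟨q1, q2, q3, -⟩ := harc.bounds t ht
      exact ⟨q1, q2, q3⟩)).mono (by
        exact Nat.mul_le_mul_left _ (by omega)) fun _ h => h).seq
    fun s4 ⟨hF4, hans4, htest, hdouble⟩ => ?_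
  rw [k1, hconv, hpt3, e10, e11, e12] at htest
  rw [e10, e11, e12] at hdouble
  have hP4 : ∀ j < 3 * h, s4.nats 13 j = b + j % h := by rwa [hF4.2 13 (by simp)]
  have l15 : s4.nats 15 0 = h := by rw [hF4.2 15 (by simp), k15]
  have l14 : s4.nats 14 0 = k := by rw [hF4.2 14 (by simp)]
  refine (newArcs_spec l15 (by omega) hP4 l14 hkh).seq fun s5 ⟨hF5, hnew, hold⟩ => ?_
  refine (Computes.setNat_seq (Computes.setNat ?_)).mono (by simp [NatExp.cost]) fun _ h => h
  have hF05 : Frame [1, 4, 10, 11, 12, 13, 14, 15, 16] s s5 := (hF03.mono (by simp)).trans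
    ((hF4.mono (by simp)).trans (hF5.mono (by simp)))
  have m13 : s5.nats 13 (s5.nats 14 0) = b + k % h := by
    rw [hF5.2 13 (by simp), hF5.2 14 (by simp), l14, hP4 _ (by omega)]
  have m16 : s5.nats 16 0 = b := by
    rw [hF5.2 16 (by simp), hF4.2 16 (by simp), hF3.2 16 (by simp), hF2.2 16 (by simp),
      hF1.2 16 (by simp), e16]
  have m1 : s5.nats 1 0 = s4.nats 1 0 := by rw [hF5.2 1 (by simp)]
  have hpt5 : s5.pt = f := by rw [pt_eq hF05 (by simp), hs.pt]
  have hu : ArcUpdate b h n k (s.nats 10) (s.nats 11) (s.nats 12) (s5.nats 10) (s5.nats 11)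
      (s5.nats 12) := by
    refine ⟨fun t ht => ?_, hnew⟩
    obtain ⟨q1, q2, q3⟩ := hold t ht.1
    rw [q1, q2, q3]
    exact hdouble t ht
  have hfb : Set.InjOn f (Set.Ico b n) := hf.mono (Set.Ico_subset_Ico (Nat.zero_le _) le_rfl)
  simp (disch := decide) only [NatExp.eval, State.nats_writeNat_of_ne, m13, m16]
  refine ⟨?_, by simp⟩
  constructor
  · simpa using hpt5
  · simp [hF05.2 0 (by simp), hs.num]
  · simp; omega
  · simpa using hlay
  · simp only [State.nats_writeNat_of_ne _ _ _ (show 1 ≠ 3 by decide),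
      State.nats_writeNat_of_ne _ _ _ (show 1 ≠ 17 by decide), m1]
    exact hans4
  · simpa using hu.arcSystem h3 hcount harc
  · simp (disch := decide) only [State.nats_writeNat_of_ne, State.nats_writeNat_self,
      Function.update_self, m1]
    intro h1
    obtain ⟨⟨q1, q2⟩, q3⟩ := htest.mp h1
    have hv := hs.sound q1
    rw [hbh] at hv
    exact hv.step hu h3 hcount hk1 harc hfb
      (orient_pos_of_tests (f := fun i => f (b + i)) q2) q3
  · simp (disch := decide) only [State.nats_writeNat_of_ne, State.nats_writeNat_self,
      Function.update_self, m1]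
    intro hnac
    obtain ⟨h1, he⟩ := hs.complete hnac
    have he := he ho
    rw [hbh] at he
    have hnacb := hlay.isNestedAlmostConvex hf hnac
    have hsl := hslice (.of_isNestedAlmostConvex hf (by omega) hnacb)
    have hpierced := hsl.pierced h3 (by omega) hfb hnacb
    have hpass := he.passesTests hcount h3 hpierced hk1
      ((he.exists_shift hcount h3 hpierced).imp_right hear)
    refine ⟨htest.mpr ⟨⟨h1, fun i hi => ⟨hsl.pos _ _ _ (by omega) (by omega) hi,
      hsl.pos _ _ _ (by omega) (by omega) hi, hsl.pos _ _ _ (by omega) (by omega) hi⟩⟩, hpass⟩,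
      fun _ => expected_step hu h3 hcount hk1 harc hfb hsl hnacb hpass⟩

/-! ### The complete program and its running time -/

/-- Number the points. -/
def listPoints : Program :=
  .loop (.natLt (.var 4) (.var 0))
    (.seq (.setNat 2 (.var 4) (.var 4)) (.setVar 4 (.add (.var 4) (.const 1))))

/-- Set the arcs of the at most two innermost points. -/
def baseArcs : Program :=
  .seq (.setVar 4 (.const 0))
    (.loop (.natLt (.add (.var 3) (.var 4)) (.var 0))
      (.seq (.setNat 10 (.add (.var 3) (.var 4)) (.add (.var 4) (.var 4)))
      (.seq (.setNat 11 (.add (.var 3) (.var 4)) (.add (.add (.var 4) (.var 4)) (.const 1)))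
      (.seq (.setNat 12 (.add (.var 3) (.var 4)) (.add (.add (.var 4) (.var 4)) (.const 2)))
      (.setVar 4 (.add (.var 4) (.const 1)))))))

/-- Test all layers. -/
def checkAll : Program :=
  .seq baseArcs (.seq (.setVar 17 (.var 3)) (.seq (.setVar 1 (.const 1))
    (.loop (.natLt (.const 0) (.var 3)) checkLayer)))

/-- Decide whether the points are a nested almost convex set. -/
def decideNested : Program :=
  .seq listPoints (.seq peelAll (.branch (.natLt (.var 9) (.const 1)) checkAll .skip))

theorem listPoints_spec (s : State) {n : ℕ} (hn : s.nats 0 0 = n) (h4 : s.nats 4 0 = 0) :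
    Computes listPoints s (30 * (n + 1)) fun s' => Frame [2, 4] s s' ∧
      ∀ j < n, s'.nats 2 j = j := by
  let I : ℕ → State → Prop := fun i s' => Frame [2, 4] s s' ∧ s'.nats 4 0 = i ∧
    ∀ j < i, s'.nats 2 j = j
  refine (Computes.count (I := I) (N := n) (j₀ := 0) (c := 20)
    (Nat.zero_le _) ?_ ?_ ?_).mono ?_ ?_
  · exact ⟨Frame.refl _ s, h4, fun j hj => by omega⟩
  · rintro i s' ⟨hF, h4, -⟩
    simp only [Test.Holds, NatExp.eval, h4, hF.2 0 (by simp), hn]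
  · rintro i s' hi ⟨hF, h4, hA⟩
    refine (Computes.straight (by simp [Program.IsStraight]) ?_).mono
      (by simp [NatExp.cost, Program.maxCost]) fun _ h => h
    simp (disch := decide) only [Program.exec, NatExp.eval, State.nats_writeNat_of_ne, h4]
    refine ⟨(hF.writeNat (by simp) _ _).writeNat (by simp) _ _, by simp, fun j hj => ?_⟩
    simp (disch := decide) only [State.nats_writeNat_of_ne, State.nats_writeNat_self,
      Function.update_apply]
    split_ifs with hji
    · exact hji.symm
    · exact hA j (by omega)
  · simp only [NatExp.cost, Test.cost]
    omega
  · rintro s' ⟨hF, -, hA⟩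
    exact ⟨hF, hA⟩

theorem baseArcs_spec (s : State) {n o : ℕ} (hn : s.nats 0 0 = n) (ho : s.nats 3 0 = o) :
    Computes baseArcs s (100 * (n - o + 1)) fun s' => Frame [4, 10, 11, 12] s s' ∧
      ∀ i, o + i < n → EarArcs (s'.nats 10) (s'.nats 11) (s'.nats 12) (o + i) i := by
  let I : ℕ → State → Prop := fun i s' => Frame [4, 10, 11, 12] s s' ∧ s'.nats 4 0 = i ∧
    ∀ j < i, EarArcs (s'.nats 10) (s'.nats 11) (s'.nats 12) (o + j) j
  refine (Computes.setNat_seq (Computes.count (I := I) (N := n - o) (j₀ := 0) (c := 80)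
    (Nat.zero_le _) ?_ ?_ ?_)).mono ?_ ?_
  · exact ⟨(Frame.refl _ s).writeNat (by simp) _ _, by simp [NatExp.eval], fun j hj => by omega⟩
  · rintro i s' ⟨hF, h4, -⟩
    simp only [Test.Holds, NatExp.eval, h4, hF.2 0 (by simp), hF.2 3 (by simp), hn, ho]
    omega
  · rintro i s' hi ⟨hF, h4, hA⟩
    have h3 : s'.nats 3 0 = o := by rw [hF.2 3 (by simp), ho]
    refine (Computes.straight (by simp [Program.IsStraight]) ?_).mono
      (by simp [NatExp.cost, Program.maxCost]) fun _ h => h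
    simp (disch := decide) only [Program.exec, NatExp.eval, State.nats_writeNat_of_ne, h4, h3]
    refine ⟨((((hF.writeNat (by simp) _ _).writeNat (by simp) _ _).writeNat (by simp) _
      _).writeNat (by simp) _ _), by simp, fun j hj => ?_⟩
    simp (disch := decide) only [EarArcs, State.nats_writeNat_of_ne, State.nats_writeNat_self,
      Function.update_apply, Nat.add_left_cancel_iff]
    split_ifs with hji
    · omega
    · exact hA j (by omega)
  · simp only [NatExp.cost, Test.cost]
    omega
  · rintro s' ⟨hF, -, hA⟩
    exact ⟨hF, fun i hi => hA i (by omega)⟩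

theorem checkAll_spec {f : ℕ → ℝ × ℝ} {n : ℕ} (hf : Set.InjOn f (Set.Ico 0 n)) {s : State}
    (hpt : s.pt = f) (hn : s.nats 0 0 = n) (ho : s.nats 3 0 ≤ n) (ho' : n ≤ s.nats 3 0 + 2)
    (hl : Layered f n (s.nats 3 0)) :
    Computes checkAll s (2100 * n + 400) fun s' => s'.nats 1 0 ≤ 1 ∧
      (s'.nats 1 0 = 1 ↔ IsNestedAlmostConvex (f '' Set.Ico 0 n)) := by
  set o := s.nats 3 0 with hodef
  refine (Computes.seq (T' := 2010 * o + 30) (baseArcs_spec s hn rfl) fun s1 ⟨hF1, harcs⟩ =>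
    (Computes.setNat_seq (Computes.setNat_seq (Computes.loop (I := CheckInvariant f n)
      (φ := fun s' => 2010 * s'.nats 3 0) ?_ ?_))).mono ?_ ?_).mono (by omega) fun _ h => h
  · have e3 : s1.nats 3 0 = o := by rw [hF1.2 3 (by simp)]
    have e2 : s1.pt = f := by
      rw [← hpt]
      funext j
      rw [State.pt, State.pt, State.point_eq_of_reals_eq hF1.1, hF1.2 2 (by simp)]
    rw [← hodef] at harcs
    constructor <;> simp (disch := decide) only [NatExp.eval, State.nats_writeNat_of_ne,
      State.nats_writeNat_self, Function.update_self, State.pt_writeNat, e3]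
    · exact e2
    · rw [hF1.2 0 (by simp), hn]
    · exact ho
    · exact hl
    · exact le_rfl
    · exact arcSystem_base ho ho' harcs
    · exact fun _ => verified_base ho' harcs
    · refine fun _ => ⟨trivial, fun hpos => expected_base ho' ?_
        (hf.mono (Set.Ico_subset_Ico (Nat.zero_le _) le_rfl)) harcs⟩
      -- The innermost polygon has at least three vertices and `h - 2` points inside, so there is an
      -- innermost point.
      obtain ⟨b, h, h1, -, h2, h3, -⟩ := hl.exists_step hpos
      omega
  · intro s' hI hb
    obtain ⟨h, h3, hle, hc⟩ := checkLayer_spec hf hI (by simpa [Test.Holds, NatExp.eval] using hb)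
    refine ⟨_, hc.mono le_rfl fun s'' ⟨q1, q2⟩ => ⟨q1, ?_⟩⟩
    simp only [q2, Test.cost, NatExp.cost]
    omega
  · have e3 : s1.nats 3 0 = o := by rw [hF1.2 3 (by simp)]
    simp (disch := decide) only [State.nats_writeNat_of_ne, e3, Test.cost, NatExp.cost]
    omega
  · rintro s' ⟨hI, hb⟩
    have h0 : s'.nats 3 0 = 0 := by
      simp only [Test.Holds, NatExp.eval] at hb
      omega
    refine ⟨hI.answer, fun h1 => ?_, fun h => (hI.complete h).1⟩
    have := (hI.sound h1).nested
    rwa [h0] at this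

/-- The constant in the bound for the running time of `decideNested`. -/
@[irreducible] def decideCost : ℕ := 2 * peelCost + 3000

/-- A bound for the running time of `decideNested`. -/
def decideNestedTime (n : ℕ) : ℕ := decideCost * ((n + 1) * (Nat.log 2 n + 2))

theorem decideCost_bound (c L n : ℕ) :
    30 * (n + 1) + (2 * (c * (L + 2) + 20) * n + 20 + (10 + (2100 * n + 400))) ≤
      (2 * c + 3000) * ((n + 1) * (L + 2)) := by
  have e : (2 * c + 3000) * ((n + 1) * (L + 2)) = 2 * (c * (L + 2)) * n + 2 * (c * (L + 2)) +
    3000 * (n * L) + 6000 * n + 3000 * L + 6000 := by ring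
  have e' : 2 * (c * (L + 2) + 20) * n = 2 * (c * (L + 2)) * n + 40 * n := by ring
  omega

theorem decideNested_spec {n : ℕ} {x : Fin n → ℝ × ℝ} (hx : Function.Injective x) :
    Computes decideNested (input x) (decideNestedTime n) fun s' => s'.nats 1 0 ≤ 1 ∧
      (s'.nats 1 0 = 1 ↔ IsNestedAlmostConvex (Set.range x)) := by
  refine (Computes.seq (T' := 2 * (peelCost * (Nat.log 2 n + 2) + 20) * n + 20 +
      (10 + (2100 * n + 400))) (listPoints_spec (input x) (n := n) (by simp [input])
      (by simp [input])) fun s1 ⟨hF1, hA⟩ => ?_).mono ?_ fun _ h => h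
  swap
  · unfold decideNestedTime decideCost
    exact decideCost_bound _ _ _
  have e0 : s1.nats 0 0 = n := by rw [hF1.2 0 (by simp)]; simp [input]
  have hpt : ∀ i : Fin n, s1.pt i = x i := by
    intro i
    rw [State.pt, State.point_eq_of_reals_eq hF1.1, hA i i.2]
    simp [State.point, input]
  have hrange : s1.pt '' Set.Ico 0 n = Set.range x := by
    ext y
    constructor
    · rintro ⟨i, hi, rfl⟩
      exact ⟨⟨i, hi.2⟩, (hpt ⟨i, hi.2⟩).symm⟩
    · rintro ⟨i, rfl⟩
      exact ⟨i, ⟨Nat.zero_le _, i.2⟩, hpt i⟩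
  have hinj : Set.InjOn s1.pt (Set.Ico 0 n) := by
    intro i hi j hj e
    have := hx ((hpt ⟨i, hi.2⟩).symm.trans (e.trans (hpt ⟨j, hj.2⟩)))
    exact congrArg Fin.val this
  refine (peelAll_spec s1 e0 (by rw [hF1.2 3 (by simp)]; simp [input])
    (by rw [hF1.2 9 (by simp)]; simp [input]) hinj le_rfl).seq
    fun s2 ⟨hF2, hP2, ho, ho', hres⟩ => ?_
  have hp := State.pt_perm hF2 hP2
  have himg : s2.pt '' Set.Ico 0 n = Set.range x := by
    rw [← hrange]
    exact hp.image_eq le_rfl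
  have e20 : s2.nats 0 0 = n := by rw [hF2.2 0 (by simp), e0]
  rw [← himg]
  refine (Computes.branch (T := 2100 * n + 400) (fun hc => ?_) fun hc => Computes.skip ?_).mono
    (by simp only [Test.cost, NatExp.cost]; omega) fun _ h => h
  all_goals simp only [Test.Holds, NatExp.eval] at hc
  · rcases hres with ⟨-, hl⟩ | ⟨h9, -⟩
    · exact checkAll_spec (hp.injOn le_rfl hinj) rfl e20 ho ho' hl
    · omega
  · rcases hres with ⟨h9, -⟩ | ⟨-, hnac⟩
    · omega
    · have e1 : s2.nats 1 0 = 0 := by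
        rw [hF2.2 1 (by simp), hF1.2 1 (by simp)]
        simp [input]
      simp [e1, hnac]

theorem decideNestedTime_isBigO :
    (fun n : ℕ => (decideNestedTime n : ℝ)) =O[atTop] fun n : ℕ => (n : ℝ) * Real.log (n : ℝ) := by
  set K : ℝ := (decideCost : ℝ)
  refine IsBigO.of_bound (K * (2 * (3 / Real.log 2))) ?_
  filter_upwards [eventually_ge_atTop 2] with n hn
  have hn' : (2 : ℝ) ≤ n := by exact_mod_cast hn
  have hlog2 : 0 < Real.log 2 := Real.log_pos (by norm_num)
  have hlogn : Real.log 2 ≤ Real.log n := Real.log_le_log (by norm_num) hn'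
  have hle : (Nat.log 2 n : ℝ) ≤ Real.log n / Real.log 2 := by
    have := Real.natLog_le_logb n 2
    rwa [Real.logb] at this
  have hone : 1 ≤ Real.log n / Real.log 2 := (one_le_div hlog2).mpr hlogn
  have h3 : (Nat.log 2 n : ℝ) + 2 ≤ 3 * (Real.log n / Real.log 2) := by linarith
  have hK : 0 ≤ K := Nat.cast_nonneg _
  rw [Real.norm_of_nonneg (Nat.cast_nonneg _), Real.norm_of_nonneg
    (mul_nonneg (Nat.cast_nonneg _) (by linarith))]
  have e : (decideNestedTime n : ℝ) = K * (((n : ℝ) + 1) * ((Nat.log 2 n : ℝ) + 2)) := by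
    simp only [decideNestedTime, K, Nat.cast_mul, Nat.cast_add, Nat.cast_one, Nat.cast_ofNat]
  rw [e]
  calc K * (((n : ℝ) + 1) * ((Nat.log 2 n : ℝ) + 2))
      ≤ K * ((2 * n) * (3 * (Real.log n / Real.log 2))) := by
        refine mul_le_mul_of_nonneg_left (mul_le_mul (by linarith) h3 (by positivity)
          (by positivity)) hK
    _ = _ := by ring

end RealRAM

theorem mainTheorem4 :
    ∃ (P : RealRAM.Program) (T : ℕ → ℕ),
      (fun n : ℕ => (T n : ℝ)) =O[atTop] (fun n : ℕ => (n : ℝ) * Real.log (n : ℝ)) ∧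
      RealRAM.DecidesInTime P IsNestedAlmostConvex T := by
  refine ⟨RealRAM.decideNested, RealRAM.decideNestedTime, RealRAM.decideNestedTime_isBigO,
    fun n x hx => ?_⟩
  obtain ⟨t, s, hr, ht, h1, h2⟩ := RealRAM.decideNested_spec hx
  exact ⟨t, s, hr, ht, h2.mpr, fun h => by
    have : s.nats 1 0 ≠ 1 := fun e => h (h2.mp e)
    rw [RealRAM.State.answer]
    omega⟩
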